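/- **Setting.** Let $Y=f^*+\varepsilon\in\mathbb R^n$ be a Gaussian vector with independent components, $Y\sim N(f^*,\Sigma)$, $\Sigma=\mathrm{diag}(\sigma_1^2,\dots,\sigma_n^2)$ with all $\sigma_i>0$. Let $\Psi$ be a $p\times n$ matrix with columns $\Psi_1,\dots,\Psi_n$ such that $S=\Psi\Sigma\Psi^\top$ is non-degenerate. Let $W$ be a $q\times p$ matrix, $\mathcal M$ a finite set of reals, and for $m\in\mathcal M$ let $\Psi_m=L_m\Psi$ for some $p\times p$ matrix $L_m$ (for instance a projector), $K_m=W(\Psi_m\Psi_m^\top)^{-1}\Psi_m$ (Moore–Penrose pseudo-inverse if degenerate), $K_{m,m^\circ}=K_m-K_{m^\circ}$ and $\xi_{m,m^\circ}=K_{m,m^\circ}\varepsilon$. Let $\Pi$ be an $n\times n$ matrix (presmoothing operator), put $B=\Sigma^{-1/2}(f^*-\Pi f^*)$ and $\Upsilon=\Sigma^{-1/2}\Pi\Sigma^{1/2}$, with rows $\Upsilon_i^\top$, and assume $$\delta_1=\bigl\|\mathrm{Var}\bigl(\Sigma^{-1/2}(\varepsilon-\Pi\varepsilon)\bigr)-I_n\bigr\|_{\mathrm{op}}\le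 1 .$$ Let $\delta_\Psi$ be a number with $$\max_{i}\|S^{-1/2}\Psi_i\|\,\sigma_i\le\delta_\Psi ,\qquad \|\Upsilon_i\|\le\delta_\Psi\quad(i=1,\dots,n).$$ **Bootstrap calibration.** Given $Y$, let $w\sim N(0,I_n)$ under $P^\flat$ and $\xi^\flat_{m,m^\circ}=K_{m,m^\circ}\,\mathrm{diag}(Y-\Pi Y)\,w$. Let $z^\flat_{m,m^\circ}(t)$ be the smallest $z\ge 0$ with $P^\flat(\|\xi^\flat_{m,m^\circ}\|>z)\le e^{-t}$, and for $x>0$ let $q^\flat_{m^\circ}=q^\flat_{m^\circ}(x)$ be the infimum of all $q$ with $$P^\flat\Bigl(\bigcup_{m\in\mathcal M,\,m>m^\circ}\bigl\{\|\xi^\flat_{m,m^\circ}\|\ge z^\flat_{m,m^\circ}(x+q)\bigr\}\Bigr)\le e^{-x}.$$ (When the laws of the $\|\xi^\flat_{m,m^\circ}\|$ are continuous and there is at least one $m>m^\circ$, both relations hold with equality, for $t>0$ in the first one.) **Theorem.** Let $x>0$ and $m^\circ\in\mathcal M$, and suppose $K_{m,m^\circ}\neq0$ for all $m\in\mathcal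 M$ with $m>m^\circ$ (that is, the distribution of each $\|\xi_{m,m^\circ}\|$ is continuous). Then $$\mathbb P\Bigl(\max_{m\in\mathcal M,\,m>m^\circ}\bigl\{\|\xi_{m,m^\circ}\|-z^\flat_{m,m^\circ}(x+q^\flat_{m^\circ})\bigr\}\ge 0\Bigr)\le 6e^{-x}+\sqrt p\,\Delta_0(x),$$ where the event is empty if there is no $m>m^\circ$ in $\mathcal M$ and, with $x_n=x+\log n$ and $x_p=x+\log(2p)$, $$\Delta_0(x)=\|B\|_\infty^2+\delta_\Psi^2\|B\|\sqrt{2x}+2\delta_\Psi x_n+\delta_\Psi^2x_n+2\delta_\Psi\sqrt{x_p}+2\delta_\Psi^2x_p .$$ -/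

import Mathlib

open MeasureTheory ProbabilityTheory

noncomputable section

namespace SmA

/-- Euclidean norm of a coordinate vector. -/
def eucNorm {k : ℕ} (v : Fin k → ℝ) : ℝ :=
  ‖(WithLp.toLp 2 v : EuclideanSpace ℝ (Fin k))‖

/-- Moore-Penrose pseudo-inverse of a symmetric matrix: the spectral function `t ↦ 1/t` for
`t ≠ 0` and `0 ↦ 0` (recall `0⁻¹ = 0`) is applied through the functional calculus. -/
def symPinv {p : ℕ} (A : Matrix (Fin p) (Fin p) ℝ) : Matrix (Fin p) (Fin p) ℝ :=
  cfc (fun t : ℝ => t⁻¹) A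

/-- `A ^ (-1/2)` for a symmetric positive definite matrix, by the functional calculus. -/
def invSqrt {p : ℕ} (A : Matrix (Fin p) (Fin p) ℝ) : Matrix (Fin p) (Fin p) ℝ :=
  cfc (fun t : ℝ => (Real.sqrt t)⁻¹) A

/-! ### The estimators -/

/-- `K_m = W S_m` with the least squares smoother `S_m = (Ψ_m Ψ_mᵀ)⁻¹ Ψ_m`
(pseudo-inverse if `Ψ_m Ψ_mᵀ` is degenerate). -/
def estMat {p n q : ℕ} (W : Matrix (Fin q) (Fin p) ℝ) (Ψm : Matrix (Fin p) (Fin n) ℝ) :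
    Matrix (Fin q) (Fin n) ℝ :=
  W * (symPinv (Ψm * Ψm.transpose) * Ψm)

/-- `K_{m,m'} = K_m - K_{m'}`. -/
def estDiff {p n q : ℕ} (W : Matrix (Fin q) (Fin p) ℝ)
    (Ψs : ℝ → Matrix (Fin p) (Fin n) ℝ) (m m' : ℝ) : Matrix (Fin q) (Fin n) ℝ :=
  estMat W (Ψs m) - estMat W (Ψs m')

/-! ### Design regularity, presmoothing bias and noise -/

/-- The noise covariance `Σ = diag(σ₁², …, σₙ²)`. -/
def noiseCov {n : ℕ} (σ : Fin n → ℝ) : Matrix (Fin n) (Fin n) ℝ :=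
  Matrix.diagonal fun i => σ i ^ 2

/-- `Σ^{1/2}`. -/
def noiseSd {n : ℕ} (σ : Fin n → ℝ) : Matrix (Fin n) (Fin n) ℝ :=
  Matrix.diagonal σ

/-- `Σ^{-1/2}`. -/
def noiseSdInv {n : ℕ} (σ : Fin n → ℝ) : Matrix (Fin n) (Fin n) ℝ :=
  Matrix.diagonal fun i => (σ i)⁻¹

/-- `S = Ψ Σ Ψᵀ = ∑ i, σ_i² Ψ_i Ψ_iᵀ`. -/
def scoreCov {p n : ℕ} (Ψ : Matrix (Fin p) (Fin n) ℝ) (σ : Fin n → ℝ) :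
    Matrix (Fin p) (Fin p) ℝ :=
  Ψ * noiseCov σ * Ψ.transpose

/-- The design regularity `max_i ‖S^{-1/2} Ψ_i‖ σ_i`, where `Ψ_i` is the `i`-th column of `Ψ`. -/
def designReg {p n : ℕ} (Ψ : Matrix (Fin p) (Fin n) ℝ) (σ : Fin n → ℝ) : ℝ :=
  ⨆ i : Fin n, eucNorm ((invSqrt (scoreCov Ψ σ)).mulVec fun j => Ψ j i) * σ i

/-- `Σ^{-1/2} (v - Π v)`: the presmoothing bias `B` for `v = f`, and the smoothed noise
for `v = ε`. -/
def presmoothed {n : ℕ} (σ : Fin n → ℝ) (Pi : Matrix (Fin n) (Fin n) ℝ) (v : Fin n → ℝ) :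
    Fin n → ℝ :=
  (noiseSdInv σ).mulVec (v - Pi.mulVec v)

/-- The operator norm of `Var(Σ^{-1/2}(ε - Π ε)) - I`. -/
def noiseDev {Ω : Type*} [MeasurableSpace Ω] (P : Measure Ω) {n : ℕ} (σ : Fin n → ℝ)
    (Pi : Matrix (Fin n) (Fin n) ℝ) (ε : Ω → Fin n → ℝ) : ℝ :=
  ‖Matrix.toEuclideanCLM (n := Fin n) (𝕜 := ℝ)
    ((Matrix.of fun i j : Fin n =>
      cov[fun ω => presmoothed σ Pi (ε ω) i, fun ω => presmoothed σ Pi (ε ω) j; P]) - 1)‖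

/-- `Υ = Σ^{-1/2} Π Σ^{1/2}`. -/
def upsilon {n : ℕ} (σ : Fin n → ℝ) (Pi : Matrix (Fin n) (Fin n) ℝ) :
    Matrix (Fin n) (Fin n) ℝ :=
  noiseSdInv σ * Pi * noiseSd σ

/-! ### The bootstrap world -/

/-- The law `N(0, I_n)` of the vector of bootstrap weights. -/
def weightLaw (n : ℕ) : Measure (Fin n → ℝ) :=
  Measure.pi fun _ : Fin n => gaussianReal 0 1

/-- The bootstrap stochastic term `K diag(y - Π y) w` for data `y` and weights `w`. -/
def bootXi {n q : ℕ} (K : Matrix (Fin q) (Fin n) ℝ) (Pi : Matrix (Fin n) (Fin n) ℝ)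
    (y w : Fin n → ℝ) : Fin q → ℝ :=
  K.mulVec ((Matrix.diagonal (y - Pi.mulVec y)).mulVec w)

/-- The bootstrap quantile `z(t)`: the smallest `z ≥ 0` such that, under the law of the weights
with the data `y` fixed, `P(‖ξ‖ > z) ≤ exp (-t)`. For `t > 0`, if the law of `‖ξ‖` is continuous,
this is the solution of `P(‖ξ‖ > z) = exp (-t)`. -/
def bootQuantile {n q : ℕ} (K : Matrix (Fin q) (Fin n) ℝ) (Pi : Matrix (Fin n) (Fin n) ℝ)
    (y : Fin n → ℝ) (t : ℝ) : ℝ :=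
  sInf {z : ℝ | 0 ≤ z ∧
    (weightLaw n).real {w | z < eucNorm (bootXi K Pi y w)} ≤ Real.exp (-t)}

/-- Probability, under the law of the weights with the data `y` fixed, that
`‖ξ_{m,m₀}‖ ≥ z_{m,m₀}(s)` for some `m > m₀` in `M`, where `z` is the bootstrap quantile. -/
def bootExceed {n q : ℕ} (M : Finset ℝ) (K : ℝ → ℝ → Matrix (Fin q) (Fin n) ℝ)
    (Pi : Matrix (Fin n) (Fin n) ℝ) (y : Fin n → ℝ) (m₀ s : ℝ) : ℝ :=
  (weightLaw n).real
    (⋃ m ∈ {m ∈ M | m₀ < m},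
      {w | bootQuantile (K m m₀) Pi y s ≤ eucNorm (bootXi (K m m₀) Pi y w)})

/-- The bootstrap multiplicity correction `q_{m₀}(x)`: the smallest `q` for which the probability
that some `‖ξ_{m,m₀}‖`, `m > m₀`, reaches `z_{m,m₀}(x + q)` is at most `exp (-x)`. If there is some
`m > m₀` and the laws of all these norms are continuous, this probability depends continuously
and monotonically on `q`, and `q_{m₀}(x)` makes it equal to `exp (-x)`. -/
def bootCorrection {n q : ℕ} (M : Finset ℝ) (K : ℝ → ℝ → Matrix (Fin q) (Fin n) ℝ)
    (Pi : Matrix (Fin n) (Fin n) ℝ) (y : Fin n → ℝ) (m₀ x : ℝ) : ℝ :=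
  sInf {c : ℝ | bootExceed M K Pi y m₀ (x + c) ≤ Real.exp (-x)}

/-! ### The error term -/

/-- The error term `Δ₀(x)`. The norm `‖B‖` of a function `B : Fin n → ℝ` is the sup-norm. -/
def errorTerm (n p : ℕ) (B : Fin n → ℝ) (δ x : ℝ) : ℝ :=
  ‖B‖ ^ 2 + δ ^ 2 * eucNorm B * Real.sqrt (2 * x)
    + 2 * δ * (x + Real.log n) + δ ^ 2 * (x + Real.log n)
    + 2 * δ * Real.sqrt (x + Real.log (2 * p)) + 2 * δ ^ 2 * (x + Real.log (2 * p))

end SmA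

end

/-!
Let `g = Σ^{-1/2} ε`, a standard Gaussian vector, and let `U = S^{-1/2} Ψ Σ^{1/2}`, whose rows are
orthonormal and whose columns `uᵢ` have norm at most `δ`. All the matrices `K_{m,m₀}` factor
through `Ψ`, so that `ξ_{m,m₀} = A_m U g` for some matrices `A_m`, while the bootstrap counterpart
is `A_m U diag(η) w` with `η = B + g - Υ g`. Since `U g` is standard Gaussian in dimension `p`, the
bootstrap replaces the identity covariance by the random matrix `V = ∑ ηᵢ² uᵢuᵢᵀ`.

The first step is to see that `αm² ≤ V ≤ αp²` in the semidefinite order outside of an event of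
probability `3 e^{-x}`, for explicit `αm`, `αp` close to one (`weightLaw_not_inflation_le`). The
matrix `∑ ((gᵢ + Bᵢ)² - 1 - Bᵢ²) uᵢuᵢᵀ` obeys a Laurent–Massart bound
(`weightLaw_quadratic_deviation_le`). Its exponential moments are controlled by adding the
summands one at a time, using a Golden–Thompson inequality for rank-one perturbations, proved by
spectral calculus without the general trace inequality. The term `Υ g` is bounded in sup-norm, and
it enters through the triangle inequality in a weighted `ℓ²` norm.

The second step is a deterministic comparison of quantiles on this event. By Anderson's inequality,
deduced from the Prékopa–Leindler inequality for the Gaussian measure, a larger covariance matrix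
makes symmetric convex sets less likely (`weightLaw_le_of_covariance_le`). Therefore the bootstrap
quantiles lie between `αm z_m` and `αp z_m`, where `z_m` are the quantiles of `‖A_m v‖` for `v`
standard Gaussian, and the joint exceedance probabilities are ordered likewise. Consequently the
calibrated bootstrap quantiles are at least `αm z_m(s₀)`, where the level `s₀` is *deterministic*:
it is the infimum of the `s` such that `P(∃ m, αm ‖A_m v‖ ≥ αp z_m(s)) ≤ e^{-x}`
(`mul_normQuantile_le_calibrated`). This removes the dependence between the data that calibrate the
bootstrap and the statistic that is tested.

Finally the event that some `‖A_m U g‖` exceeds `αm z_m(s₀)` differs from the one defining `s₀` by a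
dilation of a set of vectors by `αp / αm²`, and dilating changes the Gaussian measure of a set by
at most `√(p / 2) log (αp / αm²)` (`weightLaw_dilate_le`). When the asserted bound is less than one,
the inequality `p ≤ n δ²` forces `x + log n ≥ 6`, and the logarithm is then at most the error
term (`sqrt_mul_log_inflation_le`).
-/

namespace SmA

/-! ### The Prékopa–Leindler inequality for the standard Gaussian measure -/

/-- One-dimensional Brunn–Minkowski inequality for compact sets: the translates `min L + K` and
`max K + L` lie in `K + L` and share a single point. -/
lemma volume_add_volume_le_of_isCompact {K L C : Set ℝ} (hK : IsCompact K) (hL : IsCompact L)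
    (hK0 : K.Nonempty) (hL0 : L.Nonempty) (h : ∀ a ∈ K, ∀ b ∈ L, a + b ∈ C) :
    volume K + volume L ≤ volume C := by
  obtain ⟨a, ha, haK⟩ := hK.exists_isGreatest hK0
  obtain ⟨b, hb, hbL⟩ := hL.exists_isLeast hL0
  have h1 : volume ((fun x => x + b) '' K) = volume K := by
    simp [Set.image_add_right]
  have h2 : volume ((fun x => a + x) '' L) = volume L := by
    simp [Set.image_add_left]
  have hm1 : MeasurableSet ((fun x => a + x) '' L) :=
    (hL.image (by fun_prop)).measurableSet
  have hd : AEDisjoint volume ((fun x => x + b) '' K) ((fun x => a + x) '' L) := by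
    refine measure_mono_null (t := {a + b}) ?_ (by simp)
    rintro _ ⟨⟨x, hx, rfl⟩, ⟨y, hy, hxy⟩⟩
    have := haK hx
    have := hbL hy
    simp only [Set.mem_singleton_iff] at *
    linarith
  rw [← h1, ← h2, ← measure_union₀ hm1.nullMeasurableSet hd]
  apply measure_mono
  rintro _ (⟨x, hx, rfl⟩ | ⟨x, hx, rfl⟩)
  · exact h x hx b hb
  · exact h a ha x hx

lemma volume_add_volume_le {A B C : Set ℝ} (hA : MeasurableSet A) (hB : MeasurableSet B)
    (hA0 : A.Nonempty) (hB0 : B.Nonempty) (h : ∀ a ∈ A, ∀ b ∈ B, a + b ∈ C) :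
    volume A + volume B ≤ volume C := by
  obtain ⟨a, ha⟩ := hA0
  obtain ⟨b, hb⟩ := hB0
  have key : ∀ K ⊆ A, IsCompact K → ∀ L ⊆ B, IsCompact L → volume K + volume L ≤ volume C := by
    intro K hKA hK L hLB hL
    have := volume_add_volume_le_of_isCompact (C := C) (hK.insert a) (hL.insert b) (by simp)
      (by simp) ?_
    · exact le_trans (add_le_add (measure_mono (Set.subset_insert _ _))
        (measure_mono (Set.subset_insert _ _))) this
    · rintro x hx y hy
      exact h x (Set.insert_subset ha hKA hx) y (Set.insert_subset hb hLB hy)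
  rw [hA.measure_eq_iSup_isCompact, hB.measure_eq_iSup_isCompact]
  simp only [iSup_and']
  refine ENNReal.biSup_add_biSup_le' (p := fun K => K ⊆ A ∧ IsCompact K)
    (q := fun L => L ⊆ B ∧ IsCompact L) ⟨∅, by simp⟩ ⟨∅, by simp⟩ ?_
  rintro K ⟨h1, h2⟩ L ⟨h3, h4⟩
  exact key K h1 h2 L h3 h4

lemma mul_le_sq_of_add_le {a b c : ENNReal} (h : a + b ≤ 2 * c) : a * b ≤ c ^ 2 := by
  rcases eq_or_ne c ⊤ with rfl | hc
  · simp
  have hab : a + b ≠ ⊤ := ne_top_of_le_ne_top (by finiteness) h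
  have ha : a ≠ ⊤ := fun h => hab (by simp [h])
  have hb : b ≠ ⊤ := fun h => hab (by simp [h])
  lift a to NNReal using ha
  lift b to NNReal using hb
  lift c to NNReal using hc
  norm_cast at h ⊢
  rw [← NNReal.coe_le_coe] at h ⊢
  push_cast at *
  nlinarith [sq_nonneg ((a : ℝ) - b), a.2, b.2, c.2]

/-- Prékopa–Leindler on the line for functions of supremum one, in the stronger arithmetic form:
superlevel sets obey the Brunn–Minkowski inequality. -/
lemma lintegral_add_le_of_sup_one {f g h : ℝ → ℝ} (hf : Measurable f) (hg : Measurable g)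
    (hh : Measurable h) (hf0 : 0 ≤ f) (hg0 : 0 ≤ g) (hh0 : 0 ≤ h)
    (hf1 : ∀ x, f x ≤ 1) (hg1 : ∀ x, g x ≤ 1) (hfs : ∀ t < 1, ∃ x, t < f x)
    (hgs : ∀ t < 1, ∃ x, t < g x) (hfgh : ∀ x y, f x * g y ≤ h ((x + y) / 2) ^ 2) :
    (∫⁻ x, ENNReal.ofReal (f x)) + ∫⁻ x, ENNReal.ofReal (g x)
      ≤ 2 * ∫⁻ x, ENNReal.ofReal (h x) := by
  rw [lintegral_eq_lintegral_meas_lt _ (.of_forall hf0) hf.aemeasurable,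
    lintegral_eq_lintegral_meas_lt _ (.of_forall hg0) hg.aemeasurable,
    lintegral_eq_lintegral_meas_lt _ (.of_forall hh0) hh.aemeasurable,
    ← lintegral_const_mul', ← lintegral_add_left']
  rotate_left
  · refine (Antitone.measurable ?_).aemeasurable
    intro s t hst
    exact measure_mono fun x (hx : t < f x) => lt_of_le_of_lt hst hx
  · simp
  refine setLIntegral_mono' measurableSet_Ioi fun t ht => ?_
  have ht0 : (0 : ℝ) < t := ht
  rcases le_or_gt 1 t with h1 | h1
  · have e1 : {a | t < f a} = ∅ := by
      ext x; simp; linarith [hf1 x]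
    have e2 : {a | t < g a} = ∅ := by
      ext x; simp; linarith [hg1 x]
    simp [e1, e2]
  have hC : volume {c : ℝ | t < h (c / 2)} = 2 * volume {a | t < h a} := by
    have := Real.volume_preimage_mul_left (a := 1 / 2) (by norm_num) {a | t < h a}
    convert this using 2
    · ext c; simp; ring_nf
    · norm_num
  rw [← hC]
  refine volume_add_volume_le (measurableSet_lt measurable_const hf)
    (measurableSet_lt measurable_const hg) (hfs t h1) (hgs t h1) ?_
  intro a ha b hb
  simp only [Set.mem_ofPred_eq] at *
  refine lt_of_pow_lt_pow_left₀ 2 (hh0 _) (lt_of_lt_of_le ?_ (hfgh a b))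
  nlinarith

/-- Prékopa–Leindler on the line: rescaling `f`, `g` to supremum one reduces to the arithmetic form,
which implies the multiplicative one by the inequality between the two means. -/
lemma lintegral_mul_lintegral_le_sq {f g h : ℝ → ℝ} (hf : Measurable f) (hg : Measurable g)
    (hh : Measurable h) (hf0 : 0 ≤ f) (hg0 : 0 ≤ g) (hh0 : 0 ≤ h)
    (hfb : BddAbove (Set.range f)) (hgb : BddAbove (Set.range g))
    (hfgh : ∀ x y, f x * g y ≤ h ((x + y) / 2) ^ 2) :
    (∫⁻ x, ENNReal.ofReal (f x)) * ∫⁻ x, ENNReal.ofReal (g x)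
      ≤ (∫⁻ x, ENNReal.ofReal (h x)) ^ 2 := by
  set A := sSup (Set.range f) with hA
  set B := sSup (Set.range g) with hB
  have hfA : ∀ x, f x ≤ A := fun x => le_csSup hfb ⟨x, rfl⟩
  have hgB : ∀ x, g x ≤ B := fun x => le_csSup hgb ⟨x, rfl⟩
  rcases eq_or_lt_of_le ((hf0 0).trans (hfA 0)) with h0 | hA0
  · have : ∀ x, f x = 0 := fun x => le_antisymm (by simpa [← h0] using hfA x) (hf0 x)
    simp [this]
  rcases eq_or_lt_of_le ((hg0 0).trans (hgB 0)) with h0 | hB0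
  · have : ∀ x, g x = 0 := fun x => le_antisymm (by simpa [← h0] using hgB x) (hg0 x)
    simp [this]
  simp only [Pi.zero_apply] at hA0 hB0
  set R := √(A * B)
  have hR : 0 < R := Real.sqrt_pos.2 (by positivity)
  have hR2 : R ^ 2 = A * B := Real.sq_sqrt (by positivity)
  have sup : ∀ {u : ℝ → ℝ} {S : ℝ}, S = sSup (Set.range u) → 0 < S → ∀ t < 1, ∃ x, t < u x / S := by
    intro u S hS hS0 t ht
    have : t * S < sSup (Set.range u) := by rw [← hS]; nlinarith
    obtain ⟨_, ⟨x, rfl⟩, hx⟩ := exists_lt_of_lt_csSup (Set.range_nonempty u) this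
    exact ⟨x, by rwa [lt_div_iff₀ hS0]⟩
  have key := mul_le_sq_of_add_le (lintegral_add_le_of_sup_one (f := fun x => f x / A)
    (g := fun x => g x / B) (h := fun x => h x / R) (by fun_prop) (by fun_prop) (by fun_prop)
    (fun x => div_nonneg (hf0 x) hA0.le) (fun x => div_nonneg (hg0 x) hB0.le)
    (fun x => div_nonneg (hh0 x) hR.le) (fun x => (div_le_one hA0).2 (hfA x))
    (fun x => (div_le_one hB0).2 (hgB x)) (sup hA hA0) (sup hB hB0) ?_)
  · have e : ∀ {u : ℝ → ℝ} {S : ℝ}, 0 < S → ∫⁻ x, ENNReal.ofReal (u x)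
        = ENNReal.ofReal S * ∫⁻ x, ENNReal.ofReal (u x / S) := by
      intro u S hS
      rw [← lintegral_const_mul' _ _ (by simp)]
      refine lintegral_congr fun x => ?_
      rw [← ENNReal.ofReal_mul hS.le]
      congr 1
      field_simp
    rw [e (u := f) hA0, e (u := g) hB0, e (u := h) hR, mul_pow, mul_mul_mul_comm,
      ← ENNReal.ofReal_mul hA0.le, ← hR2, ← ENNReal.ofReal_pow hR.le]
    gcongr
  · intro x y
    rw [div_mul_div_comm, div_pow, hR2]
    gcongr
    exact hfgh x y

/-- Prékopa–Leindler for the Gaussian measure on the line, whose density is log-concave. -/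
lemma lintegral_gaussianReal_mul_le_sq {f g h : ℝ → ENNReal} (hf : Measurable f)
    (hg : Measurable g) (hh : Measurable h) (hf1 : ∀ x, f x ≤ 1) (hg1 : ∀ x, g x ≤ 1)
    (hh1 : ∀ x, h x ≤ 1) (hfgh : ∀ x y, f x * g y ≤ h ((x + y) / 2) ^ 2) :
    (∫⁻ x, f x ∂gaussianReal 0 1) * ∫⁻ x, g x ∂gaussianReal 0 1
      ≤ (∫⁻ x, h x ∂gaussianReal 0 1) ^ 2 := by
  have e : ∀ {u : ℝ → ENNReal}, Measurable u → (∀ x, u x ≤ 1) → ∫⁻ x, u x ∂gaussianReal 0 1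
      = ∫⁻ x, ENNReal.ofReal (gaussianPDFReal 0 1 x * (u x).toReal) := by
    intro u hu hu1
    rw [gaussianReal_of_var_ne_zero _ one_ne_zero,
      lintegral_withDensity_eq_lintegral_mul _ (measurable_gaussianPDF 0 1) hu]
    refine lintegral_congr fun x => ?_
    rw [ENNReal.ofReal_mul (gaussianPDFReal_nonneg _ _ _),
      ENNReal.ofReal_toReal (ne_top_of_le_ne_top ENNReal.one_ne_top (hu1 x))]
    rfl
  have r1 : ∀ {u : ℝ → ENNReal}, (∀ x, u x ≤ 1) → ∀ x, (u x).toReal ≤ 1 := fun hu x =>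
    ENNReal.toReal_le_of_le_ofReal zero_le_one (by simpa using hu x)
  have hmm : Measurable (gaussianPDFReal 0 1) := measurable_gaussianPDFReal 0 1
  have bdd : ∀ {u : ℝ → ENNReal}, (∀ x, u x ≤ 1) →
      BddAbove (Set.range fun x => gaussianPDFReal 0 1 x * (u x).toReal) := by
    intro u hu
    refine ⟨(√(2 * Real.pi * 1))⁻¹, ?_⟩
    rintro _ ⟨x, rfl⟩
    have : gaussianPDFReal 0 1 x ≤ (√(2 * Real.pi * 1))⁻¹ := by
      rw [gaussianPDFReal]
      refine mul_le_of_le_one_right (by positivity) ?_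
      rw [Real.exp_le_one_iff]
      apply div_nonpos_of_nonpos_of_nonneg
      · simp; positivity
      · simp
    exact (mul_le_of_le_one_right (gaussianPDFReal_nonneg _ _ _) (r1 hu x)).trans this
  rw [e hf hf1, e hg hg1, e hh hh1]
  refine lintegral_mul_lintegral_le_sq (by fun_prop) (by fun_prop) (by fun_prop) ?_ ?_ ?_
    (bdd hf1) (bdd hg1) ?_
  · exact fun x => mul_nonneg (gaussianPDFReal_nonneg _ _ _) ENNReal.toReal_nonneg
  · exact fun x => mul_nonneg (gaussianPDFReal_nonneg _ _ _) ENNReal.toReal_nonneg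
  · exact fun x => mul_nonneg (gaussianPDFReal_nonneg _ _ _) ENNReal.toReal_nonneg
  intro x y
  rw [mul_mul_mul_comm, mul_pow]
  refine mul_le_mul ?_ ?_ (by positivity) (by positivity)
  · simp only [gaussianPDFReal, mul_pow, mul_mul_mul_comm _ (Real.exp _), ← Real.exp_add,
      ← sq, ← Real.exp_nat_mul]
    gcongr
    simp
    nlinarith [sq_nonneg (x - y)]
  · rw [← ENNReal.toReal_mul, ← ENNReal.toReal_pow]
    exact ENNReal.toReal_mono (ENNReal.pow_ne_top
      (ne_top_of_le_ne_top ENNReal.one_ne_top (hh1 _))) (hfgh x y)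

lemma lintegral_weightLaw_succ {n : ℕ} {f : (Fin (n + 1) → ℝ) → ENNReal} (hf : Measurable f) :
    ∫⁻ x, f x ∂weightLaw (n + 1)
      = ∫⁻ t, ∫⁻ x, f (Fin.cons t x) ∂weightLaw n ∂gaussianReal 0 1 := by
  have hp := (measurePreserving_piFinSuccAbove (fun _ : Fin (n + 1) => gaussianReal 0 1) 0).symm
  unfold weightLaw
  rw [← hp.lintegral_comp hf, lintegral_prod _ (by
    exact (hf.comp (MeasurableEquiv.measurable _)).aemeasurable)]
  simp [MeasurableEquiv.piFinSuccAbove_symm_apply, Fin.insertNthEquiv]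

instance (n : ℕ) : IsProbabilityMeasure (weightLaw n) := by
  unfold weightLaw; infer_instance

lemma measurable_cons {n : ℕ} :
    Measurable fun z : ℝ × (Fin n → ℝ) => (Fin.cons z.1 z.2 : Fin (n + 1) → ℝ) := by
  refine measurable_pi_lambda _ fun i => ?_
  refine Fin.cases ?_ (fun j => ?_) i
  · simpa using measurable_fst
  · simp only [Fin.cons_succ]
    exact (measurable_pi_apply j).comp measurable_snd

/-- Prékopa–Leindler inequality for the standard Gaussian measure, by integrating out one
coordinate at a time. -/
theorem lintegral_weightLaw_mul_le_sq {n : ℕ} {f g h : (Fin n → ℝ) → ENNReal} (hf : Measurable f)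
    (hg : Measurable g) (hh : Measurable h) (hf1 : ∀ x, f x ≤ 1) (hg1 : ∀ x, g x ≤ 1)
    (hh1 : ∀ x, h x ≤ 1) (hfgh : ∀ x y, f x * g y ≤ h ((2 : ℝ)⁻¹ • (x + y)) ^ 2) :
    (∫⁻ x, f x ∂weightLaw n) * ∫⁻ x, g x ∂weightLaw n ≤ (∫⁻ x, h x ∂weightLaw n) ^ 2 := by
  induction n with
  | zero =>
    have e : ∀ u : (Fin 0 → ℝ) → ENNReal, ∫⁻ x, u x ∂weightLaw 0 = u 0 := by
      intro u
      rw [lintegral_unique, measure_univ, mul_one]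
      exact congrArg u (Subsingleton.elim _ _)
    rw [e, e, e]
    simpa using hfgh 0 0
  | succ n ih =>
    have sec : ∀ {u : (Fin (n + 1) → ℝ) → ENNReal}, Measurable u →
        Measurable fun z : ℝ × (Fin n → ℝ) => u (Fin.cons z.1 z.2) := fun hu =>
      hu.comp measurable_cons
    have le1 : ∀ {u : (Fin (n + 1) → ℝ) → ENNReal}, (∀ x, u x ≤ 1) → ∀ t,
        ∫⁻ x, u (Fin.cons t x) ∂weightLaw n ≤ 1 := by
      intro u hu t
      exact (lintegral_mono fun x => hu _).trans (by simp)
    rw [lintegral_weightLaw_succ hf, lintegral_weightLaw_succ hg, lintegral_weightLaw_succ hh]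
    refine lintegral_gaussianReal_mul_le_sq (sec hf).lintegral_prod_right'
      (sec hg).lintegral_prod_right' (sec hh).lintegral_prod_right' (le1 hf1) (le1 hg1) (le1 hh1) ?_
    intro s t
    refine ih ((sec hf).comp measurable_prodMk_left) ((sec hg).comp measurable_prodMk_left)
      ((sec hh).comp measurable_prodMk_left) (fun _ => hf1 _) (fun _ => hg1 _) (fun _ => hh1 _) ?_
    intro x y
    convert hfgh (Fin.cons s x) (Fin.cons t y) using 3
    ext i
    refine Fin.cases ?_ (fun j => ?_) i
    · simp; ring
    · simp [mul_add]

lemma weightLaw_map_neg (n : ℕ) : (weightLaw n).map (fun x => -x) = weightLaw n := by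
  unfold weightLaw
  have := Measure.pi_map_pi (μ := fun _ : Fin n => gaussianReal 0 1) (f := fun _ x => -x)
    (fun _ => by fun_prop)
  simp only [gaussianReal_map_neg, neg_zero] at this
  exact this

/-- Anderson's inequality: translating a linear image of a Gaussian vector does not increase its
probability to lie in a symmetric convex set. -/
theorem weightLaw_translate_le {n k : ℕ} (T : Matrix (Fin k) (Fin n) ℝ) {C : Set (Fin k → ℝ)}
    (hC : MeasurableSet C) (hconv : Convex ℝ C) (hsymm : ∀ v ∈ C, -v ∈ C) (u : Fin k → ℝ) :
    weightLaw n {w | T.mulVec w + u ∈ C} ≤ weightLaw n {w | T.mulVec w ∈ C} := by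
  have hT : Measurable T.mulVec :=
    (Continuous.matrix_mulVec continuous_const continuous_id).measurable
  have hm : ∀ v : Fin k → ℝ, MeasurableSet {w | T.mulVec w + v ∈ C} := fun v =>
    (hT.add_const v) hC
  have h0 : MeasurableSet {w | T.mulVec w ∈ C} := hT hC
  have key := lintegral_weightLaw_mul_le_sq (n := n)
    (f := Set.indicator {w | T.mulVec w + u ∈ C} 1) (g := Set.indicator {w | T.mulVec w + -u ∈ C} 1)
    (h := Set.indicator {w | T.mulVec w ∈ C} 1) (measurable_one.indicator (hm u))
    (measurable_one.indicator (hm (-u))) (measurable_one.indicator h0)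
    (fun x => Set.indicator_le_self' (by simp) x) (fun x => Set.indicator_le_self' (by simp) x)
    (fun x => Set.indicator_le_self' (by simp) x) ?_
  · rw [lintegral_indicator_one (hm u), lintegral_indicator_one (hm (-u)),
      lintegral_indicator_one h0] at key
    have hs : weightLaw n {w | T.mulVec w + -u ∈ C} = weightLaw n {w | T.mulVec w + u ∈ C} := by
      conv_lhs => rw [← weightLaw_map_neg]
      rw [Measure.map_apply (by fun_prop) (hm _)]
      congr 1
      ext w
      simp only [Set.mem_preimage, Set.mem_ofPred_eq, Matrix.mulVec_neg]
      constructor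
      · intro h; simpa [add_comm] using hsymm _ h
      · intro h; simpa [add_comm] using hsymm _ h
    rw [hs, ← sq] at key
    exact (ENNReal.pow_le_pow_left_iff two_ne_zero).1 key
  -- the midpoint of a point of `C - u` and a point of `C + u` lies in `C`
  · intro x y
    by_cases hx : T.mulVec x + u ∈ C
    · by_cases hy : T.mulVec y + -u ∈ C
      · have : T.mulVec ((2 : ℝ)⁻¹ • (x + y)) ∈ C := by
          have := hconv hx hy (a := 2⁻¹) (b := 2⁻¹) (by norm_num) (by norm_num) (by norm_num)
          convert this using 1
          rw [Matrix.mulVec_smul, Matrix.mulVec_add, ← smul_add]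
          congr 1
          abel
        simp only [Set.indicator, Set.mem_ofPred_eq, hx, hy, this]
        simp
      · simp [Set.indicator, hy]
    · simp [Set.indicator, hx]

/-! ### Linear images of the standard Gaussian vector -/

lemma measurable_mulVec {k n : ℕ} (T : Matrix (Fin k) (Fin n) ℝ) : Measurable T.mulVec :=
  (Continuous.matrix_mulVec continuous_const continuous_id).measurable

lemma integral_weightLaw_cexp {n : ℕ} (c : Fin n → ℝ) :
    ∫ w, Complex.exp ((c ⬝ᵥ w : ℝ) * Complex.I) ∂weightLaw n
      = Complex.exp (-((c ⬝ᵥ c : ℝ) : ℂ) / 2) := by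
  have h : ∀ w : Fin n → ℝ, Complex.exp ((c ⬝ᵥ w : ℝ) * Complex.I)
      = ∏ i, Complex.exp ((c i : ℂ) * (w i : ℂ) * Complex.I) := by
    intro w
    rw [← Complex.exp_sum, ← Finset.sum_mul]
    simp [dotProduct]
  have h1 : ∀ t : ℝ, ∫ x : ℝ, Complex.exp ((t : ℂ) * (x : ℂ) * Complex.I) ∂gaussianReal 0 1
      = Complex.exp (-(t : ℂ) ^ 2 / 2) := by
    intro t
    have := charFun_gaussianReal (μ := 0) (v := 1) t
    rw [charFun_apply_real] at this
    rw [this]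
    simp [neg_div]
  simp_rw [h]
  unfold weightLaw
  rw [integral_fintype_prod_eq_prod
    (f := fun i (x : ℝ) => Complex.exp ((c i : ℂ) * (x : ℂ) * Complex.I))]
  simp_rw [h1]
  rw [← Complex.exp_sum, ← Finset.sum_div]
  simp [dotProduct, sq]

lemma strongDual_apply_eq_dotProduct {k : ℕ} (L : StrongDual ℝ (Fin k → ℝ)) (v : Fin k → ℝ) :
    L v = (fun i => L (Pi.single i 1)) ⬝ᵥ v := by
  conv_lhs => rw [← Finset.univ_sum_single v, map_sum]
  refine Finset.sum_congr rfl fun i _ => ?_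
  have : (Pi.single i (v i) : Fin k → ℝ) = v i • Pi.single i 1 := by
    rw [← Pi.single_smul]; simp
  rw [this, map_smul, smul_eq_mul, mul_comm]

/-- If `T₂T₂ᵀ = T₁T₁ᵀ + GGᵀ`, then `T₂w` has the law of `T₁w + Gw'` with `w'` an independent copy
of `w`: the two Gaussian laws have the same characteristic function. -/
lemma weightLaw_map_eq_map_prod {k n₁ n₂ l : ℕ} (T₁ : Matrix (Fin k) (Fin n₁) ℝ)
    (T₂ : Matrix (Fin k) (Fin n₂) ℝ) (G : Matrix (Fin k) (Fin l) ℝ)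
    (h : T₂ * T₂.transpose = T₁ * T₁.transpose + G * G.transpose) :
    (weightLaw n₂).map T₂.mulVec
      = ((weightLaw n₁).prod (weightLaw l)).map fun z => T₁.mulVec z.1 + G.mulVec z.2 := by
  have hm2 := measurable_mulVec T₂
  have hm1 := measurable_mulVec T₁
  have hmG := measurable_mulVec G
  have hm : Measurable fun z : (Fin n₁ → ℝ) × (Fin l → ℝ) => T₁.mulVec z.1 + G.mulVec z.2 :=
    (hm1.comp measurable_fst).add (hmG.comp measurable_snd)
  have := Measure.isProbabilityMeasure_map (μ := weightLaw n₂) hm2.aemeasurable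
  have := Measure.isProbabilityMeasure_map (μ := (weightLaw n₁).prod (weightLaw l)) hm.aemeasurable
  refine Measure.ext_of_charFunDual (funext fun L => ?_)
  set a : Fin k → ℝ := fun i => L (Pi.single i 1) with ha
  have hL : ∀ v, L v = a ⬝ᵥ v := strongDual_apply_eq_dotProduct L
  rw [charFunDual_apply, charFunDual_apply, integral_map hm2.aemeasurable (by fun_prop),
    integral_map hm.aemeasurable (by fun_prop)]
  simp_rw [hL, dotProduct_add, Matrix.dotProduct_mulVec, Complex.ofReal_add, add_mul,
    Complex.exp_add]
  rw [integral_prod_mul (f := fun w => Complex.exp ((Matrix.vecMul a T₁ ⬝ᵥ w : ℝ) * Complex.I))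
    (g := fun w => Complex.exp ((Matrix.vecMul a G ⬝ᵥ w : ℝ) * Complex.I)),
    integral_weightLaw_cexp, integral_weightLaw_cexp, integral_weightLaw_cexp, ← Complex.exp_add]
  have e : ∀ {m : ℕ} (T : Matrix (Fin k) (Fin m) ℝ), Matrix.vecMul a T ⬝ᵥ Matrix.vecMul a T
      = a ⬝ᵥ (T * T.transpose).mulVec a := by
    intro m T
    rw [← Matrix.mulVec_mulVec, Matrix.dotProduct_mulVec, Matrix.mulVec_transpose]
  rw [e, e, e, h, Matrix.add_mulVec, dotProduct_add]
  congr 1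
  push_cast
  ring

/-- The law of `T w`, `w` standard Gaussian, depends on `TTᵀ` only. -/
lemma weightLaw_map_eq {k n₁ n₂ : ℕ} (T₁ : Matrix (Fin k) (Fin n₁) ℝ)
    (T₂ : Matrix (Fin k) (Fin n₂) ℝ) (h : T₂ * T₂.transpose = T₁ * T₁.transpose) :
    (weightLaw n₂).map T₂.mulVec = (weightLaw n₁).map T₁.mulVec := by
  rw [weightLaw_map_eq_map_prod T₁ T₂ (0 : Matrix (Fin k) (Fin 1) ℝ) (by simpa using h)]
  simp only [Matrix.zero_mulVec, add_zero]
  have := Measure.map_map (μ := (weightLaw n₁).prod (weightLaw 1)) (measurable_mulVec T₁)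
    measurable_fst
  simp only [Measure.map_fst_prod, measure_univ, one_smul] at this
  rw [this]
  rfl

lemma dotProduct_mulVec_transpose_self {k n : ℕ} (T : Matrix (Fin k) (Fin n) ℝ) (θ : Fin k → ℝ) :
    θ ⬝ᵥ (T * T.transpose).mulVec θ = T.transpose.mulVec θ ⬝ᵥ T.transpose.mulVec θ := by
  rw [← Matrix.mulVec_mulVec, Matrix.dotProduct_mulVec, Matrix.mulVec_transpose]

open scoped MatrixOrder Matrix.Norms.L2Operator in
/-- Gaussian comparison for symmetric convex sets: enlarging the covariance matrix in the
positive semidefinite order decreases the probability. The larger vector is the smaller one plus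
an independent Gaussian vector, and Anderson's inequality applies conditionally on the latter. -/
theorem weightLaw_le_of_covariance_le {k n₁ n₂ : ℕ} (T₁ : Matrix (Fin k) (Fin n₁) ℝ)
    (T₂ : Matrix (Fin k) (Fin n₂) ℝ)
    (h : ∀ θ, T₁.transpose.mulVec θ ⬝ᵥ T₁.transpose.mulVec θ
      ≤ T₂.transpose.mulVec θ ⬝ᵥ T₂.transpose.mulVec θ)
    {C : Set (Fin k → ℝ)} (hC : MeasurableSet C) (hconv : Convex ℝ C) (hsymm : ∀ v ∈ C, -v ∈ C) :
    weightLaw n₂ {w | T₂.mulVec w ∈ C} ≤ weightLaw n₁ {w | T₁.mulVec w ∈ C} := by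
  have hpsd : (T₂ * T₂.transpose - T₁ * T₁.transpose).PosSemidef := by
    refine Matrix.PosSemidef.of_dotProduct_mulVec_nonneg ?_ fun θ => ?_
    · simp [Matrix.IsHermitian, Matrix.conjTranspose_eq_transpose_of_trivial,
        Matrix.transpose_sub, Matrix.transpose_mul]
    · rw [star_trivial, Matrix.sub_mulVec, dotProduct_sub, dotProduct_mulVec_transpose_self,
        dotProduct_mulVec_transpose_self]
      linarith [h θ]
  obtain ⟨G, hG⟩ : ∃ G : Matrix (Fin k) (Fin k) ℝ,
      T₂ * T₂.transpose = T₁ * T₁.transpose + G * G.transpose := by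
    obtain ⟨B, hB⟩ := CStarAlgebra.nonneg_iff_eq_star_mul_self.1
      (Matrix.nonneg_iff_posSemidef.2 hpsd)
    refine ⟨B.transpose, ?_⟩
    rw [Matrix.star_eq_conjTranspose, Matrix.conjTranspose_eq_transpose_of_trivial] at hB
    rw [Matrix.transpose_transpose, ← hB]
    abel
  have hm : Measurable fun z : (Fin n₁ → ℝ) × (Fin k → ℝ) => T₁.mulVec z.1 + G.mulVec z.2 :=
    ((measurable_mulVec T₁).comp measurable_fst).add ((measurable_mulVec G).comp measurable_snd)
  have e : weightLaw n₂ {w | T₂.mulVec w ∈ C} = (weightLaw n₂).map T₂.mulVec C :=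
    (Measure.map_apply (measurable_mulVec T₂) hC).symm
  rw [e, weightLaw_map_eq_map_prod T₁ T₂ G hG, Measure.map_apply hm hC,
    Measure.prod_apply_symm (hm hC)]
  calc _ ≤ ∫⁻ _ : Fin k → ℝ, weightLaw n₁ {w | T₁.mulVec w ∈ C} ∂weightLaw k :=
        lintegral_mono fun u => weightLaw_translate_le T₁ hC hconv hsymm (G.mulVec u)
    _ = _ := by simp

/-! ### Dilations of the standard Gaussian measure -/

lemma integral_sq_gaussianReal : ∫ x, x ^ 2 ∂gaussianReal 0 1 = 1 := by
  have h := variance_fun_id_gaussianReal (μ := 0) (v := 1)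
  rw [variance_eq_integral measurable_id'.aemeasurable] at h
  simpa using h

lemma integral_pow_four_gaussianReal : ∫ x, x ^ 4 ∂gaussianReal 0 1 = 3 := by
  have h := iteratedDeriv_mgf_zero (X := fun x : ℝ => x) (μ := gaussianReal 0 1) (by simp) 4
  have hd : ∀ (P P' : ℝ → ℝ), (∀ t, HasDerivAt P (P' t) t) →
      deriv (fun t => P t * Real.exp (t ^ 2 / 2))
        = fun t => (P' t + t * P t) * Real.exp (t ^ 2 / 2) := by
    intro P P' hP
    funext t
    have h2 : HasDerivAt (fun t : ℝ => t ^ 2 / 2) t t := by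
      have := ((hasDerivAt_id t).fun_pow 2).div_const 2
      simpa using this
    have := (hP t).mul h2.exp
    rw [HasDerivAt.deriv (f := fun t => P t * Real.exp (t ^ 2 / 2)) this]
    ring
  have e : iteratedDeriv 4 (fun t : ℝ => Real.exp (t ^ 2 / 2)) 0 = 3 := by
    rw [iteratedDeriv_succ', iteratedDeriv_succ', iteratedDeriv_succ', iteratedDeriv_one]
    have h0 := hd (fun _ => 1) (fun _ => 0) fun t => hasDerivAt_const t 1
    simp only [one_mul, zero_add, mul_one] at h0
    have h1 := hd (fun t => t) (fun _ => 1) fun t => hasDerivAt_id t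
    have h2 := hd (fun t => 1 + t * t) (fun t => 2 * t) fun t => by
      have := ((hasDerivAt_id t).mul (hasDerivAt_id t)).const_add 1
      exact this.congr_deriv (by simp; ring)
    have h3 := hd (fun t => 2 * t + t * (1 + t * t)) (fun t => 3 + 3 * t ^ 2) fun t => by
      have := ((hasDerivAt_id t).const_mul 2).add ((hasDerivAt_id t).mul
        (((hasDerivAt_id t).mul (hasDerivAt_id t)).const_add 1))
      exact this.congr_deriv (by simp; ring)
    rw [h0, h1, h2, h3]
    simp
  rw [mgf_fun_id_gaussianReal] at h
  simp only [NNReal.coe_one, zero_mul, zero_add, one_mul, e] at h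
  simpa using h.symm

lemma integrable_pow_gaussianReal (k : ℕ) : Integrable (fun x => x ^ k) (gaussianReal 0 1) := by
  have h := memLp_id_gaussianReal (μ := 0) (v := 1) (k : NNReal)
  have := h.integrable_norm_pow'
  simp only [id] at this
  exact (integrable_norm_iff (by fun_prop)).1 (by simpa [norm_pow] using this)

lemma lintegral_sq_add_gaussianReal (a t : ℝ) (ha : 0 ≤ a) :
    ∫⁻ x, ENNReal.ofReal (a + (t + (1 - x ^ 2)) ^ 2) ∂gaussianReal 0 1
      = ENNReal.ofReal (a + 2 + t ^ 2) := by
  have e : (fun x : ℝ => a + (t + (1 - x ^ 2)) ^ 2)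
      = fun x => (a + (t + 1) ^ 2) + ((-2 * (t + 1)) * x ^ 2 + x ^ 4) := by
    funext x; ring
  have i2 := (integrable_pow_gaussianReal 2).const_mul (-2 * (t + 1))
  have i4 := integrable_pow_gaussianReal 4
  have i24 : Integrable (fun x => (-2 * (t + 1)) * x ^ 2 + x ^ 4) (gaussianReal 0 1) := i2.add i4
  have ic : Integrable (fun _ : ℝ => a + (t + 1) ^ 2) (gaussianReal 0 1) := integrable_const _
  rw [← ofReal_integral_eq_lintegral_ofReal (by rw [e]; exact ic.add i24)
    (.of_forall fun x => by simp; positivity), e, integral_add ic i24, integral_add i2 i4,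
    integral_const_mul, integral_sq_gaussianReal, integral_pow_four_gaussianReal]
  congr 1
  simp
  ring

/-- The variance of `∑ (1 - gᵢ²)` is `2n`. -/
lemma lintegral_sq_sum_one_sub_sq (n : ℕ) (t : ℝ) :
    ∫⁻ x, ENNReal.ofReal ((t + ∑ i, (1 - x i ^ 2)) ^ 2) ∂weightLaw n
      = ENNReal.ofReal (2 * n + t ^ 2) := by
  induction n generalizing t with
  | zero => simp
  | succ n ih =>
    rw [lintegral_weightLaw_succ (by fun_prop)]
    have : ∀ s : ℝ, ∫⁻ x, ENNReal.ofReal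
        ((t + ∑ i, (1 - (Fin.cons s x : Fin (n + 1) → ℝ) i ^ 2)) ^ 2) ∂weightLaw n
        = ENNReal.ofReal (2 * n + (t + (1 - s ^ 2)) ^ 2) := by
      intro s
      rw [← ih]
      simp only [Fin.sum_univ_succ, Fin.cons_zero, Fin.cons_succ, add_assoc]
    simp_rw [this]
    rw [lintegral_sq_add_gaussianReal _ _ (by positivity)]
    push_cast
    ring_nf

/-- Change of variables `x = c⁻¹ y` in a Gaussian integral. -/
lemma lintegral_gaussianReal_dilate {f : ℝ → ENNReal} (hf : Measurable f) {c : ℝ} (hc : 0 < c) :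
    ∫⁻ x, f x ∂gaussianReal 0 1 = ∫⁻ y, f (c⁻¹ * y)
      * ENNReal.ofReal (c⁻¹ * Real.exp ((1 - c⁻¹ ^ 2) / 2 * y ^ 2)) ∂gaussianReal 0 1 := by
  have hp := measurable_gaussianPDF 0 1
  rw [gaussianReal_of_var_ne_zero _ one_ne_zero,
    lintegral_withDensity_eq_lintegral_mul _ hp hf,
    lintegral_withDensity_eq_lintegral_mul _ hp (by fun_prop)]
  have hm := Real.map_volume_mul_left (inv_ne_zero hc.ne')
  have h1 : ∫⁻ y, (gaussianPDF 0 1 * f) (c⁻¹ * y)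
      = ENNReal.ofReal c * ∫⁻ x, (gaussianPDF 0 1 * f) x := by
    rw [← lintegral_map (f := gaussianPDF 0 1 * f) (g := fun y : ℝ => c⁻¹ * y) (hp.mul hf)
      (by fun_prop), hm, lintegral_smul_measure, inv_inv, abs_of_pos hc]
    rfl
  have h2 : ∫⁻ x, (gaussianPDF 0 1 * f) x
      = ENNReal.ofReal c⁻¹ * ∫⁻ y, (gaussianPDF 0 1 * f) (c⁻¹ * y) := by
    rw [h1, ← mul_assoc, ← ENNReal.ofReal_mul (by positivity), inv_mul_cancel₀ hc.ne']
    simp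
  rw [h2, ← lintegral_const_mul' _ _ (by simp)]
  refine lintegral_congr fun y => ?_
  simp only [Pi.mul_apply, gaussianPDF]
  have hpdf : c⁻¹ * gaussianPDFReal 0 1 (c⁻¹ * y)
      = gaussianPDFReal 0 1 y * (c⁻¹ * Real.exp ((1 - c⁻¹ ^ 2) / 2 * y ^ 2)) := by
    simp only [gaussianPDFReal]
    have : Real.exp (-(c⁻¹ * y - 0) ^ 2 / (2 * ((1 : NNReal) : ℝ)))
        = Real.exp (-(y - 0) ^ 2 / (2 * ((1 : NNReal) : ℝ)))
          * Real.exp ((1 - c⁻¹ ^ 2) / 2 * y ^ 2) := by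
      rw [← Real.exp_add]
      congr 1
      simp only [NNReal.coe_one]
      ring
    rw [this]
    ring
  rw [← mul_assoc, ← ENNReal.ofReal_mul (by positivity), hpdf,
    ENNReal.ofReal_mul (gaussianPDFReal_nonneg _ _ _)]
  ring

lemma lintegral_weightLaw_dilate {n : ℕ} {f : (Fin n → ℝ) → ENNReal} (hf : Measurable f) {c : ℝ}
    (hc : 0 < c) :
    ∫⁻ x, f x ∂weightLaw n = ∫⁻ y, f (c⁻¹ • y)
      * ENNReal.ofReal (c⁻¹ ^ n * Real.exp ((1 - c⁻¹ ^ 2) / 2 * ∑ i, y i ^ 2)) ∂weightLaw n := by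
  induction n with
  | zero =>
    refine lintegral_congr fun x => ?_
    simp [Subsingleton.elim (c⁻¹ • x) x]
  | succ n ih =>
    have hsec : Measurable fun z : ℝ × (Fin n → ℝ) => f (Fin.cons z.1 z.2) :=
      hf.comp measurable_cons
    rw [lintegral_weightLaw_succ hf, lintegral_weightLaw_succ (by fun_prop),
      lintegral_gaussianReal_dilate hsec.lintegral_prod_right' hc]
    refine lintegral_congr fun t => ?_
    rw [ih (f := fun x => f (Fin.cons (c⁻¹ * t) x)) (hsec.comp measurable_prodMk_left),
      ← lintegral_mul_const' _ _ (by simp)]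
    refine lintegral_congr fun x => ?_
    rw [mul_assoc, ← ENNReal.ofReal_mul (by positivity)]
    congr 2
    · ext i
      refine Fin.cases ?_ (fun j => ?_) i <;> simp
    · rw [Fin.sum_univ_succ, mul_add, Real.exp_add, pow_succ]
      simp
      ring

/-- A dilation by `c` close to one increases the Gaussian probability of a set by at most
`√(n/2) log c`, up to a quadratic error. With `ρ` the density ratio of the two laws, this follows
from `1 - ρ ≤ - log ρ`, the right-hand side having standard deviation of order `√n log c`. -/
lemma weightLaw_dilate_le_add_sq {n : ℕ} {C : Set (Fin n → ℝ)} (hC : MeasurableSet C) {l : ℝ}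
    (hl : 0 ≤ l) :
    weightLaw n {y | (Real.exp l)⁻¹ • y ∈ C}
      ≤ weightLaw n C + ENNReal.ofReal (√(n / 2) * l + 2 * n * l ^ 2) := by
  rcases Nat.eq_zero_or_pos n with rfl | hn
  · refine le_trans (le_of_eq ?_) le_self_add
    congr 1
    ext y
    rw [Set.mem_ofPred_eq, Subsingleton.elim ((Real.exp l)⁻¹ • y) y]
  have hn0 : (0 : ℝ) < n := by exact_mod_cast hn
  set c := Real.exp l with hc
  have hcpos : 0 < c := Real.exp_pos l
  set κ := (1 - c⁻¹ ^ 2) / 2 with hκ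
  have hc2 : c⁻¹ ^ 2 = Real.exp (-(2 * l)) := by
    rw [hc, ← Real.exp_neg, ← Real.exp_nat_mul]; push_cast; ring_nf
  have hκ0 : 0 ≤ κ := by
    rw [hκ, hc2]
    have : Real.exp (-(2 * l)) ≤ 1 := by rw [Real.exp_le_one_iff]; linarith
    linarith
  have hκl : κ ≤ l := by
    rw [hκ, hc2]
    linarith [Real.add_one_le_exp (-(2 * l))]
  have hlκ : l - κ ≤ 2 * l ^ 2 := by
    have h1 : Real.exp (-(2 * l)) * (1 + 2 * l) ≤ 1 := by
      rw [Real.exp_neg, inv_mul_le_one₀ (Real.exp_pos _)]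
      linarith [Real.add_one_le_exp (2 * l)]
    rw [hκ, hc2]
    set E := Real.exp (-(2 * l)) with hE
    nlinarith [Real.exp_pos (-(2 * l)), sq_nonneg l]
  set C' : Set (Fin n → ℝ) := {y | c⁻¹ • y ∈ C} with hC'
  have hmC' : MeasurableSet C' := (measurable_const_smul c⁻¹) hC
  set W : (Fin n → ℝ) → ℝ := fun y => c⁻¹ ^ n * Real.exp (κ * ∑ i, y i ^ 2) with hW
  set s : ℝ := √(2 * n) with hs
  have hs0 : 0 < s := Real.sqrt_pos.2 (by positivity)
  have hs2 : s ^ 2 = 2 * n := Real.sq_sqrt (by positivity)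
  have e1 : weightLaw n C = ∫⁻ y, C'.indicator 1 y * ENNReal.ofReal (W y) ∂weightLaw n := by
    rw [← lintegral_indicator_one hC,
      lintegral_weightLaw_dilate (measurable_one.indicator hC) hcpos]
    rfl
  have pt : ∀ y, C'.indicator (1 : (Fin n → ℝ) → ENNReal) y
      ≤ C'.indicator 1 y * ENNReal.ofReal (W y) + (ENNReal.ofReal (2 * n * l ^ 2)
        + ENNReal.ofReal (l / (4 * s)) * ENNReal.ofReal ((s + ∑ i, (1 - y i ^ 2)) ^ 2)) := by
    intro y
    by_cases hy : y ∈ C'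
    · simp only [Set.indicator_of_mem hy, Pi.one_apply, one_mul]
      rw [← ENNReal.ofReal_mul (by positivity), ← ENNReal.ofReal_add (by positivity)
        (by positivity), ← ENNReal.ofReal_add (by positivity) (by positivity), ← ENNReal.ofReal_one]
      apply ENNReal.ofReal_le_ofReal
      set a := ∑ i, (1 - y i ^ 2) with ha
      have hQ : ∑ i, y i ^ 2 = n - a := by simp [ha]
      have hWexp : W y = Real.exp (-(n * l) + κ * ∑ i, y i ^ 2) := by
        simp only [hW]
        rw [Real.exp_add]
        congr 1
        rw [hc, ← Real.exp_neg, ← Real.exp_nat_mul]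
        ring_nf
      have h1 : 1 ≤ W y + (n * (l - κ) + κ * a) := by
        have := Real.add_one_le_exp (-(n * l) + κ * ∑ i, y i ^ 2)
        rw [← hWexp, hQ] at this
        linarith
      -- `a ≤ (s + a)² / (4 s)` bounds `E a₊` by the variance, optimally for `s² = Var a = 2 n`
      have h2 : κ * a ≤ l / (4 * s) * (s + a) ^ 2 := by
        have h3 : a ≤ (s + a) ^ 2 / (4 * s) := by
          rw [le_div_iff₀ (by positivity)]
          nlinarith [sq_nonneg (s - a)]
        calc κ * a ≤ κ * ((s + a) ^ 2 / (4 * s)) := by gcongr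
          _ ≤ l * ((s + a) ^ 2 / (4 * s)) := by gcongr
          _ = _ := by ring
      have h4 : n * (l - κ) ≤ 2 * n * l ^ 2 := by nlinarith
      linarith
    · simp [Set.indicator_of_notMem hy]
  have hWm : Measurable W := by fun_prop
  rw [← lintegral_indicator_one hmC']
  refine (lintegral_mono pt).trans ?_
  rw [lintegral_add_left (by
      exact (measurable_one.indicator hmC').mul hWm.ennreal_ofReal), ← e1,
    lintegral_add_left measurable_const, lintegral_const, measure_univ, mul_one,
    lintegral_const_mul' _ _ (by simp), lintegral_sq_sum_one_sub_sq,
    ← ENNReal.ofReal_mul (by positivity), ← ENNReal.ofReal_add (by positivity) (by positivity)]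
  rw [hs2]
  have : l / (4 * s) * (2 * n + 2 * n) = √(n / 2) * l := by
    have h5 : √((n : ℝ) / 2) = s / 2 := by
      rw [hs, show (2 * n : ℝ) = n / 2 * 2 ^ 2 by ring, Real.sqrt_mul (by positivity)]
      simp
    rw [h5]
    field_simp
    rw [hs2]
    ring
  rw [this, add_comm (2 * n * l ^ 2)]

/-- A dilation by `c = exp l ≥ 1` increases the Gaussian probability of a set in `ℝⁿ` by at most
`√(n/2) log c`: split the dilation into `N` equal steps and let `N` tend to infinity. -/
theorem weightLaw_dilate_le {n : ℕ} {C : Set (Fin n → ℝ)} (hC : MeasurableSet C) {l : ℝ}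
    (hl : 0 ≤ l) :
    (weightLaw n).real {y | (Real.exp l)⁻¹ • y ∈ C} ≤ (weightLaw n).real C + √(n / 2) * l := by
  have step : ∀ l' : ℝ, 0 ≤ l' → ∀ C : Set (Fin n → ℝ), MeasurableSet C →
      (weightLaw n).real {y | (Real.exp l')⁻¹ • y ∈ C}
        ≤ (weightLaw n).real C + (√(n / 2) * l' + 2 * n * l' ^ 2) := by
    intro l' hl' C hC
    have := weightLaw_dilate_le_add_sq hC hl'
    have h2 := ENNReal.toReal_mono (by finiteness) this
    rwa [ENNReal.toReal_add (by finiteness) (by finiteness),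
      ENNReal.toReal_ofReal (by positivity)] at h2
  have iter : ∀ l' : ℝ, 0 ≤ l' → ∀ N : ℕ, (weightLaw n).real {y | (Real.exp (N * l'))⁻¹ • y ∈ C}
        ≤ (weightLaw n).real C + N * (√(n / 2) * l' + 2 * n * l' ^ 2) := by
    intro l' hl' N
    induction N with
    | zero => simp
    | succ N ih =>
      have hm : MeasurableSet {y : Fin n → ℝ | (Real.exp (N * l'))⁻¹ • y ∈ C} :=
        (measurable_const_smul (Real.exp (N * l'))⁻¹) hC
      have := step l' hl' _ hm
      have e : {y : Fin n → ℝ | (Real.exp ((N + 1 : ℕ) * l'))⁻¹ • y ∈ C}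
          = {y | (Real.exp l')⁻¹ • y ∈ {y | (Real.exp (N * l'))⁻¹ • y ∈ C}} := by
        ext y
        simp only [Set.mem_ofPred_eq, smul_smul]
        rw [← mul_inv, ← Real.exp_add]
        push_cast
        rw [add_mul, one_mul]
      rw [e]
      push_cast
      linarith
  have lim : Filter.Tendsto (fun N : ℕ => (weightLaw n).real C
      + (√(n / 2) * l + 2 * n * l ^ 2 * (1 / ((N : ℝ) + 1)))) Filter.atTop
      (nhds ((weightLaw n).real C + (√(n / 2) * l + 2 * n * l ^ 2 * 0))) :=
    ((tendsto_one_div_add_atTop_nhds_zero_nat.const_mul _).const_add _).const_add _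
  rw [mul_zero, add_zero] at lim
  refine ge_of_tendsto' lim fun N => ?_
  have := iter (l / ((N + 1 : ℕ) : ℝ)) (by positivity) (N + 1)
  rw [mul_div_cancel₀ _ (by positivity)] at this
  refine this.trans (le_of_eq ?_)
  push_cast
  field_simp

/-! ### The trace exponential under rank-one perturbations -/

/-- Orthogonal diagonalization of a real symmetric matrix, together with its exponential. -/
lemma exists_spectral_exp {p : ℕ} {H : Matrix (Fin p) (Fin p) ℝ} (hH : H.IsHermitian) :
    ∃ (V : Matrix (Fin p) (Fin p) ℝ) (h : Fin p → ℝ), V.transpose * V = 1 ∧ V * V.transpose = 1 ∧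
      H = V * Matrix.diagonal h * V.transpose ∧
      NormedSpace.exp H = V * Matrix.diagonal (fun i => Real.exp (h i)) * V.transpose := by
  set V : Matrix (Fin p) (Fin p) ℝ := (hH.eigenvectorUnitary : Matrix (Fin p) (Fin p) ℝ) with hV
  have hst : star V = V.transpose := by
    rw [Matrix.star_eq_conjTranspose, Matrix.conjTranspose_eq_transpose_of_trivial]
  have h1 : V.transpose * V = 1 := by rw [← hst]; exact Unitary.coe_star_mul_self _
  have h2 : V * V.transpose = 1 := by rw [← hst]; exact Unitary.coe_mul_star_self _
  have h3 : H = V * Matrix.diagonal hH.eigenvalues * V.transpose := by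
    rw [← hst]
    conv_lhs => rw [hH.spectral_theorem, Unitary.conjStarAlgAut_apply]
    rfl
  refine ⟨V, hH.eigenvalues, h1, h2, h3, ?_⟩
  have hu : IsUnit V := ⟨⟨V, V.transpose, h2, h1⟩, rfl⟩
  have hinv : V⁻¹ = V.transpose := Matrix.inv_eq_left_inv h1
  conv_lhs => rw [h3, ← hinv, Matrix.exp_conj _ _ hu, hinv, Matrix.exp_diagonal]
  congr 3
  funext i
  rw [Pi.coe_exp, Real.exp_eq_exp_ℝ]

lemma trace_conj_diagonal {p : ℕ} {V : Matrix (Fin p) (Fin p) ℝ} (hV : V.transpose * V = 1)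
    (d : Fin p → ℝ) : (V * Matrix.diagonal d * V.transpose).trace = ∑ i, d i := by
  rw [Matrix.trace_mul_comm, ← mul_assoc, hV, one_mul, Matrix.trace_diagonal]

lemma dotProduct_conj_diagonal_mulVec {p : ℕ} (V : Matrix (Fin p) (Fin p) ℝ) (d u : Fin p → ℝ) :
    u ⬝ᵥ (V * Matrix.diagonal d * V.transpose).mulVec u
      = ∑ i, d i * (V.transpose.mulVec u i) ^ 2 := by
  rw [← Matrix.mulVec_mulVec, ← Matrix.mulVec_mulVec, Matrix.dotProduct_mulVec,
    ← Matrix.mulVec_transpose]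
  simp only [dotProduct, Matrix.mulVec_diagonal]
  exact Finset.sum_congr rfl fun i _ => by ring

/-- Equivalently `tanh (d / 2) ≤ d / 2`. -/
lemma exp_sub_one_le_half_mul {d : ℝ} (hd : 0 ≤ d) :
    Real.exp d - 1 ≤ d / 2 * (Real.exp d + 1) := by
  have hder : ∀ x : ℝ, HasDerivAt (fun x => x / 2 * (Real.exp x + 1) - Real.exp x)
      ((1 + x * Real.exp x - Real.exp x) / 2) x := by
    intro x
    have := (((hasDerivAt_id x).div_const 2).mul ((Real.hasDerivAt_exp x).add_const 1)).sub
      (Real.hasDerivAt_exp x)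
    exact this.congr_deriv (by simp; ring)
  have hmono : Monotone fun x => x / 2 * (Real.exp x + 1) - Real.exp x := by
    refine monotone_of_hasDerivAt_nonneg hder fun x => ?_
    have h := Real.add_one_le_exp (-x)
    have : (1 - x) * Real.exp x ≤ 1 := by
      calc (1 - x) * Real.exp x ≤ Real.exp (-x) * Real.exp x := by gcongr; linarith
        _ = 1 := by rw [← Real.exp_add]; simp
    simp only [Pi.zero_apply]
    linarith
  have := hmono hd
  simp only [Real.exp_zero] at this
  linarith

/-- The logarithmic mean is at most the arithmetic mean. -/
lemma exp_sub_mul_sub_le (x y : ℝ) :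
    (Real.exp x - Real.exp y) * (x - y) ≤ (Real.exp x + Real.exp y) / 2 * (x - y) ^ 2 := by
  wlog h : y ≤ x generalizing x y
  · have := this y x (le_of_not_ge h)
    linarith
  have h1 := exp_sub_one_le_half_mul (sub_nonneg.2 h)
  have e : Real.exp x = Real.exp y * Real.exp (x - y) := by rw [← Real.exp_add]; ring_nf
  rw [e]
  have hy := Real.exp_pos y
  have hxy : 0 ≤ Real.exp y * (x - y) := mul_nonneg hy.le (sub_nonneg.2 h)
  nlinarith [mul_le_mul_of_nonneg_left h1 hxy]

/-- Increments of `tr exp` and of `uᵀ exp u` under a rank-one perturbation `t u uᵀ`, in terms of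
spectral data. Here `P` is the matrix of scalar products of the two eigenbases, `a` and `b` are the
coordinates of `u` in them, and `hP` expresses that the two matrices differ by `t u uᵀ`. -/
lemma spectral_increments {p : ℕ} {P : Matrix (Fin p) (Fin p) ℝ} {a b h h' : Fin p → ℝ} {t : ℝ}
    (ht : 0 < t) (h1 : P * P.transpose = 1) (h2 : P.transpose * P = 1) (hb : P.mulVec a = b)
    (ha : P.transpose.mulVec b = a) (hP : ∀ k j, (h' k - h j) * P k j = t * (b k * a j)) :
    (t * ∑ j, Real.exp (h j) * a j ^ 2 ≤ ∑ k, Real.exp (h' k) - ∑ j, Real.exp (h j)) ∧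
    (∑ k, Real.exp (h' k) - ∑ j, Real.exp (h j) ≤ t * ∑ k, Real.exp (h' k) * b k ^ 2) ∧
    (0 ≤ ∑ k, Real.exp (h' k) * b k ^ 2 - ∑ j, Real.exp (h j) * a j ^ 2) ∧
    (∑ k, Real.exp (h' k) * b k ^ 2 - ∑ j, Real.exp (h j) * a j ^ 2
      ≤ t / 2 * ((a ⬝ᵥ a) * ∑ k, Real.exp (h' k) * b k ^ 2
        + (b ⬝ᵥ b) * ∑ j, Real.exp (h j) * a j ^ 2)) := by
  have r1 : ∀ k, ∑ j, P k j ^ 2 = 1 := by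
    intro k
    have := congrFun (congrFun h1 k) k
    simpa [Matrix.mul_apply, sq] using this
  have r2 : ∀ j, ∑ k, P k j ^ 2 = 1 := by
    intro j
    have := congrFun (congrFun h2 j) j
    simpa [Matrix.mul_apply, sq] using this
  have r3 : ∀ k, ∑ j, P k j * a j = b k := fun k => by rw [← hb]; rfl
  have r4 : ∀ j, ∑ k, P k j * b k = a j := fun j => by
    conv_rhs => rw [← ha]
    rfl
  have s1 : ∑ k, Real.exp (h' k) = ∑ k, ∑ j, Real.exp (h' k) * P k j ^ 2 := by
    simp_rw [← Finset.mul_sum, r1, mul_one]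
  have s2 : ∑ j, Real.exp (h j) = ∑ k, ∑ j, Real.exp (h j) * P k j ^ 2 := by
    rw [Finset.sum_comm]
    simp_rw [← Finset.mul_sum, r2, mul_one]
  have s3 : ∑ k, Real.exp (h' k) * b k ^ 2
      = ∑ k, ∑ j, Real.exp (h' k) * (b k * (P k j * a j)) := by
    simp_rw [← Finset.mul_sum, r3, sq]
  have s4 : ∑ j, Real.exp (h j) * a j ^ 2
      = ∑ k, ∑ j, Real.exp (h j) * (a j * (P k j * b k)) := by
    rw [Finset.sum_comm]
    simp_rw [← Finset.mul_sum, r4, sq]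
  have s5 : (a ⬝ᵥ a) * ∑ k, Real.exp (h' k) * b k ^ 2
      = ∑ k, ∑ j, Real.exp (h' k) * (b k ^ 2 * a j ^ 2) := by
    simp_rw [← Finset.mul_sum, dotProduct, ← sq]
    rw [mul_comm, Finset.sum_mul]
    exact Finset.sum_congr rfl fun k _ => by ring
  have s6 : (b ⬝ᵥ b) * ∑ j, Real.exp (h j) * a j ^ 2
      = ∑ k, ∑ j, Real.exp (h j) * (b k ^ 2 * a j ^ 2) := by
    rw [Finset.sum_comm]
    simp_rw [dotProduct, ← sq, ← Finset.mul_sum, ← Finset.sum_mul]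
    rw [Finset.mul_sum]
    exact Finset.sum_congr rfl fun k _ => by ring
  refine ⟨?_, ?_, ?_, ?_⟩
  · rw [s1, s2, s4, ← Finset.sum_sub_distrib, Finset.mul_sum]
    refine Finset.sum_le_sum fun k _ => ?_
    rw [← Finset.sum_sub_distrib, Finset.mul_sum]
    refine Finset.sum_le_sum fun j _ => ?_
    have e := hP k j
    have c1 : Real.exp (h j) * (h' k - h j) ≤ Real.exp (h' k) - Real.exp (h j) := by
      have := Real.add_one_le_exp (h' k - h j)
      have e2 : Real.exp (h' k) = Real.exp (h j) * Real.exp (h' k - h j) := by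
        rw [← Real.exp_add]; ring_nf
      rw [e2]
      nlinarith [Real.exp_pos (h j)]
    calc _ = Real.exp (h j) * ((h' k - h j) * P k j) * P k j := by rw [e]; ring
      _ = Real.exp (h j) * (h' k - h j) * P k j ^ 2 := by ring
      _ ≤ (Real.exp (h' k) - Real.exp (h j)) * P k j ^ 2 := by gcongr
      _ = _ := by ring
  · rw [s1, s2, s3, ← Finset.sum_sub_distrib, Finset.mul_sum]
    refine Finset.sum_le_sum fun k _ => ?_
    rw [← Finset.sum_sub_distrib, Finset.mul_sum]
    refine Finset.sum_le_sum fun j _ => ?_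
    have e := hP k j
    have c1 : Real.exp (h' k) - Real.exp (h j) ≤ Real.exp (h' k) * (h' k - h j) := by
      have := Real.add_one_le_exp (h j - h' k)
      have e2 : Real.exp (h j) = Real.exp (h' k) * Real.exp (h j - h' k) := by
        rw [← Real.exp_add]; ring_nf
      rw [e2]
      nlinarith [Real.exp_pos (h' k)]
    calc _ = (Real.exp (h' k) - Real.exp (h j)) * P k j ^ 2 := by ring
      _ ≤ Real.exp (h' k) * (h' k - h j) * P k j ^ 2 := by gcongr
      _ = Real.exp (h' k) * ((h' k - h j) * P k j) * P k j := by ring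
      _ = _ := by rw [e]; ring
  · rw [s3, s4, ← Finset.sum_sub_distrib]
    refine Finset.sum_nonneg fun k _ => ?_
    rw [← Finset.sum_sub_distrib]
    refine Finset.sum_nonneg fun j _ => ?_
    have e := hP k j
    have c1 : 0 ≤ (Real.exp (h' k) - Real.exp (h j)) * (h' k - h j) := by
      rcases le_total (h j) (h' k) with hh | hh
      · exact mul_nonneg (sub_nonneg.2 (Real.exp_le_exp.2 hh)) (sub_nonneg.2 hh)
      · exact mul_nonneg_of_nonpos_of_nonpos (sub_nonpos.2 (Real.exp_le_exp.2 hh))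
          (sub_nonpos.2 hh)
    refine nonneg_of_mul_nonneg_right (a := t) ?_ ht
    calc 0 ≤ (Real.exp (h' k) - Real.exp (h j)) * (h' k - h j) * P k j ^ 2 := by positivity
      _ = (Real.exp (h' k) - Real.exp (h j)) * ((h' k - h j) * P k j) * P k j := by ring
      _ = _ := by rw [e]; ring
  · rw [s5, s6, s3, s4, ← Finset.sum_sub_distrib, ← Finset.sum_add_distrib, Finset.mul_sum]
    refine Finset.sum_le_sum fun k _ => ?_
    rw [← Finset.sum_sub_distrib, ← Finset.sum_add_distrib, Finset.mul_sum]
    refine Finset.sum_le_sum fun j _ => ?_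
    have e := hP k j
    refine le_of_mul_le_mul_left ?_ ht
    calc _ = (Real.exp (h' k) - Real.exp (h j)) * P k j * (t * (b k * a j)) := by ring
      _ = (Real.exp (h' k) - Real.exp (h j)) * (h' k - h j) * P k j ^ 2 := by rw [← e]; ring
      _ ≤ (Real.exp (h' k) + Real.exp (h j)) / 2 * (h' k - h j) ^ 2 * P k j ^ 2 := by
          exact mul_le_mul_of_nonneg_right (exp_sub_mul_sub_le _ _) (sq_nonneg _)
      _ = (Real.exp (h' k) + Real.exp (h j)) / 2 * ((h' k - h j) * P k j) ^ 2 := by ring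
      _ = _ := by rw [e]; ring

lemma isHermitian_vecMulVec_self {p : ℕ} (u : Fin p → ℝ) :
    (Matrix.vecMulVec u u).IsHermitian := by
  ext i j
  simp [Matrix.vecMulVec_apply, mul_comm]

lemma isHermitian_smul {p : ℕ} {H : Matrix (Fin p) (Fin p) ℝ} (hH : H.IsHermitian) (t : ℝ) :
    (t • H).IsHermitian := by
  unfold Matrix.IsHermitian at *
  rw [Matrix.conjTranspose_smul, hH, star_trivial]

/-- Along the line `H + y u uᵀ`, the quadratic form `k = uᵀ exp u` is the slope of the convex
function `tr exp`, and `log k` increases at rate at most `|u|²`. -/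
lemma trace_exp_increments {p : ℕ} {H : Matrix (Fin p) (Fin p) ℝ} (hH : H.IsHermitian)
    (u : Fin p → ℝ) {t : ℝ} (ht : 0 < t) :
    let H' := H + t • Matrix.vecMulVec u u
    let k := u ⬝ᵥ (NormedSpace.exp H).mulVec u
    let k' := u ⬝ᵥ (NormedSpace.exp H').mulVec u
    t * k ≤ (NormedSpace.exp H').trace - (NormedSpace.exp H).trace ∧
    (NormedSpace.exp H').trace - (NormedSpace.exp H).trace ≤ t * k' ∧
    0 ≤ k' - k ∧ k' - k ≤ t / 2 * ((u ⬝ᵥ u) * (k' + k)) := by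
  intro H' k k'
  have hH' : H'.IsHermitian := hH.add (isHermitian_smul (isHermitian_vecMulVec_self u) t)
  obtain ⟨V, h, v1, v2, v3, v4⟩ := exists_spectral_exp hH
  obtain ⟨V', h', w1, w2, w3, w4⟩ := exists_spectral_exp hH'
  set P := V'.transpose * V with hPdef
  set a := V.transpose.mulVec u with hadef
  set b := V'.transpose.mulVec u with hbdef
  have p1 : P * P.transpose = 1 := by
    rw [hPdef, Matrix.transpose_mul, Matrix.transpose_transpose, mul_assoc, ← mul_assoc V, v2,
      one_mul, w1]
  have p2 : P.transpose * P = 1 := by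
    rw [hPdef, Matrix.transpose_mul, Matrix.transpose_transpose, mul_assoc, ← mul_assoc V', w2,
      one_mul, v1]
  have hb : P.mulVec a = b := by
    rw [hPdef, hadef, Matrix.mulVec_mulVec, mul_assoc, v2, mul_one]
  have ha : P.transpose.mulVec b = a := by
    rw [hPdef, hbdef, Matrix.transpose_mul, Matrix.transpose_transpose, Matrix.mulVec_mulVec,
      mul_assoc, w2, mul_one]
  have hP : ∀ k j, (h' k - h j) * P k j = t * (b k * a j) := by
    have e1 : V'.transpose * H' * V = Matrix.diagonal h' * P := by
      rw [w3, ← mul_assoc, ← mul_assoc, w1, one_mul, mul_assoc]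
    have e2 : V'.transpose * H * V = P * Matrix.diagonal h := by
      conv_lhs => rw [v3]
      rw [mul_assoc, mul_assoc, v1, mul_one, ← mul_assoc]
    have e3 : V'.transpose * Matrix.vecMulVec u u * V = Matrix.vecMulVec b a := by
      rw [Matrix.mul_vecMulVec, Matrix.vecMulVec_mul, hadef, hbdef, Matrix.mulVec_transpose V]
    have e4 : Matrix.diagonal h' * P = P * Matrix.diagonal h + t • Matrix.vecMulVec b a := by
      rw [← e1, ← e2, ← e3]
      simp only [H', mul_add, add_mul, Matrix.mul_smul, Matrix.smul_mul]
    intro k j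
    have := congrFun (congrFun e4 k) j
    simp only [Matrix.diagonal_mul, Matrix.add_apply, Matrix.mul_diagonal, Matrix.smul_apply,
      Matrix.vecMulVec_apply, smul_eq_mul] at this
    linarith
  have haa : a ⬝ᵥ a = u ⬝ᵥ u := by
    rw [hadef, ← dotProduct_mulVec_transpose_self, v2, Matrix.one_mulVec]
  have hbb : b ⬝ᵥ b = u ⬝ᵥ u := by
    rw [hbdef, ← dotProduct_mulVec_transpose_self, w2, Matrix.one_mulVec]
  obtain ⟨c1, c2, c3, c4⟩ := spectral_increments ht p1 p2 hb ha hP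
  have k1 : k = ∑ j, Real.exp (h j) * a j ^ 2 := by
    simp only [k]; rw [v4, dotProduct_conj_diagonal_mulVec]
  have k2 : k' = ∑ j, Real.exp (h' j) * b j ^ 2 := by
    simp only [k']; rw [w4, dotProduct_conj_diagonal_mulVec]
  rw [k1, k2, v4, w4, trace_conj_diagonal v1, trace_conj_diagonal w1]
  refine ⟨c1, c2, c3, c4.trans (le_of_eq ?_)⟩
  rw [haa, hbb]
  ring

/-- A function that increases up to a quadratic error is increasing: subdivide the interval. -/
lemma le_of_quadratic_defect {g : ℝ → ℝ} {x y c r : ℝ} (hxy : x ≤ y) (hr : 0 < r)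
    (h : ∀ s s', x ≤ s → s ≤ s' → s' ≤ y → s' - s ≤ r → g s - c * (s' - s) ^ 2 ≤ g s') :
    g x ≤ g y := by
  set L := y - x with hL
  have hL0 : 0 ≤ L := sub_nonneg.2 hxy
  have key : ∀ N : ℕ, L / (N + 1) ≤ r → g x - c * L ^ 2 * (1 / ((N : ℝ) + 1)) ≤ g y := by
    intro N hN
    have hN1 : (0 : ℝ) < N + 1 := by positivity
    have hd : 0 ≤ L / (N + 1) := by positivity
    have ind : ∀ i : ℕ, i ≤ N + 1 →
        g x - i * (c * (L / (N + 1)) ^ 2) ≤ g (x + i * (L / (N + 1))) := by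
      intro i
      induction i with
      | zero => simp
      | succ i ih =>
        intro hi
        have h1 := ih (by omega)
        have hi' : ((i : ℝ) + 1) ≤ N + 1 := by exact_mod_cast hi
        have h2 := h (x + i * (L / (N + 1))) (x + (i + 1 : ℕ) * (L / (N + 1)))
          (le_add_of_nonneg_right (by positivity)) (by push_cast; linarith) ?_ ?_
        · have e : x + (i + 1 : ℕ) * (L / (N + 1)) - (x + i * (L / (N + 1))) = L / (N + 1) := by
            push_cast; ring
          rw [e] at h2
          refine le_trans ?_ h2
          push_cast
          linarith
        · push_cast
          have : ((i : ℝ) + 1) * (L / (N + 1)) ≤ (N + 1) * (L / (N + 1)) := by gcongr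
          rw [mul_div_cancel₀ _ hN1.ne'] at this
          linarith
        · push_cast
          linarith
    have := ind (N + 1) le_rfl
    push_cast at this
    rw [mul_div_cancel₀ _ hN1.ne', hL, add_sub_cancel, ← hL] at this
    convert this using 2
    field_simp
  have lim : Filter.Tendsto (fun N : ℕ => g x - c * L ^ 2 * (1 / ((N : ℝ) + 1))) Filter.atTop
      (nhds (g x - c * L ^ 2 * 0)) :=
    (tendsto_one_div_add_atTop_nhds_zero_nat.const_mul _).const_sub _
  rw [mul_zero, sub_zero] at lim
  have lim2 : Filter.Tendsto (fun N : ℕ => L * (1 / ((N : ℝ) + 1))) Filter.atTop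
      (nhds (L * 0)) := tendsto_one_div_add_atTop_nhds_zero_nat.const_mul _
  rw [mul_zero] at lim2
  refine le_of_tendsto lim ?_
  filter_upwards [lim2.eventually_le_const hr] with N hN
  exact key N (by rwa [mul_one_div] at hN)

/-- If `K` has slope `k` in the sense of a convex function and `log k` has slope at most `a`, then
`K` lies below the exponential function with value `K 0`, slope `k 0` and rate `a` at the origin. -/
lemma le_add_mul_exp_sub_one_div {K k : ℝ → ℝ} {a : ℝ} (ha : 0 < a) (hk : ∀ y, 0 ≤ k y)
    (h1 : ∀ y t, 0 < t → t * k y ≤ K (y + t) - K y)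
    (h2 : ∀ y t, 0 < t → K (y + t) - K y ≤ t * k (y + t))
    (h4 : ∀ y t, 0 < t → k (y + t) - k y ≤ t / 2 * (a * (k (y + t) + k y))) (y : ℝ) :
    K y ≤ K 0 + k 0 * ((Real.exp (a * y) - 1) / a) := by
  -- `k y * exp (-a y)` is nonincreasing
  have hkexp : ∀ x y, x ≤ y → k y * Real.exp (-(a * y)) ≤ k x * Real.exp (-(a * x)) := by
    intro x y hxy
    set g : ℝ → ℝ := fun s => -(k s * Real.exp (-(a * s))) with hg
    have bnd : ∀ s s', s < s' → s' - s ≤ 1 / a →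
        k s' ≤ k s * Real.exp (a * (s' - s)) + 2 * (k s * (a * (s' - s)) ^ 2) := by
      intro s s' hss hle
      have h := h4 s (s' - s) (sub_pos.2 hss)
      rw [add_sub_cancel] at h
      set r := a * (s' - s) with hr
      have hr0 : 0 ≤ r := mul_nonneg ha.le (sub_nonneg.2 hss.le)
      have hr1 : r ≤ 1 := by
        rw [le_div_iff₀ ha] at hle; rw [hr]; linarith
      have h' : k s' * (1 - r / 2) ≤ k s * (1 + r / 2) := by rw [hr]; linarith
      have hexp : 1 + r ≤ Real.exp r := by linarith [Real.add_one_le_exp r]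
      have hkey : (1 + r / 2) ≤ (1 + r + 2 * r ^ 2) * (1 - r / 2) := by nlinarith
      have h5 : k s' * (1 - r / 2) ≤ k s * (1 + r + 2 * r ^ 2) * (1 - r / 2) := by
        have := mul_le_mul_of_nonneg_left hkey (hk s)
        linarith
      have h6 : k s' ≤ k s * (1 + r + 2 * r ^ 2) := le_of_mul_le_mul_right h5 (by linarith)
      have := mul_le_mul_of_nonneg_left hexp (hk s)
      linarith
    have hmono : ∀ s s', s ≤ s' → k s ≤ k s' := by
      intro s s' hss
      rcases eq_or_lt_of_le hss with rfl | hss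
      · exact le_rfl
      have a1 := h1 s (s' - s) (sub_pos.2 hss)
      have a2 := h2 s (s' - s) (sub_pos.2 hss)
      rw [add_sub_cancel] at a2
      rw [add_sub_cancel] at a1
      exact le_of_mul_le_mul_left (a1.trans a2) (sub_pos.2 hss)
    have := le_of_quadratic_defect (g := g) (c := 2 * k y * a ^ 2 * Real.exp (-(a * x))) hxy
      (one_div_pos.2 ha) ?_
    · simp only [hg] at this
      linarith
    · intro s s' hs hss hs' hle
      rcases eq_or_lt_of_le hss with rfl | hlt
      · simp
      have hb := bnd s s' hlt hle
      have e1 : Real.exp (a * (s' - s)) * Real.exp (-(a * s')) = Real.exp (-(a * s)) := by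
        rw [← Real.exp_add]; ring_nf
      have e2 : Real.exp (-(a * s')) ≤ Real.exp (-(a * x)) := by
        rw [Real.exp_le_exp]; nlinarith
      have e3 := mul_le_mul_of_nonneg_right hb (Real.exp_pos (-(a * s'))).le
      have e4 : 2 * (k s * (a * (s' - s)) ^ 2) * Real.exp (-(a * s'))
          ≤ 2 * (k y * (a * (s' - s)) ^ 2) * Real.exp (-(a * x)) := by
        have := hmono s y (hss.trans hs')
        have := hk y
        gcongr
      have e5 : k s * Real.exp (a * (s' - s)) * Real.exp (-(a * s'))
          = k s * Real.exp (-(a * s)) := by rw [mul_assoc, e1]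
      simp only [hg]
      rw [add_mul, e5] at e3
      nlinarith
  set D : ℝ → ℝ := fun y => k 0 * ((Real.exp (a * y) - 1) / a) - K y with hD
  -- increments of the exponential between those of its tangents at the two endpoints
  have inc : ∀ s s', s ≤ s' → (s' - s) * Real.exp (a * s)
      ≤ (Real.exp (a * s') - 1) / a - (Real.exp (a * s) - 1) / a ∧
      (Real.exp (a * s') - 1) / a - (Real.exp (a * s) - 1) / a ≤ (s' - s) * Real.exp (a * s') := by
    intro s s' hss
    have e : Real.exp (a * s') = Real.exp (a * s) * Real.exp (a * (s' - s)) := by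
      rw [← Real.exp_add]; ring_nf
    have e' : Real.exp (a * s) = Real.exp (a * s') * Real.exp (-(a * (s' - s))) := by
      rw [← Real.exp_add]; ring_nf
    rw [← sub_div, le_div_iff₀ ha, div_le_iff₀ ha]
    constructor
    · rw [e]
      nlinarith [Real.exp_pos (a * s), Real.add_one_le_exp (a * (s' - s))]
    · rw [e']
      nlinarith [Real.exp_pos (a * s'), Real.add_one_le_exp (-(a * (s' - s)))]
  have gap : ∀ s s' z, s ≤ s' → s' ≤ z → Real.exp (a * s') - Real.exp (a * s)
      ≤ a * (s' - s) * Real.exp (a * z) := by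
    intro s s' z hss hz
    have h := (inc s s' hss).2
    rw [← sub_div, div_le_iff₀ ha] at h
    have : Real.exp (a * s') ≤ Real.exp (a * z) := by rw [Real.exp_le_exp]; nlinarith
    nlinarith [mul_le_mul_of_nonneg_left this (mul_nonneg ha.le (sub_nonneg.2 hss))]
  have hk0 := hk 0
  have hD0 : D 0 ≤ D y := by
    rcases le_total 0 y with hy | hy
    · refine le_of_quadratic_defect (c := k 0 * a * Real.exp (a * y)) hy one_pos ?_
      intro s s' hs hss hs' _
      rcases eq_or_lt_of_le hss with rfl | hlt
      · simp
      have a2 := h2 s (s' - s) (sub_pos.2 hlt)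
      rw [add_sub_cancel] at a2
      have a3 : k s' ≤ k 0 * Real.exp (a * s') := by
        have := hkexp 0 s' (hs.trans hss)
        simp only [mul_zero, neg_zero, Real.exp_zero, mul_one] at this
        rw [Real.exp_neg, ← div_eq_mul_inv, div_le_iff₀ (Real.exp_pos _)] at this
        exact this
      have a4 := mul_le_mul_of_nonneg_left (inc s s' hss).1 hk0
      have a5 := mul_le_mul_of_nonneg_left (gap s s' y hss hs')
        (mul_nonneg hk0 (sub_nonneg.2 hss))
      have a6 := mul_le_mul_of_nonneg_left a3 (sub_nonneg.2 hss)
      simp only [hD]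
      linarith
    · have := le_of_quadratic_defect (g := fun s => - D s) (c := k 0 * a) hy one_pos ?_
      · linarith
      intro s s' hs hss hs' _
      rcases eq_or_lt_of_le hss with rfl | hlt
      · simp
      have a2 := h1 s (s' - s) (sub_pos.2 hlt)
      rw [add_sub_cancel] at a2
      have a3 : k 0 * Real.exp (a * s) ≤ k s := by
        have := hkexp s 0 (hss.trans hs')
        simp only [mul_zero, neg_zero, Real.exp_zero, mul_one] at this
        rw [Real.exp_neg, ← div_eq_mul_inv, le_div_iff₀ (Real.exp_pos _)] at this
        exact this
      have a4 := mul_le_mul_of_nonneg_left (inc s s' hss).2 hk0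
      have a5 := mul_le_mul_of_nonneg_left (gap s s' 0 hss hs')
        (mul_nonneg hk0 (sub_nonneg.2 hss))
      have a6 := mul_le_mul_of_nonneg_left a3 (sub_nonneg.2 hss)
      simp only [mul_zero, Real.exp_zero, mul_one] at a5
      simp only [hD]
      linarith
  simp only [hD, mul_zero, Real.exp_zero, sub_self, zero_div] at hD0
  linarith

/-- The Golden–Thompson inequality `tr exp (A + y u uᵀ) ≤ tr (exp A exp (y u uᵀ))` for a rank-one
second matrix, the right-hand side being written out. -/
theorem trace_exp_add_smul_vecMulVec_le {p : ℕ} {A : Matrix (Fin p) (Fin p) ℝ}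
    (hA : A.IsHermitian) (u : Fin p → ℝ) (hu : 0 < u ⬝ᵥ u) (y : ℝ) :
    (NormedSpace.exp (A + y • Matrix.vecMulVec u u)).trace ≤ (NormedSpace.exp A).trace
      + u ⬝ᵥ (NormedSpace.exp A).mulVec u * ((Real.exp ((u ⬝ᵥ u) * y) - 1) / (u ⬝ᵥ u)) := by
  have hH : ∀ y : ℝ, (A + y • Matrix.vecMulVec u u).IsHermitian := fun y =>
    hA.add (isHermitian_smul (isHermitian_vecMulVec_self u) y)
  have hadd : ∀ y t : ℝ, A + (y + t) • Matrix.vecMulVec u u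
      = A + y • Matrix.vecMulVec u u + t • Matrix.vecMulVec u u := fun y t => by
    rw [add_smul, add_assoc]
  have := le_add_mul_exp_sub_one_div
    (K := fun y => (NormedSpace.exp (A + y • Matrix.vecMulVec u u)).trace)
    (k := fun y => u ⬝ᵥ (NormedSpace.exp (A + y • Matrix.vecMulVec u u)).mulVec u) hu ?_ ?_ ?_ ?_ y
  · simpa using this
  · intro y
    obtain ⟨V, h, -, -, -, v4⟩ := exists_spectral_exp (hH y)
    rw [v4, dotProduct_conj_diagonal_mulVec]
    positivity
  · intro y t ht
    rw [hadd]
    exact (trace_exp_increments (hH y) u ht).1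
  · intro y t ht
    rw [hadd]
    exact (trace_exp_increments (hH y) u ht).2.1
  · intro y t ht
    rw [hadd]
    exact (trace_exp_increments (hH y) u ht).2.2.2

/-! ### Exponential moments and deviation bounds -/

lemma continuous_trace_exp {X : Type*} [TopologicalSpace X] {p : ℕ}
    {F : X → Matrix (Fin p) (Fin p) ℝ} (hF : Continuous F) :
    Continuous fun x => (NormedSpace.exp (F x)).trace := by
  have : Continuous (NormedSpace.exp : Matrix (Fin p) (Fin p) ℝ → Matrix (Fin p) (Fin p) ℝ) := by
    open scoped Matrix.Norms.Operator in exact NormedSpace.exp_continuous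
  exact (this.comp hF).matrix_trace

lemma dotProduct_self_nonneg_real {p : ℕ} (u : Fin p → ℝ) : 0 ≤ u ⬝ᵥ u :=
  Finset.sum_nonneg fun _ _ => mul_self_nonneg _

lemma dotProduct_exp_mulVec_le {p : ℕ} {H : Matrix (Fin p) (Fin p) ℝ} (hH : H.IsHermitian)
    (u : Fin p → ℝ) :
    0 ≤ u ⬝ᵥ (NormedSpace.exp H).mulVec u ∧
      u ⬝ᵥ (NormedSpace.exp H).mulVec u ≤ (u ⬝ᵥ u) * (NormedSpace.exp H).trace := by
  obtain ⟨V, h, v1, v2, -, v4⟩ := exists_spectral_exp hH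
  rw [v4, dotProduct_conj_diagonal_mulVec, trace_conj_diagonal v1]
  refine ⟨by positivity, ?_⟩
  rw [Finset.mul_sum]
  refine Finset.sum_le_sum fun i _ => ?_
  have : u ⬝ᵥ u = ∑ i, V.transpose.mulVec u i ^ 2 := by
    have := dotProduct_mulVec_transpose_self V u
    rw [v2, Matrix.one_mulVec] at this
    rw [this]
    simp [dotProduct, sq]
  rw [mul_comm, this]
  gcongr
  exact Finset.single_le_sum (f := fun i => V.transpose.mulVec u i ^ 2)
    (fun i _ => sq_nonneg _) (Finset.mem_univ i)

/-- Adding to `H` a random multiple `y` of `u uᵀ` with `E exp (|u|² y) ≤ 1` does not increase the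
mean of `tr exp`. -/
lemma lintegral_trace_exp_add_smul_le {p : ℕ} {H : Matrix (Fin p) (Fin p) ℝ} (hH : H.IsHermitian)
    (u : Fin p → ℝ) {y : ℝ → ℝ}
    (h : ∫⁻ x, ENNReal.ofReal (Real.exp ((u ⬝ᵥ u) * y x)) ∂gaussianReal 0 1 ≤ 1) :
    ∫⁻ x, ENNReal.ofReal (NormedSpace.exp (H + y x • Matrix.vecMulVec u u)).trace
      ∂gaussianReal 0 1 ≤ ENNReal.ofReal (NormedSpace.exp H).trace := by
  rcases eq_or_lt_of_le (dotProduct_self_nonneg_real u) with h0 | hu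
  · have : u = 0 := dotProduct_self_eq_zero.1 h0.symm
    simp [this]
  obtain ⟨k0, k1⟩ := dotProduct_exp_mulVec_le hH u
  set a := u ⬝ᵥ u
  set k := u ⬝ᵥ (NormedSpace.exp H).mulVec u
  set T := (NormedSpace.exp H).trace
  have hT : 0 ≤ T - k / a := by
    rw [sub_nonneg, div_le_iff₀ hu]; linarith
  calc _ ≤ ∫⁻ x, (ENNReal.ofReal (T - k / a)
        + ENNReal.ofReal (k / a) * ENNReal.ofReal (Real.exp (a * y x))) ∂gaussianReal 0 1 := by
        refine lintegral_mono fun x => ?_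
        rw [← ENNReal.ofReal_mul (by positivity), ← ENNReal.ofReal_add hT (by positivity)]
        apply ENNReal.ofReal_le_ofReal
        refine (trace_exp_add_smul_vecMulVec_le hH u hu (y x)).trans (le_of_eq ?_)
        ring
    _ ≤ ENNReal.ofReal (T - k / a) + ENNReal.ofReal (k / a) * 1 := by
        rw [lintegral_add_left measurable_const, lintegral_const, measure_univ, mul_one,
          lintegral_const_mul' _ _ (by simp)]
        gcongr
    _ = ENNReal.ofReal T := by
        rw [mul_one, ← ENNReal.ofReal_add hT (by positivity)]
        congr 1
        ring

/-- The exponential moment of a sum of independent random multiples of rank-one matrices, bounded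
one coordinate at a time by means of the Golden–Thompson inequality. -/
theorem lintegral_trace_exp_sum_le {n p : ℕ} (u : Fin n → Fin p → ℝ) {y : Fin n → ℝ → ℝ}
    (hy : ∀ i, Continuous (y i))
    (h : ∀ i, ∫⁻ x, ENNReal.ofReal (Real.exp ((u i ⬝ᵥ u i) * y i x)) ∂gaussianReal 0 1 ≤ 1)
    {H : Matrix (Fin p) (Fin p) ℝ} (hH : H.IsHermitian) :
    ∫⁻ g, ENNReal.ofReal
      (NormedSpace.exp (H + ∑ i, y i (g i) • Matrix.vecMulVec (u i) (u i))).trace ∂weightLaw n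
      ≤ ENNReal.ofReal (NormedSpace.exp H).trace := by
  induction n generalizing H with
  | zero => simp
  | succ n ih =>
    have hc : Continuous fun g : Fin (n + 1) → ℝ => (NormedSpace.exp
        (H + ∑ i, y i (g i) • Matrix.vecMulVec (u i) (u i))).trace := by
      refine continuous_trace_exp (continuous_const.add (continuous_finsetSum _ fun i _ => ?_))
      exact ((hy i).comp (continuous_apply i)).smul continuous_const
    rw [lintegral_weightLaw_succ hc.measurable.ennreal_ofReal]
    refine le_trans (lintegral_mono fun t => ?_)
      (lintegral_trace_exp_add_smul_le hH (u 0) (h 0))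
    have := ih (fun i => u i.succ) (fun i => hy i.succ) (fun i => h i.succ)
      (hH.add (isHermitian_smul (isHermitian_vecMulVec_self (u 0)) (y 0 t)))
    refine le_trans (le_of_eq ?_) this
    simp only [Fin.sum_univ_succ, Fin.cons_zero, Fin.cons_succ, add_assoc]

/-- The cumulant generating function of `g² - 1`, `g` standard Gaussian, is sub-gamma. -/
lemma neg_half_log_sub_le {θ : ℝ} (hθ : |θ| < 1 / 2) :
    -(Real.log (1 - 2 * θ) / 2) - θ ≤ θ ^ 2 / (1 - 2 * |θ|) := by
  obtain ⟨hl, hr⟩ := abs_lt.1 hθ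
  have hτ : 0 < 1 - 2 * θ := by linarith
  rcases le_total 0 θ with h0 | h0
  · rw [abs_of_nonneg h0]
    have hlog : 0 ≤ -Real.log (1 - 2 * θ) := by
      rw [neg_nonneg]; exact Real.log_nonpos hτ.le (by linarith)
    have h1 := Real.self_le_sinh_iff.2 hlog
    rw [← Real.log_inv, Real.sinh_log (inv_pos.2 hτ), inv_inv, Real.log_inv] at h1
    have e : θ ^ 2 / (1 - 2 * θ) = ((1 - 2 * θ)⁻¹ - (1 - 2 * θ)) / 2 / 2 - θ := by
      obtain ⟨τ, hτe⟩ : ∃ τ, τ = 1 - 2 * θ := ⟨_, rfl⟩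
      have hθτ : θ = (1 - τ) / 2 := by linarith
      rw [← hτe] at hτ ⊢
      rw [hθτ]
      field_simp
      ring
    rw [e]
    linarith
  · rw [abs_of_nonpos h0]
    have h1 := Real.le_log_one_add_of_nonneg (x := -2 * θ) (by linarith)
    rw [show 1 + -2 * θ = 1 - 2 * θ by ring] at h1
    have hpos : 0 < -2 * θ + 2 := by linarith
    have h2 : -2 * θ - 2 * θ ^ 2 ≤ 2 * (-2 * θ) / (-2 * θ + 2) := by
      rw [le_div_iff₀ hpos]
      nlinarith [mul_nonneg (neg_nonneg.2 h0) (sq_nonneg θ)]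
    have h3 : θ ^ 2 ≤ θ ^ 2 / (1 - 2 * -θ) := by
      rw [le_div_iff₀ (by linarith)]
      nlinarith [mul_nonneg (neg_nonneg.2 h0) (sq_nonneg θ)]
    linarith

/-- Exponential moments of the noncentral chi-square variable `(g + B)²`, centered. -/
lemma lintegral_exp_mul_noncentral_le {θ : ℝ} (hθ : |θ| < 1 / 2) (B : ℝ) :
    ∫⁻ x, ENNReal.ofReal (Real.exp (θ * (x ^ 2 - 1 + 2 * B * x))) ∂gaussianReal 0 1
      ≤ ENNReal.ofReal (Real.exp (θ ^ 2 * (1 + 2 * B ^ 2) / (1 - 2 * |θ|))) := by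
  obtain ⟨hl, hr⟩ := abs_lt.1 hθ
  set τ : ℝ := 1 - 2 * θ with hτdef
  have hτ : 0 < τ := by rw [hτdef]; linarith
  set v : NNReal := ⟨τ⁻¹, (inv_pos.2 hτ).le⟩ with hv
  have hvτ : (v : ℝ) = τ⁻¹ := rfl
  have hv0 : v ≠ 0 := by
    intro h
    have : (v : ℝ) = 0 := by rw [h]; rfl
    rw [hvτ] at this
    exact (inv_pos.2 hτ).ne' this
  set A : ℝ := (√τ)⁻¹ * Real.exp (2 * θ ^ 2 * B ^ 2 / τ - θ) with hA
  have hpdf : ∀ x, gaussianPDFReal 0 1 x * Real.exp (θ * (x ^ 2 - 1 + 2 * B * x))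
      = A * gaussianPDFReal (2 * θ * B / τ) v x := by
    intro x
    simp only [gaussianPDFReal, hvτ, NNReal.coe_one, hA]
    have e1 : √(2 * Real.pi * τ⁻¹) = √(2 * Real.pi) * (√τ)⁻¹ := by
      rw [Real.sqrt_mul (by positivity), Real.sqrt_inv]
    have e2 : Real.exp (-(x - 0) ^ 2 / (2 * 1)) * Real.exp (θ * (x ^ 2 - 1 + 2 * B * x))
        = Real.exp (2 * θ ^ 2 * B ^ 2 / τ - θ)
          * Real.exp (-(x - 2 * θ * B / τ) ^ 2 / (2 * τ⁻¹)) := by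
      rw [← Real.exp_add, ← Real.exp_add]
      congr 1
      field_simp
      rw [hτdef]
      ring
    rw [e1, mul_assoc, e2, mul_one]
    have := (Real.sqrt_pos.2 hτ).ne'
    field_simp
  have key : ∫⁻ x, ENNReal.ofReal (Real.exp (θ * (x ^ 2 - 1 + 2 * B * x))) ∂gaussianReal 0 1
      = ENNReal.ofReal A := by
    rw [gaussianReal_of_var_ne_zero _ one_ne_zero,
      lintegral_withDensity_eq_lintegral_mul _ (measurable_gaussianPDF 0 1) (by fun_prop)]
    have : ∀ x, (gaussianPDF 0 1 * fun x => ENNReal.ofReal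
        (Real.exp (θ * (x ^ 2 - 1 + 2 * B * x)))) x
        = ENNReal.ofReal A * ENNReal.ofReal (gaussianPDFReal (2 * θ * B / τ) v x) := by
      intro x
      rw [← ENNReal.ofReal_mul (by positivity), ← hpdf,
        ENNReal.ofReal_mul (gaussianPDFReal_nonneg _ _ _)]
      rfl
    simp_rw [this]
    rw [lintegral_const_mul' _ _ (by simp), lintegral_gaussianPDFReal_eq_one _ hv0, mul_one]
  rw [key]
  apply ENNReal.ofReal_le_ofReal
  have hsq : (√τ)⁻¹ = Real.exp (-(Real.log τ / 2)) := by
    rw [Real.exp_neg, ← Real.log_sqrt hτ.le, Real.exp_log (Real.sqrt_pos.2 hτ)]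
  rw [hA, hsq, ← Real.exp_add, Real.exp_le_exp]
  have h1 := neg_half_log_sub_le hθ
  have hτ' : 1 - 2 * |θ| ≤ τ := by rw [hτdef]; linarith [le_abs_self θ]
  have h2 : 2 * θ ^ 2 * B ^ 2 / τ ≤ 2 * θ ^ 2 * B ^ 2 / (1 - 2 * |θ|) :=
    div_le_div_of_nonneg_left (by positivity) (by linarith) hτ'
  have e : θ ^ 2 * (1 + 2 * B ^ 2) / (1 - 2 * |θ|)
      = θ ^ 2 / (1 - 2 * |θ|) + 2 * θ ^ 2 * B ^ 2 / (1 - 2 * |θ|) := by ring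
  rw [e]
  linarith

lemma exp_le_trace_exp {p : ℕ} {H : Matrix (Fin p) (Fin p) ℝ} (hH : H.IsHermitian)
    {θ : Fin p → ℝ} {d : ℝ} (h : d * (θ ⬝ᵥ θ) < θ ⬝ᵥ H.mulVec θ) :
    Real.exp d ≤ (NormedSpace.exp H).trace := by
  obtain ⟨V, e, v1, v2, v3, v4⟩ := exists_spectral_exp hH
  rw [v4, trace_conj_diagonal v1]
  have hθ : θ ⬝ᵥ θ = ∑ i, V.transpose.mulVec θ i ^ 2 := by
    have := dotProduct_mulVec_transpose_self V θ
    rw [v2, Matrix.one_mulVec] at this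
    rw [this]
    simp [dotProduct, sq]
  obtain ⟨i, hi⟩ : ∃ i, d ≤ e i := by
    by_contra! hcon
    rw [v3, dotProduct_conj_diagonal_mulVec, hθ, Finset.mul_sum] at h
    refine absurd h (not_lt.2 (Finset.sum_le_sum fun i _ => ?_))
    exact mul_le_mul_of_nonneg_right (hcon i).le (sq_nonneg _)
  exact (Real.exp_le_exp.2 hi).trans
    (Finset.single_le_sum (f := fun i => Real.exp (e i)) (fun i _ => (Real.exp_pos _).le)
      (Finset.mem_univ i))

lemma trace_exp_smul_one {p : ℕ} (c : ℝ) :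
    (NormedSpace.exp (c • (1 : Matrix (Fin p) (Fin p) ℝ))).trace = p * Real.exp c := by
  rw [show c • (1 : Matrix (Fin p) (Fin p) ℝ) = Matrix.diagonal fun _ => c by
    ext i j; simp [Matrix.diagonal, Matrix.one_apply], Matrix.exp_diagonal, Matrix.trace_diagonal]
  simp [Pi.coe_exp, Real.exp_eq_exp_ℝ]

lemma dotProduct_sum_smul_vecMulVec {n p : ℕ} (u : Fin n → Fin p → ℝ) (y : Fin n → ℝ)
    (θ : Fin p → ℝ) :
    θ ⬝ᵥ (∑ i, y i • Matrix.vecMulVec (u i) (u i)).mulVec θ = ∑ i, y i * (u i ⬝ᵥ θ) ^ 2 := by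
  rw [Matrix.sum_mulVec, dotProduct_sum]
  refine Finset.sum_congr rfl fun i _ => ?_
  rw [Matrix.smul_mulVec, Matrix.vecMulVec_mulVec, dotProduct_smul]
  simp only [dotProduct_smul, op_smul_eq_smul, smul_eq_mul,
    dotProduct_comm θ (u i)]
  ring

/-- Laurent–Massart bound for matrices: one-sided deviation of a weighted sum of the rank-one
matrices `uᵢuᵢᵀ` with centered noncentral chi-square weights; the sign `s = ±1` gives the two
tails. The variance proxy is `δ²` since `∑ |uᵢ|² uᵢuᵢᵀ ≤ δ²` in the semidefinite order. -/
theorem weightLaw_quadratic_deviation_le {n p : ℕ} (u : Fin n → Fin p → ℝ)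
    (hu : ∑ i, Matrix.vecMulVec (u i) (u i) = 1) {δ : ℝ} (hδ : 0 < δ)
    (huδ : ∀ i, u i ⬝ᵥ u i ≤ δ ^ 2) (B : Fin n → ℝ) {b : ℝ} (hB : ∀ i, B i ^ 2 ≤ b) {L : ℝ}
    (hL : 0 < L) {s : ℝ} (hs : |s| = 1) :
    weightLaw n {g | ∃ θ : Fin p → ℝ, (2 * δ * √((1 + 2 * b) * L) + 2 * δ ^ 2 * L) * (θ ⬝ᵥ θ)
      < ∑ i, s * (g i ^ 2 - 1 + 2 * B i * g i) * (u i ⬝ᵥ θ) ^ 2}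
      ≤ ENNReal.ofReal (p * Real.exp (-L)) := by
  rcases Nat.eq_zero_or_pos n with rfl | hn
  · refine le_trans (le_of_eq ?_) zero_le
    convert measure_empty (μ := weightLaw 0)
    ext g
    simp only [Finset.univ_eq_empty, Finset.sum_empty, Set.mem_ofPred_eq, Set.mem_empty_iff_false,
      iff_false, not_exists, not_lt]
    intro θ
    have := dotProduct_self_nonneg_real θ
    positivity
  have hb : 0 ≤ b := (sq_nonneg _).trans (hB ⟨0, hn⟩)
  have hs2 : s ^ 2 = 1 := by rw [← sq_abs, hs, one_pow]
  set r := √L with hr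
  have hr0 : 0 < r := Real.sqrt_pos.2 hL
  have hrL : r ^ 2 = L := Real.sq_sqrt hL.le
  set w := √(1 + 2 * b) with hw
  have hw0 : 0 < w := Real.sqrt_pos.2 (by linarith)
  have hw2 : w ^ 2 = 1 + 2 * b := Real.sq_sqrt (by linarith)
  have hD : 2 * δ * √((1 + 2 * b) * L) + 2 * δ ^ 2 * L = 2 * δ * (w * r) + 2 * δ ^ 2 * r ^ 2 := by
    rw [Real.sqrt_mul (by linarith), hrL]
  rw [hD]
  set D := 2 * δ * (w * r) + 2 * δ ^ 2 * r ^ 2 with hDdef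
  -- the optimal exponent
  set l := r / (δ * w + 2 * δ ^ 2 * r) with hl
  have hden : 0 < δ * w + 2 * δ ^ 2 * r := by positivity
  have hl0 : 0 < l := by positivity
  have hτ : 1 - 2 * l * δ ^ 2 = δ * w / (δ * w + 2 * δ ^ 2 * r) := by
    rw [hl]; field_simp; ring
  have hτ0 : 0 < 1 - 2 * l * δ ^ 2 := by rw [hτ]; positivity
  set c := l ^ 2 * δ ^ 2 * (1 + 2 * b) / (1 - 2 * l * δ ^ 2) with hc
  have hopt : c - l * D = -L := by
    rw [hc, hτ, ← hw2, hDdef, hl, ← hrL]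
    field_simp
    ring
  have hmean : ∀ i, ∫⁻ x, ENNReal.ofReal (Real.exp ((u i ⬝ᵥ u i)
      * (l * (s * (x ^ 2 - 1 + 2 * B i * x)) - c))) ∂gaussianReal 0 1 ≤ 1 := by
    intro i
    set a := u i ⬝ᵥ u i with ha
    have ha0 : 0 ≤ a := dotProduct_self_nonneg_real _
    have haδ : a ≤ δ ^ 2 := huδ i
    have habs : |s * (l * a)| = l * a := by
      rw [abs_mul, hs, one_mul, abs_of_nonneg (by positivity)]
    have hla : l * a ≤ l * δ ^ 2 := by gcongr
    have hm := lintegral_exp_mul_noncentral_le (θ := s * (l * a)) (by rw [habs]; linarith) (B i)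
    have e : ∀ x, ENNReal.ofReal (Real.exp (a * (l * (s * (x ^ 2 - 1 + 2 * B i * x)) - c)))
        = ENNReal.ofReal (Real.exp (-(a * c))) * ENNReal.ofReal
          (Real.exp (s * (l * a) * (x ^ 2 - 1 + 2 * B i * x))) := by
      intro x
      rw [← ENNReal.ofReal_mul (by positivity), ← Real.exp_add]
      ring_nf
    simp_rw [e]
    rw [lintegral_const_mul' _ _ (by simp)]
    refine (mul_le_mul_right hm _).trans ?_
    rw [← ENNReal.ofReal_mul (by positivity), ← Real.exp_add, ENNReal.ofReal_le_one,
      Real.exp_le_one_iff, habs]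
    have h1 : (s * (l * a)) ^ 2 * (1 + 2 * B i ^ 2) / (1 - 2 * (l * a)) ≤ a * c := by
      have e1 : a * c = a * (l ^ 2 * δ ^ 2 * (1 + 2 * b)) / (1 - 2 * l * δ ^ 2) := by rw [hc]; ring
      rw [e1, mul_pow, hs2, one_mul]
      refine div_le_div₀ (by positivity) ?_ hτ0 (by linarith)
      have h2 : 1 + 2 * B i ^ 2 ≤ 1 + 2 * b := by linarith [hB i]
      calc (l * a) ^ 2 * (1 + 2 * B i ^ 2) = a * (l ^ 2 * a * (1 + 2 * B i ^ 2)) := by ring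
        _ ≤ a * (l ^ 2 * δ ^ 2 * (1 + 2 * b)) := by gcongr
    linarith
  have hH : (c • (1 : Matrix (Fin p) (Fin p) ℝ)).IsHermitian :=
    isHermitian_smul Matrix.isHermitian_one c
  have hexp := lintegral_trace_exp_sum_le u
    (y := fun i x => l * (s * (x ^ 2 - 1 + 2 * B i * x)) - c) (fun i => by fun_prop) hmean hH
  rw [trace_exp_smul_one] at hexp
  have hZ : ∀ g : Fin n → ℝ, c • (1 : Matrix (Fin p) (Fin p) ℝ)
      + ∑ i, (l * (s * (g i ^ 2 - 1 + 2 * B i * g i)) - c) • Matrix.vecMulVec (u i) (u i)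
      = ∑ i, (l * (s * (g i ^ 2 - 1 + 2 * B i * g i))) • Matrix.vecMulVec (u i) (u i) := by
    intro g
    simp_rw [sub_smul]
    rw [Finset.sum_sub_distrib, ← Finset.smul_sum, hu]
    abel
  simp_rw [hZ] at hexp
  set f : (Fin n → ℝ) → ENNReal := fun g => ENNReal.ofReal (NormedSpace.exp (∑ i,
    (l * (s * (g i ^ 2 - 1 + 2 * B i * g i))) • Matrix.vecMulVec (u i) (u i))).trace with hf
  have hfm : Measurable f := by
    refine (continuous_trace_exp (continuous_finsetSum _ fun i _ => ?_)).measurable.ennreal_ofReal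
    exact (by fun_prop : Continuous fun g : Fin n → ℝ =>
      l * (s * (g i ^ 2 - 1 + 2 * B i * g i))).smul continuous_const
  calc _ ≤ weightLaw n {g | ENNReal.ofReal (Real.exp (l * D)) ≤ f g} := by
        refine measure_mono ?_
        rintro g ⟨θ, hθ⟩
        refine ENNReal.ofReal_le_ofReal (exp_le_trace_exp (θ := θ) ?_ ?_)
        · refine Matrix.isHermitian_iff_isSelfAdjoint.2 ?_
          refine isSelfAdjoint_sum _ fun i _ => ?_
          exact isHermitian_smul (isHermitian_vecMulVec_self (u i)) _
        · rw [dotProduct_sum_smul_vecMulVec]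
          have := mul_lt_mul_of_pos_left hθ hl0
          rw [Finset.mul_sum, ← mul_assoc] at this
          refine this.trans_le (le_of_eq (Finset.sum_congr rfl fun i _ => by ring))
    _ ≤ (∫⁻ g, f g ∂weightLaw n) / ENNReal.ofReal (Real.exp (l * D)) :=
        meas_ge_le_lintegral_div hfm.aemeasurable (by simp [Real.exp_pos]) (by simp)
    _ ≤ ENNReal.ofReal (p * Real.exp c) / ENNReal.ofReal (Real.exp (l * D)) := by gcongr
    _ = _ := by
        rw [← ENNReal.ofReal_div_of_pos (Real.exp_pos _), mul_div_assoc, ← Real.exp_sub, hopt]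

lemma lintegral_exp_dotProduct {n : ℕ} (c : Fin n → ℝ) :
    ∫⁻ g, ENNReal.ofReal (Real.exp (c ⬝ᵥ g)) ∂weightLaw n
      = ENNReal.ofReal (Real.exp ((c ⬝ᵥ c) / 2)) := by
  have h1 : ∀ t : ℝ, ∫⁻ x, ENNReal.ofReal (Real.exp (t * x)) ∂gaussianReal 0 1
      = ENNReal.ofReal (Real.exp (t * t / 2)) := by
    intro t
    rw [← ofReal_integral_eq_lintegral_ofReal (integrable_exp_mul_gaussianReal t)
      (.of_forall fun x => (Real.exp_pos _).le)]
    have := congrFun (mgf_fun_id_gaussianReal (μ := 0) (v := 1)) t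
    rw [mgf] at this
    rw [this]
    simp [sq]
  induction n with
  | zero => simp
  | succ n ih =>
    rw [lintegral_weightLaw_succ (by unfold dotProduct; fun_prop)]
    have e : ∀ t : ℝ, ∫⁻ g, ENNReal.ofReal (Real.exp (c ⬝ᵥ (Fin.cons t g : Fin (n + 1) → ℝ)))
        ∂weightLaw n = ENNReal.ofReal (Real.exp (c 0 * t)) * ENNReal.ofReal
          (Real.exp (((fun i : Fin n => c i.succ) ⬝ᵥ fun i => c i.succ) / 2)) := by
      intro t
      rw [← ih (fun i => c i.succ), ← lintegral_const_mul' _ _ (by simp)]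
      refine lintegral_congr fun g => ?_
      rw [← ENNReal.ofReal_mul (by positivity), ← Real.exp_add]
      simp only [dotProduct, Fin.sum_univ_succ, Fin.cons_zero, Fin.cons_succ]
    simp_rw [e]
    rw [lintegral_mul_const' _ _ (by simp), h1, ← ENNReal.ofReal_mul (by positivity),
      ← Real.exp_add]
    simp only [dotProduct, Fin.sum_univ_succ]
    ring_nf

/-- Gaussian tail bound for a linear form with coefficient vector of norm at most `δ`. -/
lemma weightLaw_abs_dotProduct_le {n : ℕ} (c : Fin n → ℝ) {δ X : ℝ} (hδ : 0 < δ)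
    (hc : c ⬝ᵥ c ≤ δ ^ 2) (hX : 0 ≤ X) :
    weightLaw n {g | δ * √(2 * X) < |c ⬝ᵥ g|} ≤ ENNReal.ofReal (2 * Real.exp (-X)) := by
  set r := √(2 * X) with hr
  have hr2 : r ^ 2 = 2 * X := Real.sq_sqrt (by linarith)
  have hr0 : 0 ≤ r := Real.sqrt_nonneg _
  have one : ∀ d : Fin n → ℝ, d ⬝ᵥ d ≤ δ ^ 2 →
      weightLaw n {g | δ * r ≤ d ⬝ᵥ g} ≤ ENNReal.ofReal (Real.exp (-X)) := by
    intro d hd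
    have hm := lintegral_exp_dotProduct ((r / δ) • d)
    set f : (Fin n → ℝ) → ENNReal := fun g => ENNReal.ofReal (Real.exp (((r / δ) • d) ⬝ᵥ g)) with hf
    have hfm : Measurable f := by
      have : Continuous fun g : Fin n → ℝ => ((r / δ) • d) ⬝ᵥ g := by
        unfold dotProduct; fun_prop
      exact (Real.measurable_exp.comp this.measurable).ennreal_ofReal
    calc _ ≤ weightLaw n {g | ENNReal.ofReal (Real.exp (r ^ 2)) ≤ f g} := by
          refine measure_mono fun g (hg : δ * r ≤ d ⬝ᵥ g) => ?_
          refine ENNReal.ofReal_le_ofReal (Real.exp_le_exp.2 ?_)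
          rw [smul_dotProduct, smul_eq_mul]
          calc r ^ 2 = r / δ * (δ * r) := by field_simp
            _ ≤ _ := by gcongr
      _ ≤ (∫⁻ g, f g ∂weightLaw n) / ENNReal.ofReal (Real.exp (r ^ 2)) :=
          meas_ge_le_lintegral_div hfm.aemeasurable (by simp [Real.exp_pos]) (by simp)
      _ ≤ _ := by
          rw [hm, ← ENNReal.ofReal_div_of_pos (Real.exp_pos _), ← Real.exp_sub]
          refine ENNReal.ofReal_le_ofReal (Real.exp_le_exp.2 ?_)
          rw [smul_dotProduct, dotProduct_smul, smul_eq_mul, smul_eq_mul, ← mul_assoc]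
          have : r / δ * (r / δ) * (d ⬝ᵥ d) ≤ r / δ * (r / δ) * δ ^ 2 := by gcongr
          have e : r / δ * (r / δ) * δ ^ 2 = r ^ 2 := by field_simp
          linarith
  have hsub : {g | δ * r < |c ⬝ᵥ g|} ⊆ {g | δ * r ≤ c ⬝ᵥ g} ∪ {g | δ * r ≤ (-c) ⬝ᵥ g} := by
    intro g (hg : δ * r < |c ⬝ᵥ g|)
    rcases lt_abs.1 hg with h | h
    · exact Or.inl h.le
    · exact Or.inr (by rw [Set.mem_ofPred_eq, neg_dotProduct]; exact h.le)
  have h2 := one (-c) (by rwa [neg_dotProduct_neg])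
  rw [two_mul, ENNReal.ofReal_add (Real.exp_pos _).le (Real.exp_pos _).le]
  exact (measure_mono hsub).trans ((measure_union_le _ _).trans (add_le_add (one c hc) h2))

/-! ### Quantiles of norms of Gaussian vectors -/

lemma eucNorm_nonneg {k : ℕ} (v : Fin k → ℝ) : 0 ≤ eucNorm v := norm_nonneg _

lemma eucNorm_add_le {k : ℕ} (v w : Fin k → ℝ) : eucNorm (v + w) ≤ eucNorm v + eucNorm w :=
  norm_add_le (WithLp.toLp 2 v : EuclideanSpace ℝ (Fin k)) (WithLp.toLp 2 w)

lemma eucNorm_smul {k : ℕ} (t : ℝ) (v : Fin k → ℝ) : eucNorm (t • v) = |t| * eucNorm v :=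
  norm_smul t (WithLp.toLp 2 v : EuclideanSpace ℝ (Fin k))

lemma eucNorm_neg {k : ℕ} (v : Fin k → ℝ) : eucNorm (-v) = eucNorm v :=
  norm_neg (WithLp.toLp 2 v : EuclideanSpace ℝ (Fin k))

lemma eucNorm_sq {k : ℕ} (v : Fin k → ℝ) : eucNorm v ^ 2 = v ⬝ᵥ v := by
  rw [eucNorm, EuclideanSpace.norm_sq_eq]
  simp [dotProduct, sq]

lemma eucNorm_eq_zero {k : ℕ} {v : Fin k → ℝ} : eucNorm v = 0 ↔ v = 0 := by
  rw [← sq_eq_zero_iff, eucNorm_sq, dotProduct_self_eq_zero]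

lemma continuous_eucNorm {k : ℕ} : Continuous (eucNorm : (Fin k → ℝ) → ℝ) :=
  continuous_norm.comp (PiLp.continuous_toLp 2 _)

lemma continuous_eucNorm_mulVec {k q : ℕ} (A : Matrix (Fin q) (Fin k) ℝ) :
    Continuous fun v => eucNorm (A.mulVec v) :=
  continuous_eucNorm.comp (Continuous.matrix_mulVec continuous_const continuous_id)

lemma measurable_eucNorm_mulVec {k q : ℕ} (A : Matrix (Fin q) (Fin k) ℝ) :
    Measurable fun v => eucNorm (A.mulVec v) :=
  (continuous_eucNorm_mulVec A).measurable

lemma eucNorm_mulVec_combo_le {k q : ℕ} (A : Matrix (Fin q) (Fin k) ℝ) (v w : Fin k → ℝ)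
    {a b : ℝ} (ha : 0 ≤ a) (hb : 0 ≤ b) :
    eucNorm (A.mulVec (a • v + b • w)) ≤ a * eucNorm (A.mulVec v) + b * eucNorm (A.mulVec w) := by
  rw [Matrix.mulVec_add, Matrix.mulVec_smul, Matrix.mulVec_smul]
  refine (eucNorm_add_le _ _).trans ?_
  rw [eucNorm_smul, eucNorm_smul, abs_of_nonneg ha, abs_of_nonneg hb]

lemma exists_eucNorm_mulVec_pos {k q : ℕ} {A : Matrix (Fin q) (Fin k) ℝ} (hA : A ≠ 0) :
    ∃ v, 0 < eucNorm (A.mulVec v) := by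
  by_contra! h
  refine hA (Matrix.ext fun i j => ?_)
  have h0 : eucNorm (A.mulVec (Pi.single j 1)) = 0 := le_antisymm (h _) (eucNorm_nonneg _)
  rw [eucNorm_eq_zero] at h0
  simpa using congrFun h0 i

/-- The quantile of the norm of `A w`, `w` standard Gaussian: the smallest `z ≥ 0` with
`P(‖A w‖ > z) ≤ exp (-s)`. -/
noncomputable def normQuantile {k q : ℕ} (A : Matrix (Fin q) (Fin k) ℝ) (s : ℝ) : ℝ :=
  sInf {z : ℝ | 0 ≤ z ∧ (weightLaw k).real {w | z < eucNorm (A.mulVec w)} ≤ Real.exp (-s)}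

lemma normQuantile_nonneg {k q : ℕ} (A : Matrix (Fin q) (Fin k) ℝ) (s : ℝ) :
    0 ≤ normQuantile A s := Real.sInf_nonneg fun _ h => h.1

lemma bddBelow_quantile_set {k q : ℕ} (A : Matrix (Fin q) (Fin k) ℝ) (s : ℝ) :
    BddBelow {z : ℝ | 0 ≤ z ∧ (weightLaw k).real {w | z < eucNorm (A.mulVec w)}
      ≤ Real.exp (-s)} := ⟨0, fun _ h => h.1⟩

lemma normQuantile_le {k q : ℕ} {A : Matrix (Fin q) (Fin k) ℝ} {s z : ℝ} (hz : 0 ≤ z)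
    (h : (weightLaw k).real {w | z < eucNorm (A.mulVec w)} ≤ Real.exp (-s)) :
    normQuantile A s ≤ z := csInf_le (bddBelow_quantile_set A s) ⟨hz, h⟩

lemma exists_forall_tail_le {k q : ℕ} {ι : Type*} (M : Finset ι)
    (A : ι → Matrix (Fin q) (Fin k) ℝ) {ε : ℝ} (hε : 0 < ε) :
    ∃ z, 0 ≤ z ∧ (weightLaw k).real {w | ∃ m ∈ M, z < eucNorm ((A m).mulVec w)} ≤ ε := by
  have hanti : Antitone fun j : ℕ => {w | ∃ m ∈ M, (j : ℝ) < eucNorm ((A m).mulVec w)} := by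
    rintro i j hij w ⟨m, hm, h⟩
    exact ⟨m, hm, lt_of_le_of_lt (by exact_mod_cast hij) h⟩
  have hmeas : ∀ j : ℕ, MeasurableSet {w | ∃ m ∈ M, (j : ℝ) < eucNorm ((A m).mulVec w)} := by
    intro j
    have : {w | ∃ m ∈ M, (j : ℝ) < eucNorm ((A m).mulVec w)}
        = ⋃ m ∈ M, {w | (j : ℝ) < eucNorm ((A m).mulVec w)} := by ext; simp
    rw [this]
    exact Finset.measurableSet_biUnion _ fun m _ =>
      measurableSet_lt measurable_const (measurable_eucNorm_mulVec (A m))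
  have hempty : ⋂ j : ℕ, {w | ∃ m ∈ M, (j : ℝ) < eucNorm ((A m).mulVec w)} = ∅ := by
    ext w
    simp only [Set.mem_iInter, Set.mem_ofPred_eq, Set.mem_empty_iff_false, iff_false, not_forall]
    obtain ⟨j, hj⟩ := exists_nat_gt (∑ m ∈ M, eucNorm ((A m).mulVec w))
    refine ⟨j, ?_⟩
    rintro ⟨m, hm, h⟩
    have := Finset.single_le_sum (f := fun m => eucNorm ((A m).mulVec w))
      (fun i _ => eucNorm_nonneg _) hm
    linarith
  have hlim := tendsto_measure_iInter_atTop (μ := weightLaw k)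
    (fun j => (hmeas j).nullMeasurableSet) hanti ⟨0, by finiteness⟩
  rw [hempty, measure_empty] at hlim
  obtain ⟨j, hj⟩ := (hlim.eventually_le_const (ENNReal.ofReal_pos.2 hε)).exists
  exact ⟨j, by positivity, ENNReal.toReal_le_of_le_ofReal hε.le hj⟩

lemma nonempty_quantile_set {k q : ℕ} (A : Matrix (Fin q) (Fin k) ℝ) (s : ℝ) :
    {z : ℝ | 0 ≤ z ∧ (weightLaw k).real {w | z < eucNorm (A.mulVec w)}
      ≤ Real.exp (-s)}.Nonempty := by
  obtain ⟨z, hz, h⟩ := exists_forall_tail_le {()} (fun _ => A) (Real.exp_pos (-s))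
  exact ⟨z, hz, by simpa using h⟩

lemma tail_anti {k q : ℕ} (A : Matrix (Fin q) (Fin k) ℝ) {z z' : ℝ} (h : z ≤ z') :
    (weightLaw k).real {w | z' < eucNorm (A.mulVec w)}
      ≤ (weightLaw k).real {w | z < eucNorm (A.mulVec w)} :=
  measureReal_mono fun _ hw => lt_of_le_of_lt h hw

lemma normQuantile_mono {k q : ℕ} (A : Matrix (Fin q) (Fin k) ℝ) {s s' : ℝ} (h : s ≤ s') :
    normQuantile A s ≤ normQuantile A s' := by
  refine csInf_le_csInf (bddBelow_quantile_set A s) (nonempty_quantile_set A s') ?_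
  exact fun z hz => ⟨hz.1, hz.2.trans (Real.exp_le_exp.2 (by linarith))⟩

lemma normQuantile_of_nonpos {k q : ℕ} (A : Matrix (Fin q) (Fin k) ℝ) {s : ℝ} (h : s ≤ 0) :
    normQuantile A s = 0 := by
  refine le_antisymm (normQuantile_le le_rfl ?_) (normQuantile_nonneg A s)
  exact measureReal_le_one.trans (Real.one_le_exp (by linarith))

lemma measurableSet_forall_lt {k q : ℕ} {ι : Type*} (M : Finset ι)
    (A : ι → Matrix (Fin q) (Fin k) ℝ) (t : ι → ℝ) :
    MeasurableSet {v | ∀ m ∈ M, eucNorm ((A m).mulVec v) < t m} := by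
  have : {v | ∀ m ∈ M, eucNorm ((A m).mulVec v) < t m}
      = ⋂ m ∈ M, {v | eucNorm ((A m).mulVec v) < t m} := by ext; simp
  rw [this]
  exact Finset.measurableSet_biInter _ fun m _ =>
    measurableSet_lt (measurable_eucNorm_mulVec (A m)) measurable_const

/-- Anderson comparison for finitely many norms: a larger covariance makes the excess of given
levels more likely. -/
lemma exists_le_eucNorm_mono {k n₁ n₂ q : ℕ} {ι : Type*} (M : Finset ι)
    (A : ι → Matrix (Fin q) (Fin k) ℝ) (t : ι → ℝ) (T₁ : Matrix (Fin k) (Fin n₁) ℝ)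
    (T₂ : Matrix (Fin k) (Fin n₂) ℝ)
    (h : ∀ θ, T₁.transpose.mulVec θ ⬝ᵥ T₁.transpose.mulVec θ
      ≤ T₂.transpose.mulVec θ ⬝ᵥ T₂.transpose.mulVec θ) :
    (weightLaw n₁).real {w | ∃ m ∈ M, t m ≤ eucNorm ((A m).mulVec (T₁.mulVec w))}
      ≤ (weightLaw n₂).real {w | ∃ m ∈ M, t m ≤ eucNorm ((A m).mulVec (T₂.mulVec w))} := by
  set C : Set (Fin k → ℝ) := {v | ∀ m ∈ M, eucNorm ((A m).mulVec v) < t m} with hC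
  have hCm : MeasurableSet C := measurableSet_forall_lt M A t
  have hconv : Convex ℝ C := by
    intro v hv w hw a b ha hb hab m hm
    refine (eucNorm_mulVec_combo_le (A m) v w ha hb).trans_lt ?_
    have h1 := hv m hm
    have h2 := hw m hm
    rcases eq_or_lt_of_le ha with rfl | ha'
    · have : b = 1 := by linarith
      subst this; linarith
    · have e : t m = a * t m + b * t m := by rw [← add_mul, hab, one_mul]
      rw [e]
      have := mul_lt_mul_of_pos_left h1 ha'
      have := mul_le_mul_of_nonneg_left h2.le hb
      linarith
  have hsymm : ∀ v ∈ C, -v ∈ C := by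
    intro v hv m hm
    rw [Matrix.mulVec_neg, eucNorm_neg]
    exact hv m hm
  have key := weightLaw_le_of_covariance_le T₁ T₂ h hCm hconv hsymm
  have e : ∀ {n : ℕ} (T : Matrix (Fin k) (Fin n) ℝ),
      (weightLaw n).real {w | ∃ m ∈ M, t m ≤ eucNorm ((A m).mulVec (T.mulVec w))}
        = 1 - (weightLaw n).real {w | T.mulVec w ∈ C} := by
    intro n T
    have hmT : MeasurableSet {w | T.mulVec w ∈ C} := (measurable_mulVec T) hCm
    rw [← probReal_compl_eq_one_sub hmT]
    congr 1
    ext w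
    simp [hC]
  rw [e, e]
  have := ENNReal.toReal_mono (by finiteness) key
  simp only [← measureReal_def] at this
  linarith

lemma lt_eucNorm_mono {k n₁ n₂ q : ℕ} (A : Matrix (Fin q) (Fin k) ℝ) (z : ℝ)
    (T₁ : Matrix (Fin k) (Fin n₁) ℝ) (T₂ : Matrix (Fin k) (Fin n₂) ℝ)
    (h : ∀ θ, T₁.transpose.mulVec θ ⬝ᵥ T₁.transpose.mulVec θ
      ≤ T₂.transpose.mulVec θ ⬝ᵥ T₂.transpose.mulVec θ) :
    (weightLaw n₁).real {w | z < eucNorm (A.mulVec (T₁.mulVec w))}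
      ≤ (weightLaw n₂).real {w | z < eucNorm (A.mulVec (T₂.mulVec w))} := by
  set C : Set (Fin k → ℝ) := {v | eucNorm (A.mulVec v) ≤ z} with hC
  have hCm : MeasurableSet C := measurableSet_le (measurable_eucNorm_mulVec A) measurable_const
  have hconv : Convex ℝ C := by
    intro v hv w hw a b ha hb hab
    refine (eucNorm_mulVec_combo_le A v w ha hb).trans ?_
    have e : z = a * z + b * z := by rw [← add_mul, hab, one_mul]
    rw [e]
    exact add_le_add (mul_le_mul_of_nonneg_left hv ha) (mul_le_mul_of_nonneg_left hw hb)
  have hsymm : ∀ v ∈ C, -v ∈ C := by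
    intro v (hv : _ ≤ z)
    show _ ≤ z
    rwa [Matrix.mulVec_neg, eucNorm_neg]
  have key := weightLaw_le_of_covariance_le T₁ T₂ h hCm hconv hsymm
  have e : ∀ {n : ℕ} (T : Matrix (Fin k) (Fin n) ℝ),
      (weightLaw n).real {w | z < eucNorm (A.mulVec (T.mulVec w))}
        = 1 - (weightLaw n).real {w | T.mulVec w ∈ C} := by
    intro n T
    have hmT : MeasurableSet {w | T.mulVec w ∈ C} := (measurable_mulVec T) hCm
    rw [← probReal_compl_eq_one_sub hmT]
    congr 1
    ext w
    simp [hC]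
  rw [e, e]
  have := ENNReal.toReal_mono (by finiteness) key
  simp only [← measureReal_def] at this
  linarith

lemma normQuantile_mono_covariance {k n₁ n₂ q : ℕ} (A : Matrix (Fin q) (Fin k) ℝ) (s : ℝ)
    (T₁ : Matrix (Fin k) (Fin n₁) ℝ) (T₂ : Matrix (Fin k) (Fin n₂) ℝ)
    (h : ∀ θ, T₁.transpose.mulVec θ ⬝ᵥ T₁.transpose.mulVec θ
      ≤ T₂.transpose.mulVec θ ⬝ᵥ T₂.transpose.mulVec θ) :
    normQuantile (A * T₁) s ≤ normQuantile (A * T₂) s := by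
  refine csInf_le_csInf (bddBelow_quantile_set _ s) (nonempty_quantile_set _ s) ?_
  rintro z ⟨hz, hz'⟩
  refine ⟨hz, le_trans ?_ hz'⟩
  simp_rw [← Matrix.mulVec_mulVec]
  exact lt_eucNorm_mono A z T₁ T₂ h

lemma normQuantile_smul_one {k q : ℕ} (A : Matrix (Fin q) (Fin k) ℝ) (s : ℝ) {α : ℝ}
    (hα : 0 < α) :
    normQuantile (A * (α • (1 : Matrix (Fin k) (Fin k) ℝ))) s = α * normQuantile A s := by
  have e : ∀ w, eucNorm ((A * (α • (1 : Matrix (Fin k) (Fin k) ℝ))).mulVec w)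
      = α * eucNorm (A.mulVec w) := by
    intro w
    rw [Matrix.mul_smul, Matrix.mul_one, Matrix.smul_mulVec, eucNorm_smul, abs_of_pos hα]
  unfold normQuantile
  rw [← smul_eq_mul, ← Real.sInf_smul_of_nonneg hα.le]
  congr 1
  ext z
  simp_rw [e, Set.mem_smul_set_iff_inv_smul_mem₀ hα.ne', Set.mem_ofPred_eq, smul_eq_mul,
    ← div_eq_inv_mul, div_lt_iff₀' hα]
  rw [le_div_iff₀ hα, zero_mul]

instance isOpenPosMeasure_weightLaw (k : ℕ) : (weightLaw k).IsOpenPosMeasure := by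
  have : (gaussianReal 0 1).IsOpenPosMeasure :=
    (gaussianReal_absolutelyContinuous' 0 one_ne_zero).isOpenPosMeasure
  unfold weightLaw
  infer_instance

/-- The norm of a nondegenerate linear image of a Gaussian vector charges every interval. -/
lemma weightLaw_shell_pos {k q : ℕ} {A : Matrix (Fin q) (Fin k) ℝ} (hA : A ≠ 0) {z z' : ℝ}
    (hz : 0 ≤ z) (h : z < z') :
    0 < (weightLaw k).real {w | z < eucNorm (A.mulVec w) ∧ eucNorm (A.mulVec w) < z'} := by
  obtain ⟨v, hv⟩ := exists_eucNorm_mulVec_pos hA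
  have ho : IsOpen {w | z < eucNorm (A.mulVec w) ∧ eucNorm (A.mulVec w) < z'} :=
    (isOpen_lt continuous_const (continuous_eucNorm_mulVec A)).inter
      (isOpen_lt (continuous_eucNorm_mulVec A) continuous_const)
  have hq : 0 ≤ (z + z') / 2 / eucNorm (A.mulVec v) := div_nonneg (by linarith) hv.le
  refine ENNReal.toReal_pos (ho.measure_pos _ ⟨((z + z') / 2 / eucNorm (A.mulVec v)) • v, ?_⟩).ne'
    (by finiteness)
  rw [Set.mem_ofPred_eq, Matrix.mulVec_smul, eucNorm_smul, abs_of_nonneg hq,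
    div_mul_cancel₀ _ hv.ne']
  constructor <;> linarith

lemma tail_strictAnti {k q : ℕ} {A : Matrix (Fin q) (Fin k) ℝ} (hA : A ≠ 0) {z z' : ℝ}
    (hz : 0 ≤ z) (h : z < z') :
    (weightLaw k).real {w | z' < eucNorm (A.mulVec w)}
      < (weightLaw k).real {w | z < eucNorm (A.mulVec w)} := by
  have h0 := weightLaw_shell_pos hA hz h
  have hd : Disjoint {w | z' < eucNorm (A.mulVec w)}
      {w | z < eucNorm (A.mulVec w) ∧ eucNorm (A.mulVec w) < z'} := by
    rw [Set.disjoint_left]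
    intro w h1 h2
    exact lt_asymm (Set.mem_ofPred_eq.mp h1) h2.2
  have hm : MeasurableSet {w | z < eucNorm (A.mulVec w) ∧ eucNorm (A.mulVec w) < z'} :=
    (measurableSet_lt measurable_const (measurable_eucNorm_mulVec A)).inter
      (measurableSet_lt (measurable_eucNorm_mulVec A) measurable_const)
  have := measureReal_union (μ := weightLaw k) hd hm
  have hle : (weightLaw k).real ({w | z' < eucNorm (A.mulVec w)} ∪
      {w | z < eucNorm (A.mulVec w) ∧ eucNorm (A.mulVec w) < z'})
      ≤ (weightLaw k).real {w | z < eucNorm (A.mulVec w)} := by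
    refine measureReal_mono ?_
    rintro w (hw | hw)
    · exact h.trans hw
    · exact hw.1
  linarith

/-- The quantile function is right-continuous. -/
lemma exists_normQuantile_le {k q : ℕ} {A : Matrix (Fin q) (Fin k) ℝ} (hA : A ≠ 0) {s c : ℝ}
    (h : normQuantile A s < c) : ∃ s' > s, normQuantile A s' ≤ c := by
  obtain ⟨z, ⟨hz0, hz⟩, hzc⟩ := exists_lt_of_csInf_lt (nonempty_quantile_set A s) h
  have hlt := (tail_strictAnti hA hz0 hzc).trans_le hz
  have hcont : Filter.Tendsto (fun s' => Real.exp (-s')) (nhdsWithin s (Set.Ioi s))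
      (nhds (Real.exp (-s))) :=
    (Continuous.tendsto (by fun_prop) s).mono_left nhdsWithin_le_nhds
  obtain ⟨s', h1, h2⟩ := ((hcont.eventually_const_lt hlt).and self_mem_nhdsWithin).exists
  exact ⟨s', h2, normQuantile_le (hz0.trans hzc.le) h1.le⟩

lemma exists_le_normQuantile {k q : ℕ} {A : Matrix (Fin q) (Fin k) ℝ} (hA : A ≠ 0) {Z : ℝ}
    (hZ : 0 ≤ Z) : ∃ s, Z ≤ normQuantile A s := by
  have hpos : 0 < (weightLaw k).real {w | Z < eucNorm (A.mulVec w)} :=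
    lt_of_le_of_lt measureReal_nonneg (tail_strictAnti hA hZ (lt_add_one Z))
  have hlim : Filter.Tendsto (fun s => Real.exp (-s)) Filter.atTop (nhds 0) :=
    Real.tendsto_exp_neg_atTop_nhds_zero
  obtain ⟨s, hs⟩ := (hlim.eventually_lt_const hpos).exists
  refine ⟨s, le_csInf (nonempty_quantile_set A s) ?_⟩
  rintro z ⟨-, hz⟩
  by_contra! hlt
  have := tail_anti A hlt.le
  linarith

lemma weightLaw_dotProduct_eq_zero {k : ℕ} {a : Fin k → ℝ} (ha : a ≠ 0) :
    weightLaw k {w | a ⬝ᵥ w = 0} = 0 := by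
  have hpos : 0 < eucNorm a :=
    lt_of_le_of_ne (eucNorm_nonneg a) fun h => ha (eucNorm_eq_zero.1 h.symm)
  set T₂ : Matrix (Fin 1) (Fin k) ℝ := Matrix.of fun _ => a with hT₂
  set T₁ : Matrix (Fin 1) (Fin 1) ℝ := Matrix.of fun _ _ => eucNorm a with hT₁
  have hlaw := weightLaw_map_eq T₁ T₂ (by
    ext i j
    have := eucNorm_sq a
    simp only [Matrix.mul_apply, T₁, T₂, Matrix.of_apply, Matrix.transpose_apply,
      Finset.univ_unique, Finset.sum_singleton]
    rw [← sq, this]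
    rfl)
  have hm : MeasurableSet {v : Fin 1 → ℝ | v 0 = 0} :=
    measurableSet_eq_fun (measurable_pi_apply 0) measurable_const
  have h1 := congrArg (fun μ => μ {v : Fin 1 → ℝ | v 0 = 0}) hlaw
  rw [Measure.map_apply (measurable_mulVec T₂) hm, Measure.map_apply (measurable_mulVec T₁) hm]
    at h1
  have e2 : T₂.mulVec ⁻¹' {v : Fin 1 → ℝ | v 0 = 0} = {w | a ⬝ᵥ w = 0} := rfl
  have e1 : T₁.mulVec ⁻¹' {v : Fin 1 → ℝ | v 0 = 0} = (fun w : Fin 1 → ℝ => w 0) ⁻¹' {0} := by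
    ext w
    simp [Matrix.mulVec, dotProduct, T₁, hpos.ne']
  have := nullSingletonClass_gaussianReal (μ := 0) (v := 1) one_ne_zero
  rw [e2, e1] at h1
  rw [h1]
  have hp := (measurePreserving_eval (fun _ : Fin 1 => gaussianReal 0 1) 0).measure_preimage
    (measurableSet_singleton (0 : ℝ)).nullMeasurableSet
  exact hp.trans (measure_singleton 0)

lemma weightLaw_eucNorm_pos {k q : ℕ} {A : Matrix (Fin q) (Fin k) ℝ} (hA : A ≠ 0) :
    (weightLaw k).real {w | 0 < eucNorm (A.mulVec w)} = 1 := by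
  obtain ⟨i, hi⟩ : ∃ i, A i ≠ 0 := by
    by_contra! h
    exact hA (funext h)
  have hm : MeasurableSet {w | eucNorm (A.mulVec w) = 0} :=
    measurableSet_eq_fun (measurable_eucNorm_mulVec A) measurable_const
  have h0 : weightLaw k {w | eucNorm (A.mulVec w) = 0} = 0 := by
    refine measure_mono_null ?_ (weightLaw_dotProduct_eq_zero hi)
    intro w (hw : _ = _)
    rw [eucNorm_eq_zero] at hw
    exact congrFun hw i
  have e : {w | 0 < eucNorm (A.mulVec w)} = {w | eucNorm (A.mulVec w) = 0}ᶜ := by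
    ext w
    simp only [Set.mem_ofPred_eq, Set.mem_compl_iff]
    exact ⟨fun h => h.ne', fun h => lt_of_le_of_ne (eucNorm_nonneg _) (Ne.symm h)⟩
  rw [e, probReal_compl_eq_one_sub hm, measureReal_def, h0]
  simp

/-! ### Calibration by an approximate covariance -/

lemma exists_forall_le_normQuantile {k q : ℕ} {ι : Type*} (M : Finset ι)
    {A : ι → Matrix (Fin q) (Fin k) ℝ} (hA : ∀ m ∈ M, A m ≠ 0) {Z : ℝ} (hZ : 0 ≤ Z) :
    ∃ s, ∀ m ∈ M, Z ≤ normQuantile (A m) s := by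
  classical
  induction M using Finset.induction_on with
  | empty => exact ⟨0, by simp⟩
  | insert m M _ ih =>
    obtain ⟨s, hs⟩ := ih fun m hm => hA m (Finset.mem_insert_of_mem hm)
    obtain ⟨s', hs'⟩ := exists_le_normQuantile (hA m (Finset.mem_insert_self _ _)) hZ
    refine ⟨max s s', fun j hj => ?_⟩
    rcases Finset.mem_insert.1 hj with rfl | hj
    · exact hs'.trans (normQuantile_mono _ (le_max_right _ _))
    · exact (hs j hj).trans (normQuantile_mono _ (le_max_left _ _))

/-- The values `s` of the quantile parameter for which the joint exceedance of the quantiles by the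
norms `‖A m v‖`, with the quantiles inflated by `αp` and the norms deflated by `αm`, has
probability at most `exp (-x)`. -/
def admissibleLevels {k q : ℕ} {ι : Type*} (M : Finset ι) (A : ι → Matrix (Fin q) (Fin k) ℝ)
    (αm αp x : ℝ) : Set ℝ :=
  {s | (weightLaw k).real {v | ∃ m ∈ M, αp * normQuantile (A m) s ≤ αm * eucNorm ((A m).mulVec v)}
    ≤ Real.exp (-x)}

section

variable {k q : ℕ} {ι : Type*} {M : Finset ι} {A : ι → Matrix (Fin q) (Fin k) ℝ} {αm αp x : ℝ}

lemma pos_of_mem_admissibleLevels (hM : M.Nonempty) (hm : 0 < αm) (hx : 0 < x) {s : ℝ}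
    (hs : s ∈ admissibleLevels M A αm αp x) : 0 < s := by
  by_contra! h
  obtain ⟨m, hmM⟩ := hM
  have e : {v | ∃ m ∈ M, αp * normQuantile (A m) s ≤ αm * eucNorm ((A m).mulVec v)}
      = Set.univ := by
    refine Set.eq_univ_of_forall fun v => ⟨m, hmM, ?_⟩
    rw [normQuantile_of_nonpos _ h, mul_zero]
    exact mul_nonneg hm.le (eucNorm_nonneg _)
  have hs' : (weightLaw k).real
    {v | ∃ m ∈ M, αp * normQuantile (A m) s ≤ αm * eucNorm ((A m).mulVec v)} ≤ Real.exp (-x) := hs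
  rw [e, probReal_univ] at hs'
  have : Real.exp (-x) < 1 := by rw [Real.exp_lt_one_iff]; linarith
  linarith

lemma bddBelow_admissibleLevels (hM : M.Nonempty) (hm : 0 < αm) (hx : 0 < x) :
    BddBelow (admissibleLevels M A αm αp x) :=
  ⟨0, fun _ hs => (pos_of_mem_admissibleLevels hM hm hx hs).le⟩

lemma nonempty_admissibleLevels (hA : ∀ m ∈ M, A m ≠ 0) (hm : 0 < αm) (hp : 0 < αp) :
    (admissibleLevels M A αm αp x).Nonempty := by
  obtain ⟨z, hz, hz'⟩ := exists_forall_tail_le M A (Real.exp_pos (-x))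
  obtain ⟨s, hs⟩ := exists_forall_le_normQuantile M hA (Z := αm * (z + 1) / αp) (by positivity)
  refine ⟨s, le_trans (measureReal_mono ?_) hz'⟩
  rintro v ⟨m, hmM, h⟩
  refine ⟨m, hmM, ?_⟩
  have h1 := hs m hmM
  rw [div_le_iff₀ hp, mul_comm _ αp] at h1
  have := le_of_mul_le_mul_left (h1.trans h) hm
  linarith

/-- Calibration with a vector `T w` whose covariance lies between `αm²` and `αp²`: the calibrated
quantiles dominate, up to the factor `αm`, the quantiles of the standard Gaussian vector at the
level `sInf (admissibleLevels M A αm αp x)`, which does not depend on `T`. -/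
theorem mul_normQuantile_le_calibrated {n : ℕ} (hM : M.Nonempty) (hA : ∀ m ∈ M, A m ≠ 0)
    (hm : 0 < αm) (hp : 0 < αp) (hx : 0 < x) (T : Matrix (Fin k) (Fin n) ℝ)
    (hlow : ∀ θ, αm ^ 2 * (θ ⬝ᵥ θ) ≤ T.transpose.mulVec θ ⬝ᵥ T.transpose.mulVec θ)
    (hup : ∀ θ, T.transpose.mulVec θ ⬝ᵥ T.transpose.mulVec θ ≤ αp ^ 2 * (θ ⬝ᵥ θ)) (j : ι) :
    αm * normQuantile (A j) (sInf (admissibleLevels M A αm αp x))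
      ≤ normQuantile (A j * T) (x + sInf {c | (weightLaw n).real
        {w | ∃ m ∈ M, normQuantile (A m * T) (x + c) ≤ eucNorm ((A m).mulVec (T.mulVec w))}
          ≤ Real.exp (-x)}) := by
  have hscale : ∀ (α : ℝ) (θ : Fin k → ℝ),
      (α • (1 : Matrix (Fin k) (Fin k) ℝ)).transpose.mulVec θ
        ⬝ᵥ (α • (1 : Matrix (Fin k) (Fin k) ℝ)).transpose.mulVec θ = α ^ 2 * (θ ⬝ᵥ θ) := by
    intro α θ
    rw [Matrix.transpose_smul, Matrix.transpose_one, Matrix.smul_mulVec, Matrix.one_mulVec,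
      smul_dotProduct, dotProduct_smul, smul_eq_mul, smul_eq_mul]
    ring
  have hlow' : ∀ θ, (αm • (1 : Matrix (Fin k) (Fin k) ℝ)).transpose.mulVec θ
        ⬝ᵥ (αm • (1 : Matrix (Fin k) (Fin k) ℝ)).transpose.mulVec θ
        ≤ T.transpose.mulVec θ ⬝ᵥ T.transpose.mulVec θ := fun θ => by rw [hscale]; exact hlow θ
  have hup' : ∀ θ, T.transpose.mulVec θ ⬝ᵥ T.transpose.mulVec θ
      ≤ (αp • (1 : Matrix (Fin k) (Fin k) ℝ)).transpose.mulVec θ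
        ⬝ᵥ (αp • (1 : Matrix (Fin k) (Fin k) ℝ)).transpose.mulVec θ :=
    fun θ => by rw [hscale]; exact hup θ
  have qlow : ∀ m s, αm * normQuantile (A m) s ≤ normQuantile (A m * T) s := by
    intro m s
    rw [← normQuantile_smul_one (A m) s hm]
    exact normQuantile_mono_covariance (A m) s _ T hlow'
  have qup : ∀ m s, normQuantile (A m * T) s ≤ αp * normQuantile (A m) s := by
    intro m s
    rw [← normQuantile_smul_one (A m) s hp]
    exact normQuantile_mono_covariance (A m) s T _ hup'
  have hne : {c | (weightLaw n).real
      {w | ∃ m ∈ M, normQuantile (A m * T) (x + c) ≤ eucNorm ((A m).mulVec (T.mulVec w))}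
        ≤ Real.exp (-x)}.Nonempty := by
    obtain ⟨z, hz, hz'⟩ := exists_forall_tail_le M (fun m => A m * T) (Real.exp_pos (-x))
    obtain ⟨s, hs⟩ := exists_forall_le_normQuantile M hA (Z := (z + 1) / αm) (by positivity)
    refine ⟨s - x, le_trans (measureReal_mono ?_) hz'⟩
    rintro w ⟨m, hmM, h⟩
    refine ⟨m, hmM, ?_⟩
    have h1 := hs m hmM
    rw [div_le_iff₀' hm] at h1
    rw [add_sub_cancel] at h
    rw [← Matrix.mulVec_mulVec]
    have := qlow m s
    linarith
  refine le_trans ?_ (qlow j _)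
  refine mul_le_mul_of_nonneg_left (normQuantile_mono _ ?_) hm.le
  rw [← sub_le_iff_le_add']
  refine le_csInf hne fun c hc => ?_
  rw [sub_le_iff_le_add']
  refine csInf_le (bddBelow_admissibleLevels hM hm hx) ?_
  have hc' : (weightLaw n).real {w | ∃ m ∈ M, normQuantile (A m * T) (x + c)
      ≤ eucNorm ((A m).mulVec (T.mulVec w))} ≤ Real.exp (-x) := hc
  refine le_trans ?_ hc'
  have h1 := exists_le_eucNorm_mono M A (fun m => αp * normQuantile (A m) (x + c)) _ T hlow'
  refine le_trans (le_of_eq ?_) (h1.trans (measureReal_mono ?_))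
  · congr 1
    ext v
    simp only [Set.mem_ofPred_eq, Matrix.smul_mulVec, Matrix.one_mulVec, Matrix.mulVec_smul,
      eucNorm_smul, abs_of_pos hm]
  · rintro w ⟨m, hmM, h⟩
    exact ⟨m, hmM, (qup m _).trans h⟩

/-- The infimum `sInf (admissibleLevels M A αm αp x)` still satisfies the defining inequality of the
admissible levels, with strict exceedance. -/
lemma weightLaw_exists_gt_sInf_le (hA : ∀ m ∈ M, A m ≠ 0) (hm : 0 < αm) (hp : 0 < αp) :
    (weightLaw k).real {v | ∃ m ∈ M,
      αp / αm * normQuantile (A m) (sInf (admissibleLevels M A αm αp x))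
        < eucNorm ((A m).mulVec v)} ≤ Real.exp (-x) := by
  set s₀ := sInf (admissibleLevels M A αm αp x) with hs₀
  -- the bound holds with the levels increased by `ε`, by right-continuity of the quantiles
  have step : ∀ ε > 0, (weightLaw k).real {v | ∃ m ∈ M,
      αp / αm * normQuantile (A m) s₀ + ε ≤ eucNorm ((A m).mulVec v)} ≤ Real.exp (-x) := by
    intro ε hε
    have hright : ∃ s' > s₀, ∀ m ∈ M,
        normQuantile (A m) s' ≤ normQuantile (A m) s₀ + ε * αm / αp := by
      have hδ : 0 < ε * αm / αp := by positivity
      clear_value s₀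
      clear hs₀
      classical
      induction M using Finset.induction_on with
      | empty => exact ⟨s₀ + 1, by simp, by simp⟩
      | insert m M _ ih =>
        obtain ⟨s₁, h₁, h₁'⟩ := ih fun m hm => hA m (Finset.mem_insert_of_mem hm)
        obtain ⟨s₂, h₂, h₂'⟩ := exists_normQuantile_le (hA m (Finset.mem_insert_self _ _))
          (lt_add_of_pos_right (normQuantile (A m) s₀) hδ)
        refine ⟨min s₁ s₂, lt_min h₁ h₂, fun j hj => ?_⟩
        rcases Finset.mem_insert.1 hj with rfl | hj
        · exact (normQuantile_mono _ (min_le_right _ _)).trans h₂'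
        · exact (normQuantile_mono _ (min_le_left _ _)).trans (h₁' j hj)
    obtain ⟨s', hs', hq⟩ := hright
    obtain ⟨s, hs, hss⟩ := exists_lt_of_csInf_lt (nonempty_admissibleLevels hA hm hp) hs'
    refine le_trans (measureReal_mono ?_) hs
    rintro v ⟨m, hmM, h⟩
    refine ⟨m, hmM, ?_⟩
    have h1 := (normQuantile_mono (A m) hss.le).trans (hq m hmM)
    calc αp * normQuantile (A m) s ≤ αp * (normQuantile (A m) s₀ + ε * αm / αp) := by gcongr
      _ = αm * (αp / αm * normQuantile (A m) s₀ + ε) := by field_simp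
      _ ≤ _ := by gcongr
  have hmono : Monotone fun j : ℕ => {v | ∃ m ∈ M,
      αp / αm * normQuantile (A m) s₀ + 1 / ((j : ℝ) + 1) ≤ eucNorm ((A m).mulVec v)} := by
    rintro i j hij v ⟨m, hmM, h⟩
    refine ⟨m, hmM, le_trans ?_ h⟩
    have : 1 / ((j : ℝ) + 1) ≤ 1 / ((i : ℝ) + 1) := by gcongr
    linarith
  have hunion : {v | ∃ m ∈ M, αp / αm * normQuantile (A m) s₀ < eucNorm ((A m).mulVec v)}
      = ⋃ j : ℕ, {v | ∃ m ∈ M,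
        αp / αm * normQuantile (A m) s₀ + 1 / ((j : ℝ) + 1) ≤ eucNorm ((A m).mulVec v)} := by
    ext v
    simp only [Set.mem_ofPred_eq, Set.mem_iUnion]
    constructor
    · rintro ⟨m, hmM, h⟩
      obtain ⟨j, hj⟩ := exists_nat_one_div_lt (sub_pos.2 h)
      exact ⟨j, m, hmM, by linarith⟩
    · rintro ⟨j, m, hmM, h⟩
      refine ⟨m, hmM, lt_of_lt_of_le ?_ h⟩
      have : 0 < 1 / ((j : ℝ) + 1) := by positivity
      linarith
  rw [hunion]
  have hlim := tendsto_measure_iUnion_atTop (μ := weightLaw k) hmono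
  refine ENNReal.toReal_le_of_le_ofReal (Real.exp_pos _).le (le_of_tendsto' hlim fun j => ?_)
  rw [Function.comp_apply, ← ofReal_measureReal]
  exact ENNReal.ofReal_le_ofReal (step _ (by positivity))

/-- The norms exceed the deflated quantiles at the level `sInf (admissibleLevels M A αm αp x)` with
probability `exp (-x)`, up to the effect of a dilation by `αp / αm²`. -/
theorem weightLaw_exists_deflated_quantile_le (hA : ∀ m ∈ M, A m ≠ 0)
    (hm : 0 < αm) (hm1 : αm ≤ 1) (hp : 1 ≤ αp) (hx : 0 < x) :
    (weightLaw k).real {v | ∃ m ∈ M,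
      αm * normQuantile (A m) (sInf (admissibleLevels M A αm αp x)) ≤ eucNorm ((A m).mulVec v)}
      ≤ Real.exp (-x) + √(k / 2) * (Real.log αp - 2 * Real.log αm) := by
  have hp0 : 0 < αp := by linarith
  have hgt := weightLaw_exists_gt_sInf_le (x := x) hA hm hp0
  set s₀ := sInf (admissibleLevels M A αm αp x) with hs₀
  -- otherwise `‖A m v‖ > 0`, an almost sure event, would have probability at most `exp (-x) < 1`
  have hzpos : ∀ m ∈ M, 0 < normQuantile (A m) s₀ := by
    intro m hmM
    refine lt_of_le_of_ne (normQuantile_nonneg _ _) fun h0 => ?_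
    have h1 : (weightLaw k).real {w | 0 < eucNorm ((A m).mulVec w)} ≤ Real.exp (-x) := by
      refine le_trans (measureReal_mono ?_) hgt
      intro v hv
      refine ⟨m, hmM, ?_⟩
      rw [← h0, mul_zero]
      exact hv
    rw [weightLaw_eucNorm_pos (hA m hmM)] at h1
    have : Real.exp (-x) < 1 := by rw [Real.exp_lt_one_iff]; linarith
    linarith
  set l₀ := Real.log αp - 2 * Real.log αm with hl₀
  have hl₀0 : 0 ≤ l₀ := by
    have := Real.log_nonneg hp
    have := Real.log_nonpos hm.le hm1
    linarith
  set C : Set (Fin k → ℝ) := {v | ∀ m ∈ M, eucNorm ((A m).mulVec v) < αm * normQuantile (A m) s₀}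
    with hC
  have hCm : MeasurableSet C := measurableSet_forall_lt M A _
  have hexp : ∀ ε, (Real.exp (l₀ + ε))⁻¹ = αm ^ 2 / αp * Real.exp (-ε) := by
    intro ε
    rw [← Real.exp_neg, hl₀, show -(Real.log αp - 2 * Real.log αm + ε)
      = Real.log αm + Real.log αm - Real.log αp + -ε by ring, Real.exp_add, Real.exp_sub,
      Real.exp_add, Real.exp_log hm, Real.exp_log hp0]
    ring
  have hGm : MeasurableSet {v | ∃ m ∈ M,
      αp / αm * normQuantile (A m) s₀ < eucNorm ((A m).mulVec v)} := by
    have : {v | ∃ m ∈ M, αp / αm * normQuantile (A m) s₀ < eucNorm ((A m).mulVec v)}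
        = ⋃ m ∈ M, {v | αp / αm * normQuantile (A m) s₀ < eucNorm ((A m).mulVec v)} := by
      ext; simp
    rw [this]
    exact Finset.measurableSet_biUnion _ fun m _ =>
      measurableSet_lt measurable_const (measurable_eucNorm_mulVec (A m))
  -- a dilation by slightly more than `αp / αm²` turns closed conditions into the strict ones of `C`
  have key : ∀ ε > 0, 1 - Real.exp (-x) ≤ (weightLaw k).real C + √(k / 2) * (l₀ + ε) := by
    intro ε hε
    refine le_trans ?_ (weightLaw_dilate_le hCm (l := l₀ + ε) (by linarith))
    have h1 := probReal_compl_eq_one_sub (μ := weightLaw k) hGm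
    have h2 : 1 - Real.exp (-x) ≤ (weightLaw k).real {v | ∃ m ∈ M,
        αp / αm * normQuantile (A m) s₀ < eucNorm ((A m).mulVec v)}ᶜ := by
      rw [h1]; linarith
    refine h2.trans (measureReal_mono ?_)
    intro v hv m hmM
    have h3 : eucNorm ((A m).mulVec v) ≤ αp / αm * normQuantile (A m) s₀ := by
      by_contra! hcon
      exact hv ⟨m, hmM, hcon⟩
    have hz := hzpos m hmM
    rw [Matrix.mulVec_smul, eucNorm_smul, abs_of_pos (by positivity), hexp]
    calc αm ^ 2 / αp * Real.exp (-ε) * eucNorm ((A m).mulVec v)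
        ≤ αm ^ 2 / αp * Real.exp (-ε) * (αp / αm * normQuantile (A m) s₀) := by gcongr
      _ = Real.exp (-ε) * (αm * normQuantile (A m) s₀) := by field_simp
      _ < 1 * (αm * normQuantile (A m) s₀) := by
          have : Real.exp (-ε) < 1 := by rw [Real.exp_lt_one_iff]; linarith
          gcongr
      _ = _ := one_mul _
  have hcompl : (weightLaw k).real {v | ∃ m ∈ M,
      αm * normQuantile (A m) s₀ ≤ eucNorm ((A m).mulVec v)} = 1 - (weightLaw k).real C := by
    rw [← probReal_compl_eq_one_sub hCm]
    congr 1
    ext v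
    simp [hC]
  rw [hcompl]
  refine le_of_forall_pos_le_add fun ε hε => ?_
  have h4 := key (ε / (√(k / 2) + 1)) (by positivity)
  have h5 : √(k / 2) * (ε / (√(k / 2) + 1)) ≤ ε := by
    rw [mul_div_assoc', div_le_iff₀ (by positivity)]
    nlinarith [Real.sqrt_nonneg ((k : ℝ) / 2)]
  rw [mul_add] at h4
  linarith

end

/-! ### The size of the dilation -/

lemma neg_log_one_sub_le {y : ℝ} (h0 : 0 ≤ y) (h1 : y ≤ 0.356) :
    -Real.log (1 - y) ≤ 1.291 * y := by
  have h := Real.abs_log_sub_add_sum_range_le (x := y) (by rw [abs_of_nonneg h0]; linarith) 3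
  rw [abs_of_nonneg h0] at h
  simp only [Finset.sum_range_succ, Finset.sum_range_zero] at h
  norm_num at h
  have h2 := (abs_le.1 h).1
  have h3 : y ^ 4 / (1 - y) ≤ 0.0701 * y := by
    rw [div_le_iff₀ (by linarith)]
    have : y ^ 3 ≤ 0.356 ^ 3 := pow_le_pow_left₀ h0 h1 3
    have : y * y ^ 3 ≤ y * 0.356 ^ 3 := mul_le_mul_of_nonneg_left this h0
    nlinarith
  have h4 : y ^ 2 ≤ 0.356 * y := by nlinarith
  have h5 : y ^ 3 ≤ 0.356 ^ 2 * y := by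
    have : y ^ 2 ≤ 0.356 ^ 2 := pow_le_pow_left₀ h0 h1 2
    have : y * y ^ 2 ≤ y * 0.356 ^ 2 := mul_le_mul_of_nonneg_left this h0
    nlinarith
  linarith

/-- Logarithmic size of the factors `αm = √(1 - D) - e` and `αp = √(1 + b + D) + e` in terms of a
lower bound `b + 3.464 e + u + u² / 2 < 1` for the error term. The roles of the variables are
`e = δ √(2 X)`, `u = 2 δ √L`, and `3.464 ≈ √12` comes from `2 δ X ≥ √12 e` for `X ≥ 6`. -/
lemma log_inflation_le {b u e D : ℝ} (hb : 0 ≤ b) (hu : 0 ≤ u) (he : 0 ≤ e) (hD0 : 0 ≤ D)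
    (hD : D ≤ u * (1 + b) + u ^ 2 / 2) (hue : u ≤ 1.4143 * e) (he' : e ≤ 0.289)
    (h1 : b + 3.464 * e + u + u ^ 2 / 2 < 1) :
    D < 1 ∧ 0 < √(1 - D) - e ∧
      Real.log (√(1 + b + D) + e) - 2 * Real.log (√(1 - D) - e)
        ≤ 1.414 * (b + 3.464 * e + u + u ^ 2 / 2) := by
  have hu1 : u ≤ 0.29 := by nlinarith
  have hub : u * b ≤ 0.29 * b := mul_le_mul_of_nonneg_right hu1 hb
  have huu : u ^ 2 ≤ 0.29 * u := by nlinarith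
  have hD1 : D ≤ 0.335 := by
    have hb1 : b ≤ 1 - 3.449 * u - u ^ 2 / 2 := by linarith
    have hub' : u * b ≤ u * (1 - 3.449 * u) :=
      mul_le_mul_of_nonneg_left (by nlinarith) hu
    nlinarith [sq_nonneg (u - 0.29)]
  have hr : 0.8154 ≤ √(1 - D) := Real.le_sqrt_of_sq_le (by norm_num; linarith)
  have hr0 : 0 < √(1 - D) := by linarith
  have hpos : 0 < √(1 - D) - e := by linarith
  refine ⟨by linarith, hpos, ?_⟩
  have hlogp : Real.log (√(1 + b + D) + e) ≤ (b + D) / 2 + e := by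
    have h := Real.log_le_sub_one_of_pos (x := √(1 + b + D) + e)
      (by have : 0 < √(1 + b + D) := Real.sqrt_pos.2 (by linarith)
          linarith)
    have h2 : √(1 + b + D) ≤ 1 + (b + D) / 2 :=
      Real.sqrt_le_iff.2 ⟨by linarith, by nlinarith [sq_nonneg (b + D)]⟩
    linarith
  set y := e / √(1 - D) with hy
  have hy0 : 0 ≤ y := by positivity
  have hye : y ≤ e / 0.8154 := div_le_div_of_nonneg_left he (by norm_num) hr
  have hy1 : y ≤ 0.356 := hye.trans (by rw [div_le_iff₀ (by norm_num)]; linarith)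
  have hfac : √(1 - D) - e = √(1 - D) * (1 - y) := by rw [hy]; field_simp
  have hlogm : -2 * Real.log (√(1 - D) - e) ≤ 1.291 * D + 2 * (1.291 * (e / 0.8154)) := by
    rw [hfac, Real.log_mul hr0.ne' (by linarith), Real.log_sqrt (by linarith)]
    have h2 := neg_log_one_sub_le hD0 (by linarith)
    have h3 := neg_log_one_sub_le hy0 hy1
    linarith
  have h4 : e / 0.8154 ≤ 1.2265 * e := by rw [div_le_iff₀ (by norm_num)]; linarith
  linarith

/-- The solutions of `e^X > 24 X²` and `e^X > 6` are bounded below: the lower bound improves itself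
along the thresholds `1, 3, 5, 6`. -/
lemma six_le_of_exp_gt {X : ℝ} (h0 : 6 < Real.exp X) (h : 24 * X ^ 2 < Real.exp X) :
    6 ≤ X := by
  have e1 := Real.exp_one_lt_d9
  have e0 := Real.exp_pos 1
  have up : ∀ k : ℕ, Real.exp (k : ℝ) ≤ 2.7182818286 ^ k := fun k => by
    rw [← Real.exp_one_pow]
    exact pow_le_pow_left₀ e0.le e1.le k
  have gt : ∀ (k : ℕ) {c : ℝ}, c < Real.exp X → (2.7182818286 : ℝ) ^ k ≤ c → (k : ℝ) < X :=
    fun k c hc hk => Real.exp_lt_exp.1 (((up k).trans hk).trans_lt hc)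
  have h1 := gt 1 h0 (by norm_num)
  have h3 := gt 3 h (by push_cast at h1; nlinarith)
  have h5 := gt 5 h (by push_cast at h3; norm_num; nlinarith)
  have h6 := gt 6 h (by push_cast at h5; norm_num; nlinarith)
  exact_mod_cast h6.le

/-- If `Δ` is at least the linear part `2 δ X` of the error term and the claimed bound
`6 e^{-x} + √p Δ` is nontrivial, then `p ≤ n δ²` forces `n` to be large. -/
lemma six_le_of_nontrivial {n p : ℕ} (hp : 1 ≤ p) {δ x : ℝ} (hδ : 0 < δ) (hx : 0 < x)
    (hn : (p : ℝ) ≤ n * δ ^ 2) {X Δ : ℝ} (hX : X = x + Real.log n) (hΔ : 2 * δ * X ≤ Δ)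
    (h : 6 * Real.exp (-x) + √p * Δ < 1) :
    Δ < 1 ∧ 6 ≤ X ∧ x + Real.log (2 * p) ≤ X := by
  have hp1 : (1 : ℝ) ≤ p := by exact_mod_cast hp
  have hn0 : 0 < n := by
    rcases Nat.eq_zero_or_pos n with rfl | h0
    · norm_num at hn; linarith
    · exact h0
  have hn1 : (1 : ℝ) ≤ n := by exact_mod_cast hn0
  have hX0 : 0 < X := by have := Real.log_nonneg hn1; linarith
  have hr1 : 1 ≤ √(p : ℝ) := by rw [Real.one_le_sqrt]; exact hp1
  have hex : 0 < Real.exp (-x) := Real.exp_pos _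
  have hδX : 0 < 2 * δ * X := by positivity
  have hΔ0 : 0 < Δ := by linarith
  have hΔ1 : Δ < 1 := by nlinarith
  have hex6 : 6 < Real.exp x := by
    have h1 : 6 * Real.exp (-x) < 1 := by
      have : 0 < √(p : ℝ) * Δ := by positivity
      linarith
    rw [Real.exp_neg, ← div_eq_mul_inv, div_lt_one (Real.exp_pos x)] at h1
    exact h1
  have heX : Real.exp X = n * Real.exp x := by
    rw [hX, Real.exp_add, Real.exp_log (by linarith), mul_comm]
  have h2 : 2 * δ * X < 1 := by linarith
  -- `4 δ² X² < 1 ≤ p ≤ n δ²` gives `4 X² < n`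
  have h24 : 24 * X ^ 2 < Real.exp X := by
    have h3 : (2 * δ * X) ^ 2 < 1 := by nlinarith
    have h4 : 4 * X ^ 2 * (n * δ ^ 2) < n * 1 := by nlinarith
    have h5 : 4 * X ^ 2 < n := by nlinarith [sq_nonneg X]
    rw [heX]
    nlinarith
  have hX6 : 6 ≤ X := six_le_of_exp_gt (by rw [heX]; nlinarith) h24
  have hδ1 : δ ≤ 1 / 12 := by nlinarith
  refine ⟨hΔ1, hX6, ?_⟩
  rw [hX]
  have h3 : 2 * (p : ℝ) ≤ n := by
    have : δ ^ 2 ≤ 1 / 144 := by nlinarith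
    nlinarith
  have := Real.log_le_log (by linarith) h3
  linarith

/-- When the claimed bound `6 e^{-x} + √p Δ` is nontrivial, the effect of the dilation is at most
`√p Δ`. Here `b` is the squared sup-norm of the bias. -/
theorem sqrt_mul_log_inflation_le {n p : ℕ} (hp : 1 ≤ p) {δ b x : ℝ} (hδ : 0 < δ) (hb : 0 ≤ b)
    (hx : 0 < x) (hn : (p : ℝ) ≤ n * δ ^ 2) {X L Δ D e : ℝ} (hX : X = x + Real.log n)
    (hL : L = x + Real.log (2 * p))
    (hΔ : b + 2 * δ * X + δ ^ 2 * X + 2 * δ * √L + 2 * δ ^ 2 * L ≤ Δ)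
    (hD : D = 2 * δ * √((1 + 2 * b) * L) + 2 * δ ^ 2 * L) (he : e = δ * √(2 * X))
    (h : 6 * Real.exp (-x) + √p * Δ < 1) :
    D < 1 ∧ 0 < √(1 - D) - e ∧
      √(p / 2) * (Real.log (√(1 + b + D) + e) - 2 * Real.log (√(1 - D) - e)) ≤ √p * Δ := by
  have hp1 : (1 : ℝ) ≤ p := by exact_mod_cast hp
  have hL0 : 0 < L := by have := Real.log_nonneg (x := 2 * p) (by linarith); linarith
  have hsL := Real.sqrt_nonneg L
  have hX0 : 0 < X := by
    rcases Nat.eq_zero_or_pos n with rfl | h0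
    · norm_num at hn; linarith
    · have := Real.log_nonneg (x := n) (by exact_mod_cast h0); linarith
  have hlow : 0 ≤ b + δ ^ 2 * X + 2 * δ * √L + 2 * δ ^ 2 * L := by positivity
  obtain ⟨hΔ1, hX6, hLX⟩ := six_le_of_nontrivial hp hδ hx hn hX (by linarith) h
  rw [← hL] at hLX
  have hδX : 0 < 2 * δ * X := by positivity
  have hΔ0 : 0 < Δ := by linarith
  clear h hL hX hn
  have he0 : 0 ≤ e := by rw [he]; positivity
  have he2 : e ^ 2 = 2 * δ ^ 2 * X := by
    rw [he, mul_pow, Real.sq_sqrt (by linarith)]; ring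
  set u := 2 * δ * √L with hu
  have hu0 : 0 ≤ u := by positivity
  have hu2 : u ^ 2 = 4 * δ ^ 2 * L := by
    rw [hu, mul_pow, Real.sq_sqrt hL0.le]; ring
  have hue : u ≤ 1.4143 * e := by
    have he1 : 0 ≤ 1.4143 * e := mul_nonneg (by norm_num) he0
    refine (sq_le_sq₀ hu0 he1).1 ?_
    rw [hu2, mul_pow, he2]
    have h3 : δ ^ 2 * L ≤ δ ^ 2 * X := by gcongr
    have h4 : 0 < δ ^ 2 * X := by positivity
    linarith
  have heX2 : 3.464 * e ≤ 2 * δ * X := by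
    have he1 : 0 ≤ 3.464 * e := mul_nonneg (by norm_num) he0
    refine (sq_le_sq₀ he1 hδX.le).1 ?_
    rw [mul_pow, he2]
    have h3 : 0 ≤ δ ^ 2 * X * (X - 6) := mul_nonneg (by positivity) (by linarith)
    have h4 : 0 < δ ^ 2 * X := by positivity
    linarith
  have hDu : D ≤ u * (1 + b) + u ^ 2 / 2 := by
    have h3 : √((1 + 2 * b) * L) ≤ (1 + b) * √L := by
      rw [Real.sqrt_mul (by linarith)]
      gcongr
      exact Real.sqrt_le_iff.2 ⟨by linarith, by nlinarith⟩
    have h4 := mul_le_mul_of_nonneg_left h3 (show 0 ≤ 2 * δ by positivity)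
    rw [hD, hu2, hu]
    nlinarith
  have hD0 : 0 ≤ D := by rw [hD]; positivity
  have hsum : b + 3.464 * e + u + u ^ 2 / 2 ≤ Δ := by
    have : 0 < δ ^ 2 * X := by positivity
    rw [hu2]
    linarith
  obtain ⟨g1, g2, g3⟩ := log_inflation_le hb hu0 he0 hD0 hDu hue (by linarith)
    (hsum.trans_lt hΔ1)
  refine ⟨g1, g2, ?_⟩
  have hhalf : √(p / 2 : ℝ) ≤ √p / 1.414 := by
    rw [Real.sqrt_div (by linarith)]
    exact div_le_div_of_nonneg_left (by positivity) (by norm_num)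
      (Real.le_sqrt_of_sq_le (by norm_num))
  calc _ ≤ √(p / 2 : ℝ) * (1.414 * Δ) := by gcongr; linarith
    _ ≤ √p / 1.414 * (1.414 * Δ) := by gcongr
    _ = √p * Δ := by ring

/-! ### The bootstrap covariance on an event of high probability -/

lemma transpose_mulVec_dotProduct_self {p n : ℕ} {U : Matrix (Fin p) (Fin n) ℝ}
    (hU : U * U.transpose = 1) (θ : Fin p → ℝ) :
    U.transpose.mulVec θ ⬝ᵥ U.transpose.mulVec θ = θ ⬝ᵥ θ := by
  rw [← dotProduct_mulVec_transpose_self, hU, Matrix.one_mulVec]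

lemma sum_vecMulVec_col {p n : ℕ} (U : Matrix (Fin p) (Fin n) ℝ) :
    ∑ i, Matrix.vecMulVec (U.transpose i) (U.transpose i) = U * U.transpose := by
  ext j k
  simp [Matrix.sum_apply, Matrix.vecMulVec_apply, Matrix.mul_apply]

/-- For a matrix with orthonormal rows, the number of rows is the sum of the squared norms of the
columns. -/
lemma card_le_mul_sq_of_col_le {p n : ℕ} {U : Matrix (Fin p) (Fin n) ℝ}
    (hU : U * U.transpose = 1) {δ : ℝ} (hδ : ∀ i, U.transpose i ⬝ᵥ U.transpose i ≤ δ ^ 2) :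
    (p : ℝ) ≤ n * δ ^ 2 := by
  have h := congrArg Matrix.trace hU
  rw [← sum_vecMulVec_col, Matrix.trace_sum, Matrix.trace_one, Fintype.card_fin] at h
  simp only [Matrix.trace_vecMulVec] at h
  rw [← h]
  refine (Finset.sum_le_sum fun i _ => hδ i).trans ?_
  simp

/-- Two-sided control of `∑ i, (uᵢᵀθ)² ηᵢ²` for `η = B + g - Υ g`, by the triangle inequality in
the norm with weights `(uᵢᵀθ)²`, from the same control for `B + g` and a bound on `Υ g`. -/
lemma inflation_of_deviation {p n : ℕ} {U : Matrix (Fin p) (Fin n) ℝ} (hU : U * U.transpose = 1)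
    {B g r : Fin n → ℝ} {b D e : ℝ} (hB : ∀ i, B i ^ 2 ≤ b) (hD0 : 0 ≤ D) (hb : 0 ≤ b)
    (he0 : 0 ≤ e) (hpos : 0 < √(1 - D) - e) (hr : ∀ i, |r i| ≤ e)
    (hup : ∀ θ, ∑ i, 1 * (g i ^ 2 - 1 + 2 * B i * g i) * (U.transpose i ⬝ᵥ θ) ^ 2 ≤ D * (θ ⬝ᵥ θ))
    (hlow : ∀ θ, ∑ i, -1 * (g i ^ 2 - 1 + 2 * B i * g i) * (U.transpose i ⬝ᵥ θ) ^ 2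
      ≤ D * (θ ⬝ᵥ θ)) (θ : Fin p → ℝ) :
    (√(1 - D) - e) ^ 2 * (θ ⬝ᵥ θ)
        ≤ (U * Matrix.diagonal (B + g - r)).transpose.mulVec θ
          ⬝ᵥ (U * Matrix.diagonal (B + g - r)).transpose.mulVec θ ∧
      (U * Matrix.diagonal (B + g - r)).transpose.mulVec θ
          ⬝ᵥ (U * Matrix.diagonal (B + g - r)).transpose.mulVec θ
        ≤ (√(1 + b + D) + e) ^ 2 * (θ ⬝ᵥ θ) := by
  set c : Fin n → ℝ := U.transpose.mulVec θ with hc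
  have hD1 : 0 ≤ 1 - D := by
    by_contra! h
    rw [Real.sqrt_eq_zero_of_nonpos h.le] at hpos
    linarith
  have hcc : ∑ i, c i ^ 2 = θ ⬝ᵥ θ := by
    rw [← transpose_mulVec_dotProduct_self hU θ]
    simp only [dotProduct, ← hc, sq]
  have hci : ∀ i, U.transpose i ⬝ᵥ θ = c i := fun i => rfl
  set a : Fin n → ℝ := fun i => (B i + g i) * c i with ha
  set d : Fin n → ℝ := fun i => r i * c i with hd
  have hT : (U * Matrix.diagonal (B + g - r)).transpose.mulVec θ = a - d := by
    rw [Matrix.transpose_mul, Matrix.diagonal_transpose, ← Matrix.mulVec_mulVec, ← hc]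
    ext i
    simp only [Matrix.mulVec_diagonal, Pi.sub_apply, Pi.add_apply, ha, hd]
    ring
  set t := eucNorm θ with ht
  have ht0 : 0 ≤ t := eucNorm_nonneg θ
  have ht2 : θ ⬝ᵥ θ = t ^ 2 := (eucNorm_sq θ).symm
  have hup' := hup θ
  have hlow' := hlow θ
  simp only [hci] at hup' hlow'
  have hB2 : ∑ i, B i ^ 2 * c i ^ 2 ≤ b * t ^ 2 := by
    rw [← ht2, ← hcc, Finset.mul_sum]
    exact Finset.sum_le_sum fun i _ => mul_le_mul_of_nonneg_right (hB i) (sq_nonneg _)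
  have hB0 : 0 ≤ ∑ i, B i ^ 2 * c i ^ 2 := Finset.sum_nonneg fun i _ => by positivity
  have ha2 : eucNorm a ^ 2 = t ^ 2 + ∑ i, 1 * (g i ^ 2 - 1 + 2 * B i * g i) * c i ^ 2
      + ∑ i, B i ^ 2 * c i ^ 2 := by
    rw [eucNorm_sq, ← ht2, ← hcc, ← Finset.sum_add_distrib, ← Finset.sum_add_distrib]
    refine Finset.sum_congr rfl fun i _ => ?_
    simp only [ha]
    ring
  have hneg : ∑ i, -1 * (g i ^ 2 - 1 + 2 * B i * g i) * c i ^ 2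
      = -∑ i, 1 * (g i ^ 2 - 1 + 2 * B i * g i) * c i ^ 2 := by
    rw [← Finset.sum_neg_distrib]
    exact Finset.sum_congr rfl fun i _ => by ring
  rw [hneg] at hlow'
  rw [ht2] at hup' hlow'
  have hd2 : eucNorm d ≤ e * t := by
    refine (sq_le_sq₀ (eucNorm_nonneg _) (by positivity)).1 ?_
    rw [eucNorm_sq, mul_pow, ← ht2, ← hcc, Finset.mul_sum]
    refine Finset.sum_le_sum fun i _ => ?_
    have h1 : r i ^ 2 ≤ e ^ 2 := sq_le_sq' (abs_le.1 (hr i)).1 (abs_le.1 (hr i)).2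
    calc d i * d i = r i ^ 2 * c i ^ 2 := by simp only [hd]; ring
      _ ≤ e ^ 2 * c i ^ 2 := by gcongr
  have halow : √(1 - D) * t ≤ eucNorm a := by
    refine (sq_le_sq₀ (by positivity) (eucNorm_nonneg _)).1 ?_
    rw [mul_pow, Real.sq_sqrt hD1]
    linarith
  have haup : eucNorm a ≤ √(1 + b + D) * t := by
    refine (sq_le_sq₀ (eucNorm_nonneg _) (by positivity)).1 ?_
    rw [mul_pow, Real.sq_sqrt (by positivity)]
    linarith
  have htri1 : eucNorm a ≤ eucNorm (a - d) + eucNorm d := by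
    simpa using eucNorm_add_le (a - d) d
  have htri2 : eucNorm (a - d) ≤ eucNorm a + eucNorm d := by
    simpa [sub_eq_add_neg, eucNorm_neg] using eucNorm_add_le a (-d)
  rw [hT, ht2, ← eucNorm_sq (a - d), ← mul_pow, ← mul_pow]
  constructor
  · refine (sq_le_sq₀ (by positivity) (eucNorm_nonneg _)).2 ?_
    linarith
  · refine (sq_le_sq₀ (eucNorm_nonneg _) (by positivity)).2 ?_
    linarith

/-- With probability at least `1 - 3 e^{-x}`, the conditional covariance of the bootstrapped score
lies between `(√(1 - D) - e)²` and `(√(1 + b + D) + e)²` in the semidefinite order. -/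
theorem weightLaw_not_inflation_le {p n : ℕ} (hp : 1 ≤ p) {U : Matrix (Fin p) (Fin n) ℝ}
    (hU : U * U.transpose = 1) {δ : ℝ} (hδ : 0 < δ)
    (hUδ : ∀ i, U.transpose i ⬝ᵥ U.transpose i ≤ δ ^ 2) {R : Matrix (Fin n) (Fin n) ℝ}
    (hR : ∀ i, R i ⬝ᵥ R i ≤ δ ^ 2) {B : Fin n → ℝ} {b : ℝ} (hB : ∀ i, B i ^ 2 ≤ b) (hb : 0 ≤ b)
    {x L X D e : ℝ} (hx : 0 < x) (hX : X = x + Real.log n) (hL : L = x + Real.log (2 * p))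
    (hD : D = 2 * δ * √((1 + 2 * b) * L) + 2 * δ ^ 2 * L) (he : e = δ * √(2 * X))
    (hpos : 0 < √(1 - D) - e) :
    weightLaw n {g | ¬ ∀ θ,
      (√(1 - D) - e) ^ 2 * (θ ⬝ᵥ θ)
        ≤ (U * Matrix.diagonal (B + g - R.mulVec g)).transpose.mulVec θ
          ⬝ᵥ (U * Matrix.diagonal (B + g - R.mulVec g)).transpose.mulVec θ ∧
      (U * Matrix.diagonal (B + g - R.mulVec g)).transpose.mulVec θ
          ⬝ᵥ (U * Matrix.diagonal (B + g - R.mulVec g)).transpose.mulVec θ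
        ≤ (√(1 + b + D) + e) ^ 2 * (θ ⬝ᵥ θ)} ≤ ENNReal.ofReal (3 * Real.exp (-x)) := by
  have hp1 : (1 : ℝ) ≤ p := by exact_mod_cast hp
  have hL0 : 0 < L := by have := Real.log_nonneg (x := 2 * p) (by linarith); linarith
  have hn : 0 < n := by
    rcases Nat.eq_zero_or_pos n with rfl | h0
    · have := card_le_mul_sq_of_col_le hU hUδ
      norm_num at this
      linarith
    · exact h0
  have hX0 : 0 ≤ X := by
    have := Real.log_nonneg (x := n) (by exact_mod_cast hn)
    linarith
  have hD0 : 0 ≤ D := by rw [hD]; positivity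
  have he0 : 0 ≤ e := by rw [he]; positivity
  have hu : ∑ i, Matrix.vecMulVec (U.transpose i) (U.transpose i) = 1 := by
    rw [sum_vecMulVec_col, hU]
  have h1 := weightLaw_quadratic_deviation_le (fun i => U.transpose i) hu hδ hUδ B hB hL0
    (s := 1) (by simp)
  have h2 := weightLaw_quadratic_deviation_le (fun i => U.transpose i) hu hδ hUδ B hB hL0
    (s := -1) (by simp)
  rw [← hD] at h1 h2
  have h3 : weightLaw n (⋃ i, {g | e < |R i ⬝ᵥ g|})
      ≤ ENNReal.ofReal (n * (2 * Real.exp (-X))) := by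
    refine (measure_iUnion_fintype_le _ _).trans ?_
    refine (Finset.sum_le_sum fun i _ => he ▸ weightLaw_abs_dotProduct_le (R i) hδ (hR i) hX0).trans
      ?_
    rw [Finset.sum_const, Finset.card_univ, Fintype.card_fin, nsmul_eq_mul,
      ENNReal.ofReal_mul (p := (n : ℝ)) (by positivity), ENNReal.ofReal_natCast]
  have e1 : p * Real.exp (-L) = Real.exp (-x) / 2 := by
    rw [hL, neg_add, Real.exp_add, Real.exp_neg (Real.log _), Real.exp_log (by linarith)]
    field_simp
  have e3 : n * (2 * Real.exp (-X)) = 2 * Real.exp (-x) := by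
    have : (0 : ℝ) < n := by exact_mod_cast hn
    rw [hX, neg_add, Real.exp_add, Real.exp_neg (Real.log _), Real.exp_log this]
    field_simp
  rw [e1] at h1 h2
  rw [e3] at h3
  have hex := Real.exp_pos (-x)
  have htot := add_le_add (add_le_add h1 h2) h3
  rw [← ENNReal.ofReal_add (by positivity) (by positivity),
    ← ENNReal.ofReal_add (by positivity) (by positivity)] at htot
  refine le_trans ((measure_mono ?_).trans ((measure_union_le _ _).trans
    (add_le_add_left (measure_union_le _ _) _))) (htot.trans (le_of_eq (by congr 1; ring)))
  intro g hg
  by_contra hcon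
  simp only [Set.mem_union, Set.mem_iUnion, Set.mem_ofPred_eq, not_or, not_exists, not_lt] at hcon
  exact hg (inflation_of_deviation hU hB hD0 hb he0 hpos (fun i => hcon.2 i) hcon.1.1 hcon.1.2)

/-- The calibrated bootstrap quantiles in terms of the standardized noise `g`: the norms `‖A U g‖`
are compared with the quantiles of `‖A U diag(η) w‖`, where `η = B + g - R g`. -/
theorem weightLaw_exceed_calibrated_le {p n q : ℕ} {ι : Type*} {M : Finset ι} (hM : M.Nonempty)
    {A : ι → Matrix (Fin q) (Fin p) ℝ} (hA : ∀ m ∈ M, A m ≠ 0) (hp : 1 ≤ p)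
    {U : Matrix (Fin p) (Fin n) ℝ} (hU : U * U.transpose = 1) {δ : ℝ} (hδ : 0 < δ)
    (hUδ : ∀ i, U.transpose i ⬝ᵥ U.transpose i ≤ δ ^ 2) {R : Matrix (Fin n) (Fin n) ℝ}
    (hR : ∀ i, R i ⬝ᵥ R i ≤ δ ^ 2) (B : Fin n → ℝ) {x Δ : ℝ} (hx : 0 < x)
    (hΔ : ‖B‖ ^ 2 + 2 * δ * (x + Real.log n) + δ ^ 2 * (x + Real.log n)
      + 2 * δ * √(x + Real.log (2 * p)) + 2 * δ ^ 2 * (x + Real.log (2 * p)) ≤ Δ)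
    (h : 6 * Real.exp (-x) + √p * Δ < 1) :
    weightLaw n {g | ∃ m ∈ M, normQuantile (A m * (U * Matrix.diagonal (B + g - R.mulVec g)))
      (x + sInf {c | (weightLaw n).real {w | ∃ m ∈ M,
        normQuantile (A m * (U * Matrix.diagonal (B + g - R.mulVec g))) (x + c)
          ≤ eucNorm ((A m).mulVec
            ((U * Matrix.diagonal (B + g - R.mulVec g)).mulVec w))} ≤ Real.exp (-x)})
        ≤ eucNorm ((A m).mulVec (U.mulVec g))}
      ≤ ENNReal.ofReal (6 * Real.exp (-x) + √p * Δ) := by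
  set b := ‖B‖ ^ 2 with hb
  have hb0 : 0 ≤ b := sq_nonneg _
  have hB : ∀ i, B i ^ 2 ≤ b := fun i => by
    rw [hb, ← sq_abs]
    exact pow_le_pow_left₀ (abs_nonneg _) (norm_le_pi_norm B i) 2
  set X := x + Real.log n with hX
  set L := x + Real.log (2 * p) with hL
  set D := 2 * δ * √((1 + 2 * b) * L) + 2 * δ ^ 2 * L with hD
  set e := δ * √(2 * X) with he
  obtain ⟨hD1, hpos, hlog⟩ := sqrt_mul_log_inflation_le hp hδ hb0 hx
    (card_le_mul_sq_of_col_le hU hUδ) hX hL hΔ hD he h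
  have hbad := weightLaw_not_inflation_le hp hU hδ hUδ hR hB hb0 hx hX hL hD he hpos
  have hp1 : (1 : ℝ) ≤ p := by exact_mod_cast hp
  have hL0 : 0 < L := by have := Real.log_nonneg (x := 2 * p) (by linarith); linarith
  have hD0 : 0 ≤ D := by rw [hD]; positivity
  have he0 : 0 ≤ e := by rw [he]; positivity
  set αm := √(1 - D) - e with hαm
  set αp := √(1 + b + D) + e with hαp
  have hαm1 : αm ≤ 1 := by
    have : √(1 - D) ≤ 1 := Real.sqrt_le_one.2 (by linarith)
    linarith
  have hαp1 : 1 ≤ αp := by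
    have : 1 ≤ √(1 + b + D) := Real.one_le_sqrt.2 (by linarith)
    linarith
  have hαp0 : 0 < αp := by linarith
  have hmain := weightLaw_exists_deflated_quantile_le (x := x) hA hpos hαm1 hαp1 hx
  set E : Set (Fin p → ℝ) := {v | ∃ m ∈ M,
    αm * normQuantile (A m) (sInf (admissibleLevels M A αm αp x)) ≤ eucNorm ((A m).mulVec v)}
    with hE
  have hmap : (weightLaw n).map U.mulVec = weightLaw p := by
    rw [weightLaw_map_eq (1 : Matrix (Fin p) (Fin p) ℝ) U (by rw [hU]; simp)]
    have : (1 : Matrix (Fin p) (Fin p) ℝ).mulVec = id := funext Matrix.one_mulVec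
    rw [this, Measure.map_id]
  have hEn : weightLaw n (U.mulVec ⁻¹' E)
      ≤ ENNReal.ofReal (Real.exp (-x) + √(p / 2) * (Real.log αp - 2 * Real.log αm)) := by
    refine (Measure.le_map_apply (measurable_mulVec U).aemeasurable E).trans ?_
    rw [hmap, ← ofReal_measureReal]
    exact ENNReal.ofReal_le_ofReal hmain
  have hex := Real.exp_pos (-x)
  have hle : ENNReal.ofReal (3 * Real.exp (-x)) + ENNReal.ofReal (Real.exp (-x)
      + √(p / 2) * (Real.log αp - 2 * Real.log αm))
      ≤ ENNReal.ofReal (6 * Real.exp (-x) + √p * Δ) := by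
    rw [← ENNReal.ofReal_add (by positivity)]
    · exact ENNReal.ofReal_le_ofReal (by linarith)
    · have := Real.log_nonneg hαp1
      have := Real.log_nonpos hpos.le hαm1
      have : 0 ≤ Real.log αp - 2 * Real.log αm := by linarith
      positivity
  refine le_trans ((measure_mono ?_).trans ((measure_union_le _ _).trans
    (add_le_add hbad hEn))) hle
  rintro g ⟨m, hmM, hg⟩
  refine or_iff_not_imp_left.2 fun hgood => ?_
  have hgood' := not_not.1 hgood
  refine ⟨m, hmM, le_trans ?_ hg⟩
  exact mul_normQuantile_le_calibrated hM hA hpos hαp0 hx _ (fun θ => (hgood' θ).1)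
    (fun θ => (hgood' θ).2) m

/-! ### Standardization of the score and of the noise -/

lemma scoreCov_eq {p n : ℕ} (Ψ : Matrix (Fin p) (Fin n) ℝ) (σ : Fin n → ℝ) :
    scoreCov Ψ σ = Ψ * noiseSd σ * (Ψ * noiseSd σ).transpose := by
  rw [Matrix.transpose_mul, noiseSd, Matrix.diagonal_transpose, scoreCov, noiseCov]
  simp only [Matrix.mul_assoc]
  rw [← Matrix.mul_assoc (Matrix.diagonal σ), Matrix.diagonal_mul_diagonal]
  simp only [sq]

lemma posDef_scoreCov {p n : ℕ} {Ψ : Matrix (Fin p) (Fin n) ℝ} {σ : Fin n → ℝ}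
    (hS : IsUnit (scoreCov Ψ σ).det) : (scoreCov Ψ σ).PosDef := by
  have hpsd : (scoreCov Ψ σ).PosSemidef := by
    rw [scoreCov_eq, ← Matrix.conjTranspose_eq_transpose_of_trivial]
    exact Matrix.posSemidef_self_mul_conjTranspose _
  exact hpsd.posDef_iff_isUnit.2 ((Matrix.isUnit_iff_isUnit_det _).2 hS)

lemma transpose_invSqrt {p : ℕ} (S : Matrix (Fin p) (Fin p) ℝ) :
    (invSqrt S).transpose = invSqrt S := by
  have h : IsSelfAdjoint (invSqrt S) := cfc_predicate _ _
  rw [← Matrix.conjTranspose_eq_transpose_of_trivial]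
  exact h

lemma invSqrt_mul_mul_invSqrt {p : ℕ} {S : Matrix (Fin p) (Fin p) ℝ} (hS : S.PosDef) :
    invSqrt S * S * invSqrt S = 1 := by
  have hsa : IsSelfAdjoint S := hS.isHermitian
  have hcont : ∀ f : ℝ → ℝ, ContinuousOn f (spectrum ℝ S) := fun f =>
    (Matrix.finite_real_spectrum (A := S)).continuousOn f
  have hpos : ∀ t ∈ spectrum ℝ S, 0 < t := by
    intro t ht
    rw [hS.isHermitian.spectrum_real_eq_range_eigenvalues] at ht
    obtain ⟨i, rfl⟩ := ht
    exact hS.eigenvalues_pos i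
  have h1 : invSqrt S * S = cfc (fun t : ℝ => (√t)⁻¹ * t) S := by
    rw [cfc_mul (fun t : ℝ => (√t)⁻¹) (fun t => t) S (hcont _) (hcont _), cfc_id' ℝ S]
    rfl
  rw [h1, invSqrt, ← cfc_mul _ _ S (hcont _) (hcont _), ← cfc_one ℝ S]
  refine cfc_congr fun t ht => ?_
  have h2 := Real.sqrt_pos.2 (hpos t ht)
  have h3 := Real.mul_self_sqrt (hpos t ht).le
  simp only [Pi.one_apply]
  field_simp
  nlinarith

/-- The standardized design `S^{-1/2} Ψ Σ^{1/2}`, a matrix with orthonormal rows. -/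
noncomputable def stdDesign {p n : ℕ} (Ψ : Matrix (Fin p) (Fin n) ℝ) (σ : Fin n → ℝ) :
    Matrix (Fin p) (Fin n) ℝ :=
  invSqrt (scoreCov Ψ σ) * (Ψ * noiseSd σ)

lemma stdDesign_mul_transpose {p n : ℕ} {Ψ : Matrix (Fin p) (Fin n) ℝ} {σ : Fin n → ℝ}
    (hS : IsUnit (scoreCov Ψ σ).det) :
    stdDesign Ψ σ * (stdDesign Ψ σ).transpose = 1 := by
  have h := invSqrt_mul_mul_invSqrt (posDef_scoreCov hS)
  rw [stdDesign, Matrix.transpose_mul, transpose_invSqrt, Matrix.mul_assoc,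
    ← Matrix.mul_assoc (Ψ * noiseSd σ), ← scoreCov_eq, ← Matrix.mul_assoc, h]

lemma stdDesign_col_le {p n : ℕ} {Ψ : Matrix (Fin p) (Fin n) ℝ} {σ : Fin n → ℝ}
    (hσ : ∀ i, 0 < σ i) {δ : ℝ} (hδ : designReg Ψ σ ≤ δ) (i : Fin n) :
    (stdDesign Ψ σ).transpose i ⬝ᵥ (stdDesign Ψ σ).transpose i ≤ δ ^ 2 := by
  have h1 : (stdDesign Ψ σ).transpose i
      = σ i • (invSqrt (scoreCov Ψ σ)).mulVec fun j => Ψ j i := by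
    ext k
    rw [stdDesign, noiseSd, Matrix.transpose_apply, Matrix.mul_apply]
    simp only [Matrix.mul_diagonal, Pi.smul_apply, smul_eq_mul, Matrix.mulVec, dotProduct,
      Finset.mul_sum]
    exact Finset.sum_congr rfl fun j _ => by ring
  have h2 := (le_ciSup (Set.finite_range _).bddAbove i).trans hδ
  rw [← eucNorm_sq, h1, eucNorm_smul, abs_of_pos (hσ i), mul_comm]
  exact pow_le_pow_left₀ (mul_nonneg (eucNorm_nonneg _) (hσ i).le) h2 2

/-- Matrices that factor through the features, rescaled by the noise level, factor through the
standardized design. -/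
lemma exists_mul_stdDesign {p n q : ℕ} {Ψ : Matrix (Fin p) (Fin n) ℝ} {σ : Fin n → ℝ}
    (hS : IsUnit (scoreCov Ψ σ).det) (A : Matrix (Fin q) (Fin p) ℝ) :
    ∃ A' : Matrix (Fin q) (Fin p) ℝ, A' * stdDesign Ψ σ = A * Ψ * noiseSd σ := by
  refine ⟨A * (scoreCov Ψ σ * invSqrt (scoreCov Ψ σ)), ?_⟩
  have h : scoreCov Ψ σ * invSqrt (scoreCov Ψ σ) * invSqrt (scoreCov Ψ σ) = 1 := by
    rw [mul_eq_one_comm, ← Matrix.mul_assoc]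
    exact invSqrt_mul_mul_invSqrt (posDef_scoreCov hS)
  rw [stdDesign, Matrix.mul_assoc, ← Matrix.mul_assoc (_ * _) (invSqrt _), h, Matrix.one_mul,
    Matrix.mul_assoc]

lemma exists_estMat_eq {p n q : ℕ} (W : Matrix (Fin q) (Fin p) ℝ)
    {Ψ Ψm : Matrix (Fin p) (Fin n) ℝ} (h : ∃ L : Matrix (Fin p) (Fin p) ℝ, Ψm = L * Ψ) :
    ∃ A : Matrix (Fin q) (Fin p) ℝ, estMat W Ψm = A * Ψ := by
  obtain ⟨L, rfl⟩ := h
  exact ⟨W * (symPinv (L * Ψ * (L * Ψ).transpose) * L), by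
    simp only [estMat, Matrix.mul_assoc]⟩

lemma noiseSdInv_mul_noiseSd {n : ℕ} {σ : Fin n → ℝ} (hσ : ∀ i, 0 < σ i) :
    noiseSdInv σ * noiseSd σ = 1 := by
  rw [noiseSdInv, noiseSd, Matrix.diagonal_mul_diagonal, ← Matrix.diagonal_one]
  congr 1
  ext i
  exact inv_mul_cancel₀ (hσ i).ne'

/-- The presmoothed data in terms of the bias and of the standardized noise. -/
lemma presmoothed_add_noise {n : ℕ} {σ : Fin n → ℝ} (hσ : ∀ i, 0 < σ i)
    (Pi : Matrix (Fin n) (Fin n) ℝ) (f g : Fin n → ℝ) :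
    presmoothed σ Pi (f + (noiseSd σ).mulVec g)
      = presmoothed σ Pi f + g - (upsilon σ Pi).mulVec g := by
  have h : (noiseSdInv σ).mulVec ((noiseSd σ).mulVec g) = g := by
    rw [Matrix.mulVec_mulVec, noiseSdInv_mul_noiseSd hσ, Matrix.one_mulVec]
  simp only [presmoothed, upsilon, Matrix.mulVec_add, Matrix.mulVec_sub, ← Matrix.mulVec_mulVec, h]
  abel

lemma bootXi_eq {p n q : ℕ} {σ : Fin n → ℝ} (hσ : ∀ i, 0 < σ i)
    {K : Matrix (Fin q) (Fin n) ℝ} {A : Matrix (Fin q) (Fin p) ℝ} {U : Matrix (Fin p) (Fin n) ℝ}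
    (h : A * U = K * noiseSd σ) (Pi : Matrix (Fin n) (Fin n) ℝ) (y w : Fin n → ℝ) :
    bootXi K Pi y w = A.mulVec ((U * Matrix.diagonal (presmoothed σ Pi y)).mulVec w) := by
  have h1 : Matrix.diagonal (y - Pi.mulVec y)
      = noiseSd σ * Matrix.diagonal (presmoothed σ Pi y) := by
    rw [noiseSd, Matrix.diagonal_mul_diagonal]
    congr 1
    ext i
    rw [presmoothed, noiseSdInv, Matrix.mulVec_diagonal, mul_inv_cancel_left₀ (hσ i).ne']
  rw [bootXi, h1, Matrix.mulVec_mulVec, Matrix.mulVec_mulVec, ← Matrix.mul_assoc,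
    ← Matrix.mul_assoc, h]

lemma bootQuantile_eq {p n q : ℕ} {σ : Fin n → ℝ} (hσ : ∀ i, 0 < σ i)
    {K : Matrix (Fin q) (Fin n) ℝ} {A : Matrix (Fin q) (Fin p) ℝ} {U : Matrix (Fin p) (Fin n) ℝ}
    (h : A * U = K * noiseSd σ) (Pi : Matrix (Fin n) (Fin n) ℝ) (y : Fin n → ℝ) (t : ℝ) :
    bootQuantile K Pi y t = normQuantile (A * (U * Matrix.diagonal (presmoothed σ Pi y))) t := by
  simp only [bootQuantile, normQuantile, bootXi_eq hσ h, Matrix.mulVec_mulVec]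

lemma bootCorrection_eq {p n q : ℕ} {σ : Fin n → ℝ} (hσ : ∀ i, 0 < σ i) {M : Finset ℝ}
    {K : ℝ → ℝ → Matrix (Fin q) (Fin n) ℝ} {A : ℝ → Matrix (Fin q) (Fin p) ℝ}
    {U : Matrix (Fin p) (Fin n) ℝ} {m₀ : ℝ}
    (h : ∀ m ∈ M, A m * U = K m m₀ * noiseSd σ) (Pi : Matrix (Fin n) (Fin n) ℝ) (y : Fin n → ℝ)
    (x : ℝ) :
    bootCorrection M K Pi y m₀ x = sInf {c | (weightLaw n).real {w | ∃ m ∈ M.filter (m₀ < ·),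
      normQuantile (A m * (U * Matrix.diagonal (presmoothed σ Pi y))) (x + c)
        ≤ eucNorm ((A m).mulVec ((U * Matrix.diagonal (presmoothed σ Pi y)).mulVec w))}
          ≤ Real.exp (-x)} := by
  simp only [bootCorrection, bootExceed]
  congr 1
  ext c
  simp only [Set.mem_ofPred_eq]
  rw [iff_iff_eq]
  congr 2
  ext w
  simp only [Set.mem_iUnion, Set.mem_ofPred_eq, exists_prop]
  refine exists_congr fun m => and_congr_right fun hm => ?_
  have hmM := h m (Finset.mem_filter.1 hm).1
  rw [bootXi_eq hσ hmM, bootQuantile_eq hσ hmM]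

/-- Standardizing independent Gaussian variables gives a standard Gaussian vector. -/
lemma map_standardize {Ω : Type*} [MeasurableSpace Ω] {P : Measure Ω} [IsProbabilityMeasure P]
    {n : ℕ} {Y : Fin n → Ω → ℝ} {f σ : Fin n → ℝ} (hσ : ∀ i, 0 < σ i) (hindep : iIndepFun Y P)
    (hlaw : ∀ i, HasLaw (Y i) (gaussianReal (f i) (Real.toNNReal (σ i ^ 2))) P) :
    AEMeasurable (fun ω i => (Y i ω - f i) / σ i) P ∧
      P.map (fun ω i => (Y i ω - f i) / σ i) = weightLaw n := by
  have h1 : ∀ i, HasLaw (fun ω => (Y i ω - f i) / σ i) (gaussianReal 0 1) P := by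
    intro i
    have h := gaussianReal_div_const (gaussianReal_sub_const (hlaw i) (f i)) (σ i)
    convert h using 2
    · simp
    · have : σ i ^ 2 ≠ 0 := pow_ne_zero 2 (hσ i).ne'
      ext
      simp [Real.coe_toNNReal _ (sq_nonneg (σ i)), this]
  have hm : ∀ i, AEMeasurable (fun ω => (Y i ω - f i) / σ i) P := fun i => (h1 i).aemeasurable
  refine ⟨aemeasurable_pi_lambda _ hm, ?_⟩
  have hind : iIndepFun (fun i ω => (Y i ω - f i) / σ i) P :=
    hindep.comp (fun i y => (y - f i) / σ i) fun i => by fun_prop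
  rw [(iIndepFun_iff_map_fun_eq_pi_map hm).1 hind, weightLaw]
  congr 1
  ext1 i
  exact (h1 i).map_eq

lemma errorTerm_nonneg {n p : ℕ} (B : Fin n → ℝ) {δ x : ℝ} (hδ : 0 ≤ δ) (hx : 0 < x) :
    0 ≤ errorTerm n p B δ x := by
  have h1 : ∀ k : ℕ, 0 ≤ Real.log k := fun k => Real.log_natCast_nonneg k
  have h2 := h1 n
  have h3 := h1 (2 * p)
  push_cast at h3
  have := eucNorm_nonneg B
  unfold errorTerm
  positivity

end SmA

theorem mainTheorem2 {Ω : Type*} [MeasurableSpace Ω] (P : Measure Ω) [IsProbabilityMeasure P]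
    {n p q : ℕ}
    -- the data: independent components, `Y i ~ N(f i, σ i ^ 2)`
    (Y : Fin n → Ω → ℝ) (f σ : Fin n → ℝ) (hσ : ∀ i, 0 < σ i)
    (hindep : iIndepFun Y P)
    (hlaw : ∀ i, HasLaw (Y i) (gaussianReal (f i) (Real.toNNReal (σ i ^ 2))) P)
    -- the feature matrix, the weighting matrix, the models and their feature matrices
    (Ψ : Matrix (Fin p) (Fin n) ℝ) (hS : IsUnit (SmA.scoreCov Ψ σ).det)
    (W : Matrix (Fin q) (Fin p) ℝ)
    (M : Finset ℝ) (Ψs : ℝ → Matrix (Fin p) (Fin n) ℝ)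
    (hΨs : ∀ m ∈ M, ∃ L : Matrix (Fin p) (Fin p) ℝ, Ψs m = L * Ψ)
    -- the presmoothing operator
    (Pi : Matrix (Fin n) (Fin n) ℝ)
    (hnoise : SmA.noiseDev P σ Pi (fun ω i => Y i ω - f i) ≤ 1)
    -- design regularity and regularity of the rows of `Υ`
    (δ : ℝ) (hdesign : SmA.designReg Ψ σ ≤ δ)
    (hrows : ∀ i, SmA.eucNorm (SmA.upsilon σ Pi i) ≤ δ)
    (x : ℝ) (hx : 0 < x)
    (m₀ : ℝ) (hm₀ : m₀ ∈ M)
    -- the distributions of `‖ξ_{m,m₀}‖` are continuous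
    (hne : ∀ m ∈ M, m₀ < m → SmA.estDiff W Ψs m m₀ ≠ 0) :
    P.real {ω | ∃ m ∈ M, m₀ < m ∧
        0 ≤ SmA.eucNorm ((SmA.estDiff W Ψs m m₀).mulVec fun i => Y i ω - f i)
          - SmA.bootQuantile (SmA.estDiff W Ψs m m₀) Pi (fun i => Y i ω)
              (x + SmA.bootCorrection M (SmA.estDiff W Ψs) Pi (fun i => Y i ω) m₀ x)}
      ≤ 6 * Real.exp (-x)
        + Real.sqrt p * SmA.errorTerm n p (SmA.presmoothed σ Pi f) δ x := by
  set B := SmA.presmoothed σ Pi f with hB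
  set RHS := 6 * Real.exp (-x) + Real.sqrt p * SmA.errorTerm n p B δ x with hRHS
  have hex := Real.exp_pos (-x)
  -- for `n = 0` the supremum in `designReg` is over the empty set and vanishes
  have hδ0 : 0 ≤ δ := by
    rcases Nat.eq_zero_or_pos n with rfl | hn
    · refine le_trans (le_of_eq ?_) hdesign
      rw [SmA.designReg, Real.iSup_of_isEmpty]
    · exact (SmA.eucNorm_nonneg _).trans (hrows ⟨0, hn⟩)
  have hΔ0 : 0 ≤ SmA.errorTerm n p B δ x := SmA.errorTerm_nonneg B hδ0 hx
  have hRHS0 : 0 ≤ RHS := by positivity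
  -- a bound by a number at least one is trivial
  rcases le_or_gt 1 RHS with h1 | h1
  · exact measureReal_le_one.trans h1
  rcases (M.filter (m₀ < ·)).eq_empty_or_nonempty with hM | hM
  · refine le_trans (le_of_eq ?_) hRHS0
    rw [← measureReal_empty (μ := P)]
    congr 1
    refine Set.eq_empty_of_forall_notMem ?_
    rintro ω ⟨m, hm, hlt, -⟩
    exact Finset.notMem_empty m (hM ▸ Finset.mem_filter.2 ⟨hm, hlt⟩)
  set U := SmA.stdDesign Ψ σ with hU
  have hUU : U * U.transpose = 1 := SmA.stdDesign_mul_transpose hS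
  have hUδ := SmA.stdDesign_col_le (Ψ := Ψ) hσ hdesign
  have hA : ∀ m, ∃ A : Matrix (Fin q) (Fin p) ℝ,
      m ∈ M → A * U = SmA.estDiff W Ψs m m₀ * SmA.noiseSd σ := by
    intro m
    by_cases hm : m ∈ M
    · obtain ⟨A₁, h₁⟩ := SmA.exists_estMat_eq W (hΨs m hm)
      obtain ⟨A₂, h₂⟩ := SmA.exists_estMat_eq W (hΨs m₀ hm₀)
      obtain ⟨A, h⟩ := SmA.exists_mul_stdDesign hS (A₁ - A₂)
      refine ⟨A, fun _ => ?_⟩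
      rw [h, SmA.estDiff, h₁, h₂, Matrix.sub_mul A₁ A₂ Ψ]
    · exact ⟨0, fun h => absurd h hm⟩
  choose A hA using hA
  have hAne : ∀ m ∈ M.filter (m₀ < ·), A m ≠ 0 := by
    intro m hm h0
    obtain ⟨hmM, hlt⟩ := Finset.mem_filter.1 hm
    refine hne m hmM hlt ?_
    have h2 := hA m hmM
    rw [h0, Matrix.zero_mul] at h2
    have h3 : SmA.noiseSd σ * SmA.noiseSdInv σ = 1 :=
      mul_eq_one_comm.1 (SmA.noiseSdInv_mul_noiseSd hσ)
    calc SmA.estDiff W Ψs m m₀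
        = SmA.estDiff W Ψs m m₀ * SmA.noiseSd σ * SmA.noiseSdInv σ := by
          rw [Matrix.mul_assoc, h3, Matrix.mul_one]
      _ = 0 := by rw [← h2, Matrix.zero_mul]
  have hp : 1 ≤ p := by
    by_contra! hp
    obtain rfl : p = 0 := by omega
    obtain ⟨m, hm⟩ := hM
    exact hAne m hm (Subsingleton.elim _ _)
  have hδ : 0 < δ := by
    refine lt_of_le_of_ne hδ0 fun h => ?_
    have h2 := SmA.card_le_mul_sq_of_col_le hUU hUδ
    have hp1 : (1 : ℝ) ≤ p := by exact_mod_cast hp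
    rw [← h] at h2
    norm_num at h2
    linarith
  have hR : ∀ i, SmA.upsilon σ Pi i ⬝ᵥ SmA.upsilon σ Pi i ≤ δ ^ 2 := fun i => by
    rw [← SmA.eucNorm_sq]
    exact pow_le_pow_left₀ (SmA.eucNorm_nonneg _) (hrows i) 2
  have hmain := SmA.weightLaw_exceed_calibrated_le hM hAne hp hUU hδ hUδ hR B
    (Δ := SmA.errorTerm n p B δ x) hx (by
      have : 0 ≤ δ ^ 2 * SmA.eucNorm B * Real.sqrt (2 * x) := by
        have := SmA.eucNorm_nonneg B
        positivity
      rw [SmA.errorTerm]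
      linarith) h1
  obtain ⟨hmeas, hmap⟩ := SmA.map_standardize hσ hindep hlaw
  -- the exceedance set need not be known to be measurable: `Measure.le_map_apply` suffices
  refine ENNReal.toReal_le_of_le_ofReal hRHS0 (le_trans (measure_mono ?_)
    ((Measure.le_map_apply hmeas _).trans
      ((congrFun (congrArg DFunLike.coe hmap) _).le.trans hmain)))
  rintro ω ⟨m, hm, hlt, hω⟩
  set g : Fin n → ℝ := fun i => (Y i ω - f i) / σ i with hg
  have hnoise_eq : (fun i => Y i ω - f i) = (SmA.noiseSd σ).mulVec g := by
    ext i
    rw [SmA.noiseSd, Matrix.mulVec_diagonal, hg]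
    exact (mul_div_cancel₀ _ (hσ i).ne').symm
  have hY : (fun i => Y i ω) = f + (SmA.noiseSd σ).mulVec g := by
    rw [← hnoise_eq]
    ext i
    simp
  refine ⟨m, Finset.mem_filter.2 ⟨hm, hlt⟩, ?_⟩
  rw [sub_nonneg, SmA.bootQuantile_eq hσ (hA m hm), SmA.bootCorrection_eq hσ hA, hY,
    SmA.presmoothed_add_noise hσ, hnoise_eq, Matrix.mulVec_mulVec, ← hA m hm,
    ← Matrix.mulVec_mulVec] at hω
  exact hω
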